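/- Let $n\ge 2$, let $K\neq\mathbb{Q}$ be a totally real number field with a fixed embedding $\sigma\colon K\to\mathbb{R}$, and let $f$ be a quadratic form on $K^{n+1}$ such that $f^{\sigma}$ has signature $(n,1)$ and $f^{\tau}$ is definite for every embedding $\tau\neq\sigma$ of $K$ into $\mathbb{R}$ (an admissible pair $(K,f)$). Let $\mathbb{H}^n$ be the hyperbolic space of negative lines of $f^\sigma$, with isometry group $\mathrm{PO}_f(\mathbb{R})=\mathrm{O}_f(\mathbb{R})/\{\pm1\}$; for a subring $R$ of $K$ let $\mathrm{PO}_f(R)$ be the image of $\mathrm{O}_f(R)$ in it. Let $\Lambda\le \mathrm{PO}_f(\mathcal{O}_K)$ be a torsion-free subgroup such that $N=\Lambda\backslash\mathbb{H}^n$ is compact. Let $H_0=v_0^{\perp}$ and $H_1=v_1^{\perp}$ be hyperplanes of $\mathbb{H}^n$ with $v_i\in K^{n+1}$, $f(v_i)>0$ ($K$-rational hyperplanes), whose images $N_0$ and $N_1$ in $N$ are embedded and disjoint, and assume that the interior of the common perpendicular segment $c$ of $H_0$ and $H_1$ does not meet any $\Lambda$-translate of $H_0$ or $H_1$. Let $C$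 be the connected component of $\mathbb{H}^n\setminus\bigcup_{\lambda\in\Lambda}\lambda(H_0\cup H_1)$ containing the interior of $c$, let $\Gamma_1=\{\gamma\in\Lambda:\gamma C=C\}$, and let $M'=\Gamma_1\backslash\overline{C}$; this is the component containing the image of $c$ of the manifold obtained by cutting $N$ along $N_0$ and $N_1$. Let $M$ be the double of $M'$ along its boundary, with its hyperbolic metric, and let $\Gamma<\mathrm{PO}_f(\mathbb{R})$ be a discrete subgroup acting freely on $\mathbb{H}^n$ such that $\Gamma\backslash\mathbb{H}^n$ is isometric to $M$. Then: 1. $\partial M'$ has $\ell$ connected components with $2\le \ell\le 4$. Hence there are lifts $H_0,H_1,\dots,H_{\ell-1}\subset\partial C$ of these components, one for each component, beginning with the given $H_0$ and $H_1$ and each a $\Lambda$-translate of $H_0$ or of $H_1$. 2. $\Gamma_1\subset \mathrm{PO}_f(K)$, and after conjugating $\Gamma$ in $\mathrm{PO}_f(\mathbb{R})$ so that the covering $\mathbb{H}^n\to M$ restricts on $\overline{C}$ to the projection of $\overline C$ onto the first copy of $M'$ in $M$ (which is possible), one has $\Gamma\subset\mathrm{PO}_f(K)$. Moreover, for every choice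 of lifts as in 1, each $H_j$ is a $K$-rational hyperplane, the reflection $I_j$ in $H_j$ belongs to $\mathrm{PO}_f(K)$, and $$\Gamma=\left\langle\, \Gamma_1,\quad I_0^{-1}\Gamma_1 I_0,\quad I_j^{-1}I_0\ \ (1\le j\le \ell-1)\,\right\rangle .$$ 3. $\Gamma$ is a quasi-arithmetic lattice: it is a lattice in $G=\mathrm{PO}_f(\mathbb{R})$, and there are a linear algebraic group $\mathbf{G}$ over $\mathbb{Q}$ and a continuous surjective homomorphism $\phi\colon\mathbf{G}(\mathbb{R})^{\circ}\to G^{\circ}$ with compact kernel such that some subgroup of finite index in $\Gamma$ is contained in $\phi(\mathbf{G}(\mathbb{Q})\cap\mathbf{G}(\mathbb{R})^{\circ})$. -/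

import Mathlib

open scoped Pointwise MatrixGroups

noncomputable section

namespace Doubling

/-! ## The hyperboloid model of a real form of signature `(n, 1)` -/

/-- The symmetric bilinear form `xᵀ S y`; the quadratic form is `x ↦ bil S x x`. -/
def bil {R : Type*} [CommRing R] {n : ℕ} (S : Matrix (Fin (n + 1)) (Fin (n + 1)) R)
    (x y : Fin (n + 1) → R) : R :=
  x ⬝ᵥ S.mulVec y

/-- `S` has signature `(n, 1)`: it is congruent over `ℝ` to `diag(-1, 1, …, 1)`. -/
def HasLorentzSignature {n : ℕ} (S : Matrix (Fin (n + 1)) (Fin (n + 1)) ℝ) : Prop :=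
  ∃ P : GL (Fin (n + 1)) ℝ,
    (P : Matrix _ _ ℝ).transpose * S * (P : Matrix _ _ ℝ) =
      Matrix.diagonal (Fin.cons (-1) (fun _ => 1))

/-- Hyperbolic space of the form `S`: the sheet of `{x | xᵀ S x = -1}` singled out by the negative
vector `e`. Every negative line contains exactly one point of it, so that this is the space of
negative lines. -/
def hypSet {n : ℕ} (S : Matrix (Fin (n + 1)) (Fin (n + 1)) ℝ) (e : Fin (n + 1) → ℝ) :
    Set (Fin (n + 1) → ℝ) :=
  {x | bil S x x = -1 ∧ bil S x e < 0}

/-- Hyperbolic space as a type, with the topology induced from `ℝⁿ⁺¹`. -/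
abbrev Hyp {n : ℕ} (S : Matrix (Fin (n + 1)) (Fin (n + 1)) ℝ) (e : Fin (n + 1) → ℝ) : Type :=
  ↥(hypSet S e)

/-- The hyperbolic distance, `cosh d(x, y) = - (x, y)`. -/
def hdist {n : ℕ} {S : Matrix (Fin (n + 1)) (Fin (n + 1)) ℝ} {e : Fin (n + 1) → ℝ}
    (x y : Hyp S e) : ℝ :=
  Real.arcosh (-bil S x.1 y.1)

/-- The isometry group `PO_S(ℝ) = O_S(ℝ) / {±1}` of hyperbolic space: every class `{g, -g}` is
represented by its unique member that preserves the sheet. -/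
def PO {n : ℕ} (S : Matrix (Fin (n + 1)) (Fin (n + 1)) ℝ) (e : Fin (n + 1) → ℝ) :
    Subgroup (GL (Fin (n + 1)) ℝ) where
  carrier := {g | (g : Matrix _ _ ℝ).transpose * S * (g : Matrix _ _ ℝ) = S ∧
    ∀ x, (g : Matrix _ _ ℝ).mulVec x ∈ hypSet S e ↔ x ∈ hypSet S e}
  one_mem' := by simp
  mul_mem' := by
    rintro a b ⟨ha, ha'⟩ ⟨hb, hb'⟩
    refine ⟨?_, fun x => ?_⟩
    · calc ((a * b : GL (Fin (n + 1)) ℝ) : Matrix _ _ ℝ).transpose * S *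
            ((a * b : GL (Fin (n + 1)) ℝ) : Matrix _ _ ℝ)
          = (b : Matrix _ _ ℝ).transpose *
              ((a : Matrix _ _ ℝ).transpose * S * (a : Matrix _ _ ℝ)) * (b : Matrix _ _ ℝ) := by
            simp only [Units.val_mul, Matrix.transpose_mul, Matrix.mul_assoc]
        _ = S := by rw [ha, hb]
    · rw [Units.val_mul, ← Matrix.mulVec_mulVec, ha', hb']
  inv_mem' := by
    rintro a ⟨ha, ha'⟩
    have h1 : a.1 * (a⁻¹).1 = 1 := Units.mul_inv a
    have h2 : (a⁻¹).1.transpose * a.1.transpose = 1 := by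
      rw [← Matrix.transpose_mul, h1, Matrix.transpose_one]
    refine ⟨?_, fun x => ?_⟩
    · calc (a⁻¹).1.transpose * S * (a⁻¹).1
          = (a⁻¹).1.transpose * (a.1.transpose * S * a.1) * (a⁻¹).1 := by rw [ha]
        _ = ((a⁻¹).1.transpose * a.1.transpose) * S * (a.1 * (a⁻¹).1) := by
            simp only [Matrix.mul_assoc]
        _ = S := by rw [h1, h2, Matrix.one_mul, Matrix.mul_one]
    · rw [← ha', Matrix.mulVec_mulVec, h1, Matrix.one_mulVec]

/-- The action of `PO_S(ℝ)` on hyperbolic space. -/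
instance instMulActionPO {n : ℕ} (S : Matrix (Fin (n + 1)) (Fin (n + 1)) ℝ)
    (e : Fin (n + 1) → ℝ) : MulAction ↥(PO S e) (Hyp S e) where
  smul g x := ⟨(g.1 : Matrix _ _ ℝ).mulVec x.1, (g.2.2 x.1).2 x.2⟩
  one_smul x := Subtype.ext (Matrix.one_mulVec x.1)
  mul_smul g h x := Subtype.ext (Matrix.mulVec_mulVec x.1 g.1.1 h.1.1).symm

/-- The subgroup `PO_S(R)` of the isometries with coefficients in a ring `R → ℝ`, the image of
`O_S(R)` in `PO_S(ℝ)`. -/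
def POover {n : ℕ} (S : Matrix (Fin (n + 1)) (Fin (n + 1)) ℝ) (e : Fin (n + 1) → ℝ)
    {R : Type*} [CommRing R] (i : R →+* ℝ) : Subgroup ↥(PO S e) :=
  (Matrix.GeneralLinearGroup.map (n := Fin (n + 1)) i).range.subgroupOf (PO S e)

/-- The hyperplane of hyperbolic space orthogonal to `v`. -/
def hyperplane {n : ℕ} (S : Matrix (Fin (n + 1)) (Fin (n + 1)) ℝ) (e : Fin (n + 1) → ℝ)
    (v : Fin (n + 1) → ℝ) : Set (Hyp S e) :=
  {x | bil S v x.1 = 0}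

/-- `g` is the reflection in the hyperplane `H`: the nontrivial isometry fixing `H` pointwise. -/
def IsReflectionIn {n : ℕ} {S : Matrix (Fin (n + 1)) (Fin (n + 1)) ℝ} {e : Fin (n + 1) → ℝ}
    (g : ↥(PO S e)) (H : Set (Hyp S e)) : Prop :=
  g ≠ 1 ∧ ∀ x ∈ H, g • x = x

/-! ## Admissible pairs -/

/-- `(K, A)` is admissible at the real place `σ`: the quadratic form with symmetric matrix `A` has
signature `(n, 1)` at `σ` and is (positive or negative) definite at all the other real places. -/
def IsAdmissiblePair {n : ℕ} {K : Type*} [Field K] (σ : K →+* ℝ)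
    (A : Matrix (Fin (n + 1)) (Fin (n + 1)) K) : Prop :=
  A.IsSymm ∧ HasLorentzSignature (A.map σ) ∧
    ∀ τ : K →+* ℝ, τ ≠ σ → (A.map τ).PosDef ∨ (-(A.map τ)).PosDef

/-! ## Quotient metrics and doubles -/

/-- The quotient distance: the infimum of the distances between representatives. -/
def quotDist {X : Type*} (s : Setoid X) (d : X → X → ℝ) (a b : Quotient s) : ℝ :=
  sInf {r | ∃ x y : X, Quotient.mk s x = a ∧ Quotient.mk s y = b ∧ r = d x y}

/-- Two copies of `X`, with the two copies of each point of `B` identified. -/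
def doubleSetoid {X : Type*} (B : Set X) : Setoid (X × Bool) where
  r a b := a.1 = b.1 ∧ (a.2 = b.2 ∨ a.1 ∈ B)
  iseqv :=
    { refl := fun _ => ⟨rfl, Or.inl rfl⟩
      symm := by
        rintro ⟨a, i⟩ ⟨b, j⟩ ⟨h, h'⟩
        simp only at h h'
        subst h
        exact ⟨rfl, h'.imp Eq.symm id⟩
      trans := by
        rintro ⟨a, i⟩ ⟨b, j⟩ ⟨c, k⟩ ⟨h, h'⟩ ⟨h2, h2'⟩
        simp only at h h' h2 h2'
        subst h
        subst h2
        refine ⟨rfl, ?_⟩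
        rcases h' with rfl | h'
        · exact h2'
        · exact Or.inr h' }

/-- The double of `X` along `B`. -/
abbrev Double {X : Type*} (B : Set X) : Type _ := Quotient (doubleSetoid B)

/-- The distance on the double obtained by gluing two copies of `(X, d)` along `B`: points of the
same copy keep their distance, and one passes from one copy to the other through a point of `B`. -/
def doubleDist {X : Type*} (B : Set X) (d : X → X → ℝ) (u v : Double B) : ℝ :=
  sInf {r | ∃ (a b : X) (i j : Bool), Quotient.mk (doubleSetoid B) (a, i) = u ∧
    Quotient.mk (doubleSetoid B) (b, j) = v ∧
    ((i = j ∧ r = d a b) ∨ ∃ z ∈ B, r = d a z + d z b)}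

/-! ## The piece `M'` and its double `M` -/

section Construction

variable {n : ℕ} {S : Matrix (Fin (n + 1)) (Fin (n + 1)) ℝ} {e : Fin (n + 1) → ℝ}

/-- The image of `H` in `Λ\ℍⁿ` is embedded: the translates of `H` are equal to `H` or disjoint
from it. -/
def EmbeddedIn (Λ : Subgroup ↥(PO S e)) (H : Set (Hyp S e)) : Prop :=
  ∀ g ∈ Λ, g • H = H ∨ Disjoint (g • H) H

/-- The preimage in `ℍⁿ` of the union of the images of `H₀` and `H₁` in `Λ\ℍⁿ`. -/
def arrangement (Λ : Subgroup ↥(PO S e)) (H₀ H₁ : Set (Hyp S e)) : Set (Hyp S e) :=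
  {x | ∃ g ∈ Λ, x ∈ g • H₀ ∨ x ∈ g • H₁}

/-- The open geodesic segment between `p` and `q`. -/
def openGeodesic (p q : Hyp S e) : Set (Hyp S e) :=
  {x | ∃ s t : ℝ, 0 < s ∧ 0 < t ∧ x.1 = s • p.1 + t • q.1}

/-- The component of the complement of `T` that contains the connected set `c`. -/
def componentOf (T c : Set (Hyp S e)) : Set (Hyp S e) :=
  {y | ∃ x ∈ c, y ∈ connectedComponentIn Tᶜ x}

/-- The stabiliser in `Λ` of the region `C`. -/
def pieceGroup (Λ : Subgroup ↥(PO S e)) (C : Set (Hyp S e)) : Subgroup ↥(PO S e) :=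
  Λ ⊓ MulAction.stabilizer ↥(PO S e) C

/-- The equivalence of points of the closure of `C` under the group `Γ₁`. -/
def pieceSetoid (Γ₁ : Subgroup ↥(PO S e)) (C : Set (Hyp S e)) : Setoid ↥(closure C) where
  r x y := ∃ g ∈ Γ₁, g • (x : Hyp S e) = (y : Hyp S e)
  iseqv :=
    { refl := fun x => ⟨1, Γ₁.one_mem, one_smul _ _⟩
      symm := by
        rintro x y ⟨g, hg, h⟩
        exact ⟨g⁻¹, Γ₁.inv_mem hg, by rw [← h, inv_smul_smul]⟩
      trans := by
        rintro x y z ⟨g, hg, h⟩ ⟨k, hk, h'⟩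
        exact ⟨k * g, Γ₁.mul_mem hk hg, by rw [mul_smul, h, h']⟩ }

/-- The manifold with boundary `M' = Γ₁ \ closure C`, where `Γ₁` is the stabiliser of `C` in `Λ`.
If `C` is a component of the preimage in `ℍⁿ` of the complement of closed hypersurfaces of
`Λ\ℍⁿ`, this is the corresponding component of `Λ\ℍⁿ` cut along these hypersurfaces
(a hypersurface may contribute two boundary components). -/
abbrev Piece (Λ : Subgroup ↥(PO S e)) (C : Set (Hyp S e)) : Type :=
  Quotient (pieceSetoid (pieceGroup Λ C) C)

/-- The boundary of `M'`. -/
def pieceBoundary (Λ : Subgroup ↥(PO S e)) (C : Set (Hyp S e)) : Set (Piece Λ C) :=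
  {a | ∃ x : ↥(closure C), (x : Hyp S e) ∈ frontier C ∧ Quotient.mk _ x = a}

/-- The distance of `M'`. -/
def pieceDist (Λ : Subgroup ↥(PO S e)) (C : Set (Hyp S e)) : Piece Λ C → Piece Λ C → ℝ :=
  quotDist (pieceSetoid (pieceGroup Λ C) C) (fun x y => hdist (x : Hyp S e) (y : Hyp S e))

/-- The double `M` of `M'` along its boundary. -/
abbrev DoubledManifold (Λ : Subgroup ↥(PO S e)) (C : Set (Hyp S e)) : Type :=
  Double (pieceBoundary Λ C)

/-- The distance of the double `M`. -/
def doubledManifoldDist (Λ : Subgroup ↥(PO S e)) (C : Set (Hyp S e)) :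
    DoubledManifold Λ C → DoubledManifold Λ C → ℝ :=
  doubleDist (pieceBoundary Λ C) (pieceDist Λ C)

/-- The projection of the closure of `C` to the first of the two copies of `M'` in `M`. -/
def toFirstCopy (Λ : Subgroup ↥(PO S e)) (C : Set (Hyp S e)) (x : ↥(closure C)) :
    DoubledManifold Λ C :=
  Quotient.mk (doubleSetoid (pieceBoundary Λ C))
    (Quotient.mk (pieceSetoid (pieceGroup Λ C) C) x, false)

/-- `M = Γ\ℍⁿ` as hyperbolic manifolds: `Γ` is discrete and acts freely on `ℍⁿ`, and `F` is an
isometry from `Γ\ℍⁿ` to the double `M`. -/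
structure Uniformizes (Λ : Subgroup ↥(PO S e)) (C : Set (Hyp S e)) (Γ : Subgroup ↥(PO S e))
    (F : Quotient (MulAction.orbitRel ↥Γ (Hyp S e)) ≃ DoubledManifold Λ C) : Prop where
  discrete : DiscreteTopology ↥Γ
  free : ∀ g ∈ Γ, ∀ x : Hyp S e, g • x = x → g = 1
  isometric : ∀ a b, doubledManifoldDist Λ C (F a) (F b) =
    quotDist (MulAction.orbitRel ↥Γ (Hyp S e)) hdist a b

/-- `H` lists lifts to the boundary of `C` of the connected components of the boundary of `M'`,
one lift for each component, starting with the lifts `H₀` and `H₁`; the lifts are translates of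
`H₀` and `H₁` by elements of `Λ`. -/
structure IsBoundarySystem (Λ : Subgroup ↥(PO S e)) (H₀ H₁ C : Set (Hyp S e)) {m : ℕ}
    (H : Fin (m + 2) → Set (Hyp S e)) : Prop where
  zero : H 0 = H₀
  one : H 1 = H₁
  translate : ∀ j, ∃ g ∈ Λ, H j = g • H₀ ∨ H j = g • H₁
  subset_frontier : ∀ j, H j ⊆ frontier C
  existsUnique : ∀ x ∈ frontier C, ∃! j, ∃ g ∈ pieceGroup Λ C, g • x ∈ H j

end Construction

/-! ## Quasi-arithmetic lattices -/

/-- A linear algebraic group defined over `ℚ`: a subgroup of `GL_N(ℂ)` that is the set of zeros of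
polynomials with rational coefficients in the matrix entries. -/
structure RatAlgGroup where
  N : ℕ
  equations : Set (MvPolynomial (Fin N × Fin N) ℚ)
  points : Subgroup (GL (Fin N) ℂ)
  mem_points : ∀ g : GL (Fin N) ℂ, g ∈ points ↔
    ∀ p ∈ equations, MvPolynomial.aeval (fun k : Fin N × Fin N => g.1 k.1 k.2) p = 0

/-- The real points `𝔾(ℝ)`. -/
def RatAlgGroup.realPoints (𝔾 : RatAlgGroup) : Subgroup (GL (Fin 𝔾.N) ℝ) :=
  𝔾.points.comap (Matrix.GeneralLinearGroup.map (algebraMap ℝ ℂ))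

/-- The identity component `𝔾(ℝ)°` of the real points. -/
abbrev RatAlgGroup.realComponent (𝔾 : RatAlgGroup) : Subgroup ↥𝔾.realPoints :=
  Subgroup.connectedComponentOfOne ↥𝔾.realPoints

/-- A real point is rational if its matrix has rational entries. -/
def RatAlgGroup.IsRational (𝔾 : RatAlgGroup) (x : ↥𝔾.realPoints) : Prop :=
  ∃ q : GL (Fin 𝔾.N) ℚ, Matrix.GeneralLinearGroup.map (algebraMap ℚ ℝ) q = x.1

/-- `Γ` is a lattice in `G`: it is discrete and `Γ\G` has finite Haar volume, that is, `Γ\G` is the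
image of a set of finite Haar measure. -/
def IsLattice {G : Type*} [Group G] [TopologicalSpace G] (Γ : Subgroup G) : Prop :=
  DiscreteTopology ↥Γ ∧
    ∃ μ : @MeasureTheory.Measure G (borel G),
      @MeasureTheory.Measure.IsHaarMeasure G _ _ (borel G) μ ∧
      ∃ D : Set G, @MeasurableSet G (borel G) D ∧ μ D < ⊤ ∧ ∀ g : G, ∃ γ ∈ Γ, γ * g ∈ D

/-- The homomorphism `φ : 𝔾(ℝ)° → G°` witnesses that the algebraic group `𝔾` is admissible for the
identity component `G°` of `G`. -/
structure IsAdmissibleHom {G : Type*} [Group G] [TopologicalSpace G] [IsTopologicalGroup G]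
    (𝔾 : RatAlgGroup) (φ : ↥𝔾.realComponent →* ↥(Subgroup.connectedComponentOfOne G)) : Prop where
  continuous : Continuous φ
  surjective : Function.Surjective φ
  isCompact_ker : IsCompact (φ.ker : Set ↥𝔾.realComponent)

/-- `Γ` is a quasi-arithmetic lattice in `G`: it is a lattice, and for some algebraic group `𝔾` over
`ℚ` that is admissible for `G°`, through `φ`, a subgroup of finite index of `Γ` is contained in
`φ(𝔾(ℚ))`. -/
def IsQuasiArithmetic {G : Type*} [Group G] [TopologicalSpace G] [IsTopologicalGroup G]
    (Γ : Subgroup G) : Prop :=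
  IsLattice Γ ∧
    ∃ (𝔾 : RatAlgGroup) (φ : ↥𝔾.realComponent →* ↥(Subgroup.connectedComponentOfOne G)),
      IsAdmissibleHom 𝔾 φ ∧
      ∃ Γ' : Subgroup G, Γ' ≤ Γ ∧ Γ'.relIndex Γ ≠ 0 ∧
        ∀ γ ∈ Γ', ∃ x : ↥𝔾.realComponent, 𝔾.IsRational x.1 ∧ (φ x : G) = γ

end Doubling

end

open scoped Pointwise MatrixGroups

noncomputable section

namespace Doubling

section Basic

variable {n : ℕ} {S : Matrix (Fin (n + 1)) (Fin (n + 1)) ℝ} {e : Fin (n + 1) → ℝ}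

/-! ## Lorentzian forms -/

section Bil

variable {R : Type*} [CommRing R] (B : Matrix (Fin (n + 1)) (Fin (n + 1)) R)
  (x y z : Fin (n + 1) → R) (r : R)

theorem bil_add_left : bil B (x + y) z = bil B x z + bil B y z := by
  simp [bil, add_dotProduct]

theorem bil_add_right : bil B x (y + z) = bil B x y + bil B x z := by
  simp [bil, Matrix.mulVec_add, dotProduct_add]

theorem bil_smul_left : bil B (r • x) y = r * bil B x y := by
  simp [bil]

theorem bil_smul_right : bil B x (r • y) = r * bil B x y := by
  simp [bil, Matrix.mulVec_smul]

theorem bil_neg_left : bil B (-x) y = -bil B x y := by simp [bil]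

theorem bil_neg_right : bil B x (-y) = -bil B x y := by simp [bil, Matrix.mulVec_neg]

theorem bil_sub_left : bil B (x - y) z = bil B x z - bil B y z := by
  simp [bil, sub_dotProduct]

theorem bil_sub_right : bil B x (y - z) = bil B x y - bil B x z := by
  simp [bil, Matrix.mulVec_sub, dotProduct_sub]

@[simp] theorem bil_zero_left : bil B 0 x = 0 := by simp [bil]

@[simp] theorem bil_zero_right : bil B x 0 = 0 := by simp [bil]

variable {B} in
theorem bil_comm_of_isSymm (hB : B.IsSymm) : bil B x y = bil B y x := by
  unfold bil
  rw [Matrix.dotProduct_mulVec, dotProduct_comm, ← Matrix.mulVec_transpose, hB.eq]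

theorem bil_mulVec_mulVec (g h : Matrix (Fin (n + 1)) (Fin (n + 1)) R) :
    bil B (g.mulVec x) (h.mulVec y) = bil (g.transpose * B * h) x y := by
  unfold bil
  simp only [← Matrix.mulVec_mulVec]
  rw [Matrix.dotProduct_mulVec x, Matrix.vecMul_transpose]

theorem map_bil {R' : Type*} [CommRing R'] (i : R →+* R') :
    i (bil B x y) = bil (B.map i) (fun k => i (x k)) (fun k => i (y k)) := by
  simp [bil, dotProduct, Matrix.mulVec, map_sum, map_mul]

variable {B} in
theorem eq_of_forall_bil_eq {B' : Matrix (Fin (n + 1)) (Fin (n + 1)) R}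
    (h : ∀ x y, bil B x y = bil B' x y) : B = B' := by
  ext i j
  simpa [bil] using h (Pi.single i 1) (Pi.single j 1)

end Bil

theorem continuous_bil (B : Matrix (Fin (n + 1)) (Fin (n + 1)) ℝ) {Y : Type*} [TopologicalSpace Y]
    {f g : Y → Fin (n + 1) → ℝ} (hf : Continuous f) (hg : Continuous g) :
    Continuous fun y => bil B (f y) (g y) := by
  unfold bil
  fun_prop

/-- `S` is symmetric, has a negative vector, and the orthogonal complement of every negative vector
is positive definite. -/
class Lorentzian (S : Matrix (Fin (n + 1)) (Fin (n + 1)) ℝ) : Prop where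
  symm : S.IsSymm
  exists_neg : ∃ x, bil S x x < 0
  pos_of_orth : ∀ x y, bil S x x < 0 → bil S x y = 0 → y ≠ 0 → 0 < bil S y y

/-- The vector `e` is negative. -/
class Timelike (S : Matrix (Fin (n + 1)) (Fin (n + 1)) ℝ) (e : Fin (n + 1) → ℝ) : Prop where
  neg : bil S e e < 0

/-- In diagonal coordinates orthogonality equates the product of the time coordinates with the
scalar product of the spatial parts. The spatial part of a negative vector is shorter than its time
coordinate, so Cauchy–Schwarz makes the other vector longer in space than in time. -/
theorem HasLorentzSignature.pos_of_orth (hS : HasLorentzSignature S)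
    (x y : Fin (n + 1) → ℝ) (hx : bil S x x < 0) (hxy : bil S x y = 0) (hy : y ≠ 0) :
    0 < bil S y y := by
  obtain ⟨P, hP⟩ := hS
  have key : ∀ u : Fin (n + 1) → ℝ, ∃ a, u = P.1.mulVec a := fun u =>
    ⟨(P⁻¹).1.mulVec u, by rw [Matrix.mulVec_mulVec, Units.mul_inv, Matrix.one_mulVec]⟩
  obtain ⟨a, rfl⟩ := key x
  obtain ⟨b, rfl⟩ := key y
  have hb : b ≠ 0 := by
    rintro rfl
    simp at hy
  rw [bil_mulVec_mulVec, hP] at *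
  have form : ∀ u v : Fin (n + 1) → ℝ,
      bil (Matrix.diagonal (Fin.cons (-1) (fun _ => 1)) : Matrix (Fin (n + 1)) (Fin (n + 1)) ℝ) u v
        = -(u 0 * v 0) + ∑ i : Fin n, u i.succ * v i.succ := by
    intro u v
    simp [bil, dotProduct, Matrix.mulVec_diagonal, Fin.sum_univ_succ]
  rw [form] at *
  have cs := Finset.sum_mul_sq_le_sq_mul_sq Finset.univ (fun i : Fin n => a i.succ)
    (fun i => b i.succ)
  simp only [← sq] at *
  set p := ∑ i : Fin n, a i.succ ^ 2
  set q := ∑ i : Fin n, b i.succ ^ 2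
  set s := ∑ i : Fin n, a i.succ * b i.succ
  have hq : 0 ≤ q := Finset.sum_nonneg fun i _ => sq_nonneg _
  have hp : 0 ≤ p := Finset.sum_nonneg fun i _ => sq_nonneg _
  -- If the spatial part of `b` vanishes, orthogonality forces its time coordinate to vanish as
  -- well, since `a 0 ≠ 0`.
  rcases hq.eq_or_lt with h0 | h0
  · exfalso
    apply hb
    have h1 : ∀ i : Fin n, b i.succ = 0 := fun i => by
      have := (Finset.sum_eq_zero_iff_of_nonneg (fun i _ => sq_nonneg (b (Fin.succ i)))).1 h0.symm i
        (Finset.mem_univ _)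
      simpa using this
    have h2 : s = 0 := Finset.sum_eq_zero fun i _ => by rw [h1, mul_zero]
    have h3 : a 0 * b 0 = 0 := by linarith
    have h4 : a 0 ≠ 0 := fun h => by rw [h] at hx; nlinarith
    ext i
    refine Fin.cases ?_ (fun j => h1 j) i
    simpa [h4] using h3
  · have h1 : s = a 0 * b 0 := by linarith
    have h2 : 0 < a 0 ^ 2 := by linarith
    rw [h1, mul_pow] at cs
    have : a 0 ^ 2 * b 0 ^ 2 < a 0 ^ 2 * q := by nlinarith
    have := lt_of_mul_lt_mul_left this h2.le
    linarith

section Lorentz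

variable [Lorentzian S]

theorem bil_comm (x y : Fin (n + 1) → ℝ) : bil S x y = bil S y x :=
  bil_comm_of_isSymm x y Lorentzian.symm

theorem bil_self_nonneg_of_orth {x y : Fin (n + 1) → ℝ} (hx : bil S x x < 0)
    (h : bil S x y = 0) : 0 ≤ bil S y y := by
  rcases eq_or_ne y 0 with rfl | hy
  · simp
  · exact (Lorentzian.pos_of_orth x y hx h hy).le

/-- Cauchy–Schwarz in the orthogonal complement of a negative vector. -/
theorem bil_sq_le_of_orth {x y z : Fin (n + 1) → ℝ} (hx : bil S x x < 0)
    (hy : bil S x y = 0) (hz : bil S x z = 0) : bil S y z ^ 2 ≤ bil S y y * bil S z z := by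
  rcases eq_or_ne z 0 with rfl | hz0
  · simp
  · have h1 := Lorentzian.pos_of_orth x z hx hz hz0
    -- This is `bil S z z` times the component of `y` orthogonal to `z`; the scaling avoids a
    -- division.
    have h2 := bil_self_nonneg_of_orth (y := bil S z z • y - bil S y z • z) hx (by
      rw [bil_sub_right, bil_smul_right, bil_smul_right, hy, hz]; ring)
    have h3 : bil S (bil S z z • y - bil S y z • z) (bil S z z • y - bil S y z • z)
        = bil S z z * (bil S y y * bil S z z - bil S y z ^ 2) := by
      simp only [bil_sub_left, bil_sub_right, bil_smul_left, bil_smul_right, bil_comm z y]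
      ring
    rw [h3] at h2
    have := nonneg_of_mul_nonneg_right h2 h1
    linarith

theorem eq_zero_of_forall_bil_eq_zero {x : Fin (n + 1) → ℝ} (h : ∀ y, bil S x y = 0) :
    x = 0 := by
  by_contra hx
  obtain ⟨e, he⟩ := Lorentzian.exists_neg (S := S)
  have := Lorentzian.pos_of_orth e x he (by rw [bil_comm, h]) hx
  rw [h] at this
  exact this.false

theorem det_ne_zero : S.det ≠ 0 := by
  intro h
  obtain ⟨v, hv, h0⟩ := Matrix.exists_mulVec_eq_zero_iff.2 h
  exact hv (eq_zero_of_forall_bil_eq_zero (S := S) fun y => by rw [bil_comm, bil, h0]; simp)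

/-- Reversed Cauchy–Schwarz: the component of `y` orthogonal to the negative vector `x`, multiplied
by `bil S x x`, has nonnegative norm. -/
theorem bil_mul_bil_le_sq {x : Fin (n + 1) → ℝ} (hx : bil S x x < 0) (y : Fin (n + 1) → ℝ) :
    bil S x x * bil S y y ≤ bil S x y ^ 2 := by
  have h := bil_self_nonneg_of_orth (y := bil S x x • y - bil S x y • x) hx (by
    simp only [bil_sub_right, bil_smul_right]; ring)
  simp only [bil_sub_left, bil_sub_right, bil_smul_left, bil_smul_right, bil_comm y x] at h
  have h1 : 0 ≤ (-bil S x x) * (bil S x y ^ 2 - bil S x x * bil S y y) := by linarith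
  linarith [nonneg_of_mul_nonneg_right h1 (neg_pos.2 hx)]

/-- Cauchy–Schwarz for the projections to the orthogonal complement of a negative vector. -/
theorem bil_proj_sq_le {x : Fin (n + 1) → ℝ} (hx : bil S x x < 0) (y z : Fin (n + 1) → ℝ) :
    (bil S x x * bil S y z - bil S x y * bil S x z) ^ 2 ≤
      (bil S x y ^ 2 - bil S x x * bil S y y) * (bil S x z ^ 2 - bil S x x * bil S z z) := by
  have cs := bil_sq_le_of_orth (y := bil S x x • y - bil S x y • x)
    (z := bil S x x • z - bil S x z • x) hx
    (by simp only [bil_sub_right, bil_smul_right]; ring)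
    (by simp only [bil_sub_right, bil_smul_right]; ring)
  simp only [bil_sub_left, bil_sub_right, bil_smul_left, bil_smul_right, bil_comm y x,
    bil_comm z x] at cs
  refine le_of_mul_le_mul_left ?_ (by nlinarith : 0 < bil S x x ^ 2)
  linarith

/-- Two negative vectors in the same half of the cone as `x` pair negatively: relative to `x` the
product of their time components exceeds the product of the lengths of their spatial components. -/
theorem bil_neg_of_neg_of_neg {x y z : Fin (n + 1) → ℝ} (hx : bil S x x < 0)
    (hy : bil S y y < 0) (hz : bil S z z < 0) (hxy : bil S x y < 0) (hxz : bil S x z < 0) :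
    bil S y z < 0 := by
  have cs := bil_proj_sq_le hx y z
  have h1 := bil_mul_bil_le_sq hx y
  by_contra! hn
  have h2 : bil S x x * bil S y y > 0 := mul_pos_of_neg_of_neg hx hy
  have h3 : bil S x x * bil S z z > 0 := mul_pos_of_neg_of_neg hx hz
  have hbc : 0 < bil S x y * bil S x z := mul_pos_of_neg_of_neg hxy hxz
  have h4 : bil S x x * bil S y z ≤ 0 := mul_nonpos_of_nonpos_of_nonneg hx.le hn
  have h5 : (bil S x y * bil S x z) ^ 2 ≤ (bil S x x * bil S y z - bil S x y * bil S x z) ^ 2 := by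
    nlinarith
  have h6 : (bil S x y ^ 2 - bil S x x * bil S y y) * (bil S x z ^ 2 - bil S x x * bil S z z)
      < bil S x y ^ 2 * bil S x z ^ 2 :=
    mul_lt_mul'' (by linarith) (by linarith) (by linarith)
      (by linarith [bil_mul_bil_le_sq hx z])
  nlinarith

end Lorentz

/-! ## Hyperbolic space -/

theorem hyp_self (x : Hyp S e) : bil S x.1 x.1 = -1 := x.2.1

set_option linter.unusedSectionVars false

variable [Lorentzian S] [Timelike S e]

theorem hyp_neg (x : Hyp S e) : bil S x.1 x.1 < 0 := by rw [hyp_self]; norm_num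

theorem bil_hyp_neg (x y : Hyp S e) : bil S x.1 y.1 < 0 :=
  bil_neg_of_neg_of_neg (Timelike.neg (S := S) (e := e)) (hyp_neg x) (hyp_neg y)
    (by rw [bil_comm]; exact x.2.2) (by rw [bil_comm]; exact y.2.2)

/-- Any point of the sheet can replace `e` in singling it out, so that later arguments can choose a
convenient base point. -/
theorem mem_hypSet_iff (x : Hyp S e) (y : Fin (n + 1) → ℝ) :
    y ∈ hypSet S e ↔ bil S y y = -1 ∧ bil S x.1 y < 0 := by
  refine ⟨fun h => ⟨h.1, bil_hyp_neg x ⟨y, h⟩⟩, fun h => ⟨h.1, ?_⟩⟩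
  exact bil_neg_of_neg_of_neg (hyp_neg x) (by rw [h.1]; norm_num) Timelike.neg h.2 x.2.2

theorem bil_sq_le_of_hyp (x : Hyp S e) (y : Fin (n + 1) → ℝ) :
    -bil S y y ≤ bil S x.1 y ^ 2 := by
  have := bil_mul_bil_le_sq (hyp_neg x) y
  rw [hyp_self] at this
  linarith

theorem one_le_neg_bil (x y : Hyp S e) : 1 ≤ -bil S x.1 y.1 := by
  have h := bil_sq_le_of_hyp x y.1
  rw [hyp_self] at h
  nlinarith [bil_hyp_neg x y]

theorem eq_of_neg_bil_eq_one {x y : Hyp S e} (h : -bil S x.1 y.1 = 1) : x = y := by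
  by_contra hne
  have h1 : x.1 - y.1 ≠ 0 := fun h0 => hne (Subtype.ext (sub_eq_zero.1 h0))
  have h2 : bil S x.1 (x.1 - y.1) = 0 := by rw [bil_sub_right, hyp_self]; linarith
  have h3 := Lorentzian.pos_of_orth _ _ (hyp_neg x) h2 h1
  simp only [bil_sub_left, bil_sub_right, hyp_self, bil_comm y.1 x.1] at h3
  linarith

theorem cosh_hdist (x y : Hyp S e) : Real.cosh (hdist x y) = -bil S x.1 y.1 :=
  Real.cosh_arcosh (one_le_neg_bil x y)

theorem hdist_nonneg (x y : Hyp S e) : 0 ≤ hdist x y := Real.arcosh_nonneg (one_le_neg_bil x y)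

theorem hdist_eq_of_cosh {x y : Hyp S e} {r : ℝ} (hr : 0 ≤ r)
    (h : -bil S x.1 y.1 = Real.cosh r) : hdist x y = r := by
  rw [hdist, h, Real.arcosh_cosh hr]

theorem hdist_eq_hdist_iff {x y z w : Hyp S e} :
    hdist x y = hdist z w ↔ bil S x.1 y.1 = bil S z.1 w.1 := by
  refine ⟨fun h => ?_, fun h => by rw [hdist, hdist, h]⟩
  have := cosh_hdist x y
  rw [h, cosh_hdist] at this
  linarith

theorem hdist_le_iff {x y : Hyp S e} {r : ℝ} (hr : 0 ≤ r) :
    hdist x y ≤ r ↔ -bil S x.1 y.1 ≤ Real.cosh r := by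
  rw [← cosh_hdist, Real.cosh_le_cosh, abs_of_nonneg (hdist_nonneg x y), abs_of_nonneg hr]

theorem hdist_lt_iff {x y : Hyp S e} {r : ℝ} (hr : 0 ≤ r) :
    hdist x y < r ↔ -bil S x.1 y.1 < Real.cosh r := by
  rw [← cosh_hdist, Real.cosh_lt_cosh, abs_of_nonneg (hdist_nonneg x y), abs_of_nonneg hr]

@[simp] theorem hdist_self (x : Hyp S e) : hdist x x = 0 := by
  rw [hdist, hyp_self]; simp

theorem hdist_comm (x y : Hyp S e) : hdist x y = hdist y x := by
  rw [hdist, hdist, bil_comm]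

theorem eq_of_hdist_eq_zero {x y : Hyp S e} (h : hdist x y = 0) : x = y := by
  apply eq_of_neg_bil_eq_one
  rw [← cosh_hdist, h, Real.cosh_zero]

theorem sinh_hdist_sq (x y : Hyp S e) : Real.sinh (hdist x y) ^ 2 = bil S x.1 y.1 ^ 2 - 1 := by
  rw [Real.sinh_sq, cosh_hdist]; ring

/-- After taking `cosh`, the addition formula reduces this to Cauchy–Schwarz for the components of
`x` and `z` orthogonal to `y`, whose lengths are the hyperbolic sines of the distances to `y`. -/
theorem hdist_triangle (x y z : Hyp S e) : hdist x z ≤ hdist x y + hdist y z := by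
  rw [hdist_le_iff (add_nonneg (hdist_nonneg _ _) (hdist_nonneg _ _)), Real.cosh_add, cosh_hdist,
    cosh_hdist]
  have cs := bil_proj_sq_le (hyp_neg y) x.1 z.1
  simp only [hyp_self] at cs
  have h1 := sinh_hdist_sq y x
  have h2 := sinh_hdist_sq y z
  rw [hdist_comm] at h1
  have h3 : (-1 * bil S x.1 z.1 - bil S y.1 x.1 * bil S y.1 z.1) ^ 2 ≤
      (Real.sinh (hdist x y) * Real.sinh (hdist y z)) ^ 2 := by
    rw [mul_pow, h1, h2]; linarith
  have h4 : 0 ≤ Real.sinh (hdist x y) * Real.sinh (hdist y z) :=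
    mul_nonneg (Real.sinh_nonneg_iff.2 (hdist_nonneg _ _))
      (Real.sinh_nonneg_iff.2 (hdist_nonneg _ _))
  have h5 := (abs_le_of_sq_le_sq' h3 h4).2
  rw [bil_comm y.1 x.1] at h5
  linarith

/-- Distances add up along geodesic segments. -/
theorem hdist_add_of_between {x y z : Hyp S e} {s t : ℝ} (hs : 0 ≤ s) (ht : 0 ≤ t)
    (h : z.1 = s • x.1 + t • y.1) : hdist x z + hdist z y = hdist x y := by
  symm
  refine hdist_eq_of_cosh (add_nonneg (hdist_nonneg _ _) (hdist_nonneg _ _)) ?_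
  rw [Real.cosh_add, cosh_hdist, cosh_hdist]
  have hxz : bil S x.1 z.1 = -s + t * bil S x.1 y.1 := by
    rw [h, bil_add_right, bil_smul_right, bil_smul_right, hyp_self]; ring
  have hzy : bil S z.1 y.1 = s * bil S x.1 y.1 - t := by
    rw [h, bil_add_left, bil_smul_left, bil_smul_left, hyp_self]; ring
  have hzz : s ^ 2 + t ^ 2 - 2 * s * t * bil S x.1 y.1 = 1 := by
    have := hyp_self z
    rw [h] at this
    simp only [bil_add_left, bil_add_right, bil_smul_left, bil_smul_right, hyp_self,
      bil_comm y.1 x.1] at this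
    linarith
  have hc := one_le_neg_bil x y
  have hsinh := Real.sinh_nonneg_iff.2 (hdist_nonneg x y)
  -- The coefficients of `z` are the ratios of hyperbolic sines; squaring turns this into the
  -- normalisation `hzz` of `z`.
  have e1 : Real.sinh (hdist x z) = t * Real.sinh (hdist x y) := by
    rw [← sq_eq_sq₀ (Real.sinh_nonneg_iff.2 (hdist_nonneg x z)) (mul_nonneg ht hsinh), mul_pow,
      sinh_hdist_sq, sinh_hdist_sq, hxz]
    linear_combination hzz
  have e2 : Real.sinh (hdist z y) = s * Real.sinh (hdist x y) := by
    rw [← sq_eq_sq₀ (Real.sinh_nonneg_iff.2 (hdist_nonneg z y)) (mul_nonneg hs hsinh), mul_pow,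
      sinh_hdist_sq, sinh_hdist_sq, hzy]
    linear_combination hzz
  have e3 := sinh_hdist_sq x y
  rw [e1, e2, hxz, hzy]
  linear_combination (-s * t) * e3 + bil S x.1 y.1 * hzz

end Basic

set_option linter.unusedSectionVars false

variable {n : ℕ} {S : Matrix (Fin (n + 1)) (Fin (n + 1)) ℝ} {e : Fin (n + 1) → ℝ}
  [Lorentzian S] [Timelike S e]

/-! ## Topology of hyperbolic space -/

theorem continuous_hdist {Y : Type*} [TopologicalSpace Y] {f g : Y → Hyp S e}
    (hf : Continuous f) (hg : Continuous g) : Continuous fun y => hdist (f y) (g y) := by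
  refine Real.continuousOn_arcosh.comp_continuous ?_ fun y => one_le_neg_bil _ _
  exact (continuous_bil S (continuous_subtype_val.comp hf) (continuous_subtype_val.comp hg)).neg

/-- By homogeneity the constant is the inverse of the minimum of `q` on the compact unit sphere. -/
theorem exists_norm_sq_le {q : (Fin (n + 1) → ℝ) → ℝ} (hc : Continuous q)
    (hq : ∀ (r : ℝ) y, q (r • y) = r ^ 2 * q y) (hpos : ∀ y, y ≠ 0 → 0 < q y) :
    ∃ C : ℝ, 0 < C ∧ ∀ y, ‖y‖ ^ 2 ≤ C * q y := by
  obtain ⟨u, hu, hmin⟩ := (isCompact_sphere (0 : Fin (n + 1) → ℝ) 1).exists_isMinOn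
    (NormedSpace.sphere_nonempty.2 zero_le_one) hc.continuousOn
  have hu0 : u ≠ 0 := by
    rintro rfl
    simp at hu
  refine ⟨(q u)⁻¹, inv_pos.2 (hpos u hu0), fun y => ?_⟩
  rcases eq_or_ne y 0 with rfl | hy
  · have : q 0 = 0 := by simpa using hq 0 0
    simp [this]
  · have hy' : ‖y‖ ≠ 0 := norm_ne_zero_iff.2 hy
    have h1 : q u ≤ q (‖y‖⁻¹ • y) := hmin (by simp [norm_smul, hy'])
    rw [hq, inv_pow, ← div_eq_inv_mul, le_div_iff₀ (by positivity)] at h1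
    rw [← div_eq_inv_mul, le_div_iff₀ (hpos u hu0)]
    linarith

/-- The positive definite form `bil y y + 2 (bil x y)²` controls the norm. -/
theorem exists_norm_sq_le_bil (x : Hyp S e) :
    ∃ C : ℝ, 0 < C ∧ ∀ y, ‖y‖ ^ 2 ≤ C * (bil S y y + 2 * bil S x.1 y ^ 2) := by
  refine exists_norm_sq_le ?_ ?_ ?_
  · have h1 := continuous_bil S continuous_id continuous_id
    have h2 := continuous_bil S (continuous_const (y := x.1)) continuous_id
    exact h1.add (continuous_const.mul (h2.pow 2))
  · intro r y
    simp only [bil_smul_left, bil_smul_right]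
    ring
  · intro y hy
    rcases eq_or_ne (bil S x.1 y) 0 with h | h
    · have := Lorentzian.pos_of_orth _ _ (hyp_neg x) h hy
      rw [h]; linarith
    · have := bil_sq_le_of_hyp x y
      have := pow_pos (abs_pos.2 h) 2
      rw [sq_abs] at this
      linarith

theorem isOpen_hball (x : Hyp S e) (r : ℝ) : IsOpen {y : Hyp S e | hdist x y < r} :=
  isOpen_lt (continuous_hdist continuous_const continuous_id) continuous_const

theorem isClosed_hball (x : Hyp S e) (r : ℝ) : IsClosed {y : Hyp S e | hdist x y ≤ r} :=
  isClosed_le (continuous_hdist continuous_const continuous_id) continuous_const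

theorem hball_mem_nhds (x : Hyp S e) {r : ℝ} (hr : 0 < r) :
    {y : Hyp S e | hdist x y < r} ∈ nhds x :=
  (isOpen_hball x r).mem_nhds (by simpa using hr)

/-- Together with `hball_mem_nhds` this says that `hdist` induces the given topology. The definite
form at `x`, evaluated on `y - x`, is a polynomial in `cosh (hdist x y) - 1` without constant term.
-/
theorem exists_hball_subset {x : Hyp S e} {U : Set (Hyp S e)} (hU : U ∈ nhds x) :
    ∃ r > 0, ∀ y, hdist x y < r → y ∈ U := by
  obtain ⟨δ, hδ, hball⟩ := Metric.mem_nhds_iff.1 hU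
  obtain ⟨C, hC, hb⟩ := exists_norm_sq_le_bil x
  have hcont : Continuous fun r : ℝ =>
      C * (2 * (Real.cosh r - 1) + 2 * (Real.cosh r - 1) ^ 2) := by fun_prop
  have h0 : ∀ᶠ r in nhds (0 : ℝ),
      C * (2 * (Real.cosh r - 1) + 2 * (Real.cosh r - 1) ^ 2) < δ ^ 2 :=
    hcont.continuousAt.eventually_lt continuousAt_const (by simpa using pow_pos hδ 2)
  obtain ⟨ε, hε, h1⟩ := Metric.eventually_nhds_iff.1 h0
  refine ⟨ε, hε, fun y hy => hball ?_⟩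
  have h2 := h1 (y := hdist x y) (by
    rw [Real.dist_eq, sub_zero, abs_of_nonneg (hdist_nonneg _ _)]; exact hy)
  have h3 := hb (y.1 - x.1)
  rw [Metric.mem_ball, Subtype.dist_eq, dist_eq_norm]
  refine lt_of_pow_lt_pow_left₀ 2 hδ.le (lt_of_le_of_lt h3 (lt_of_eq_of_lt ?_ h2))
  rw [cosh_hdist]
  simp only [bil_sub_left, bil_sub_right, hyp_self, bil_comm y.1 x.1]
  ring

/-- Hyperbolic space is proper: the sheet is closed in `ℝⁿ⁺¹`, and the definite form at `x` bounds
the norm in terms of the distance from `x`. -/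
theorem isCompact_of_bounded {Q : Set (Hyp S e)} (hQ : IsClosed Q) (x : Hyp S e) (R : ℝ)
    (h : ∀ y ∈ Q, hdist x y ≤ R) : IsCompact Q := by
  have hcl : IsClosed (hypSet S e) := by
    -- The open condition `bil S x y < 0` improves to `≤ -1` on the hyperboloid, so the sheet is
    -- closed.
    have : hypSet S e = {y | bil S y y = -1} ∩ {y | bil S x.1 y ≤ -1} := by
      ext y
      rw [mem_hypSet_iff x]
      refine and_congr_right fun h => ⟨fun h' => ?_, fun h' => lt_of_le_of_lt h' (by norm_num)⟩
      have := bil_sq_le_of_hyp x y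
      rw [h] at this
      simp only [Set.mem_ofPred_eq]
      nlinarith
    rw [this]
    exact (isClosed_eq (continuous_bil S continuous_id continuous_id) continuous_const).inter
      (isClosed_le (continuous_bil S continuous_const continuous_id) continuous_const)
  rw [Subtype.isCompact_iff]
  refine Metric.isCompact_of_isClosed_isBounded (hcl.isClosedMap_subtype_val _ hQ) ?_
  obtain ⟨C, hC, hb⟩ := exists_norm_sq_le_bil x
  refine (Metric.isBounded_iff_subset_closedBall 0).2
    ⟨√(C * (-1 + 2 * Real.cosh R ^ 2)), ?_⟩
  rintro _ ⟨y, hy, rfl⟩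
  rw [mem_closedBall_zero_iff]
  apply Real.le_sqrt_of_sq_le
  refine (hb y.1).trans ?_
  have h1 := h y hy
  have h2 : -bil S x.1 y.1 ≤ Real.cosh R :=
    (hdist_le_iff ((hdist_nonneg x y).trans h1)).1 h1
  have h3 := one_le_neg_bil x y
  rw [hyp_self]
  gcongr ?_ * (-1 + 2 * ?_)
  nlinarith

/-- The point of hyperbolic space on a negative line. -/
def hypNormalize (x : Hyp S e) (y : Fin (n + 1) → ℝ) (hy : bil S y y < 0) (hxy : bil S x.1 y < 0) :
    Hyp S e :=
  ⟨(√(-bil S y y))⁻¹ • y, (mem_hypSet_iff x _).2 (by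
    have h1 : 0 < √(-bil S y y) := Real.sqrt_pos.2 (neg_pos.2 hy)
    have h2 := Real.sq_sqrt (neg_pos.2 hy).le
    simp only [bil_smul_left, bil_smul_right]
    refine ⟨?_, mul_neg_of_pos_of_neg (inv_pos.2 h1) hxy⟩
    field_simp
    linarith)⟩

/-- The geodesic segment from `x` to `y`. -/
theorem exists_segment (x y : Hyp S e) :
    ∃ f : ℝ → Hyp S e, Continuous f ∧ f 0 = x ∧ f 1 = y ∧
      ∀ t ∈ Set.Icc (0 : ℝ) 1, ∃ c > 0, (f t).1 = (c * (1 - t)) • x.1 + (c * t) • y.1 := by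
  let p : ℝ → Fin (n + 1) → ℝ := fun t => (1 - t) • x.1 + t • y.1
  have hp : Continuous p := by fun_prop
  have hxy := bil_hyp_neg x y
  have h1 : ∀ t ∈ Set.Icc (0 : ℝ) 1, bil S (p t) (p t) < 0 := by
    rintro t ⟨ht0, ht1⟩
    simp only [p, bil_add_left, bil_add_right, bil_smul_left, bil_smul_right, hyp_self,
      bil_comm y.1 x.1]
    have := mul_nonneg ht0 (sub_nonneg.2 ht1)
    nlinarith [one_le_neg_bil x y]
  have h2 : ∀ t ∈ Set.Icc (0 : ℝ) 1, bil S x.1 (p t) < 0 := by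
    rintro t ⟨ht0, ht1⟩
    simp only [p, bil_add_right, bil_smul_right, hyp_self]
    nlinarith [one_le_neg_bil x y]
  let f : Set.Icc (0 : ℝ) 1 → Hyp S e := fun t => hypNormalize x (p t) (h1 t t.2) (h2 t t.2)
  have hf : Continuous f := by
    have hps : Continuous fun t : Set.Icc (0 : ℝ) 1 => p t := hp.comp continuous_subtype_val
    have hf' : Continuous fun t : Set.Icc (0 : ℝ) 1 => (√(-bil S (p t) (p t)))⁻¹ • p t :=
      ((continuous_bil S hps hps).neg.sqrt.inv₀ fun t =>
        (Real.sqrt_pos.2 (neg_pos.2 (h1 t t.2))).ne').smul hps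
    exact hf'.subtype_mk _
  refine ⟨fun t => f (Set.projIcc 0 1 zero_le_one t), hf.comp continuous_projIcc, ?_, ?_, ?_⟩
  · apply Subtype.ext
    simp [f, hypNormalize, p, hyp_self]
  · apply Subtype.ext
    simp [f, hypNormalize, p, hyp_self]
  · intro t ht
    refine ⟨(√(-bil S (p t) (p t)))⁻¹, inv_pos.2 (Real.sqrt_pos.2 (neg_pos.2 (h1 t ht))), ?_⟩
    simp only [Set.projIcc_of_mem zero_le_one ht, f, hypNormalize, p, smul_add, smul_smul]

/-- A set of points of hyperbolic space that contains geodesic segments is connected. -/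
theorem isPreconnected_of_segments {U : Set (Hyp S e)}
    (hU : ∀ x ∈ U, ∀ y ∈ U, ∀ z : Hyp S e, ∀ s t : ℝ, 0 ≤ s → 0 ≤ t →
      z.1 = s • x.1 + t • y.1 → z ∈ U) : IsPreconnected U := by
  refine isPreconnected_of_forall_pair fun x hx y hy => ?_
  obtain ⟨f, hf, hf0, hf1, hfs⟩ := exists_segment x y
  refine ⟨f '' Set.Icc 0 1, ?_, ⟨0, by simp, hf0⟩, ⟨1, by simp, hf1⟩,
    isPreconnected_Icc.image f hf.continuousOn⟩
  rintro _ ⟨t, ht, rfl⟩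
  obtain ⟨c, hc, h⟩ := hfs t ht
  exact hU x hx y hy _ _ _ (mul_nonneg hc.le (by linarith [ht.2])) (mul_nonneg hc.le ht.1) h

theorem subset_closure_openGeodesic (x y : Hyp S e) :
    x ∈ closure (openGeodesic x y) ∧ y ∈ closure (openGeodesic x y) := by
  obtain ⟨f, hf, hf0, hf1, hfs⟩ := exists_segment x y
  have h1 : f '' Set.Ioo 0 1 ⊆ openGeodesic x y := by
    rintro _ ⟨t, ht, rfl⟩
    obtain ⟨c, hc, h⟩ := hfs t ⟨ht.1.le, ht.2.le⟩
    exact ⟨_, _, mul_pos hc (by linarith [ht.2]), mul_pos hc ht.1, h⟩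
  have h2 := (image_closure_subset_closure_image hf).trans (closure_mono h1)
  rw [closure_Ioo zero_ne_one] at h2
  exact ⟨h2 ⟨0, by simp, hf0⟩, h2 ⟨1, by simp, hf1⟩⟩

theorem isPreconnected_openGeodesic (p q : Hyp S e) : IsPreconnected (openGeodesic p q) := by
  refine isPreconnected_of_segments ?_
  rintro x ⟨s, t, hs, ht, hx⟩ y ⟨s', t', hs', ht', hy⟩ z a b ha hb hz
  have hab : 0 < a ∨ 0 < b := by
    by_contra! h
    have ha' : a = 0 := le_antisymm h.1 ha
    have hb' : b = 0 := le_antisymm h.2 hb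
    have h0 := hyp_self z
    rw [hz, ha', hb', zero_smul, zero_smul, add_zero, bil, zero_dotProduct] at h0
    norm_num at h0
  refine ⟨a * s + b * s', a * t + b * t', ?_, ?_, ?_⟩
  · rcases hab with h | h <;> positivity
  · rcases hab with h | h <;> positivity
  · rw [hz, hx, hy]
    module

instance : PreconnectedSpace (Hyp S e) :=
  ⟨isPreconnected_of_segments fun _ _ _ _ _ _ _ _ _ _ => Set.mem_univ _⟩

/-- The normalisation of `z` reads `(s + t)² + 2st(cosh d(x, y) - 1) = 1`. -/
theorem add_le_one_of_between {x y z : Hyp S e} {s t : ℝ} (hs : 0 ≤ s) (ht : 0 ≤ t)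
    (h : z.1 = s • x.1 + t • y.1) : s + t ≤ 1 := by
  have hz := hyp_self z
  rw [h] at hz
  simp only [bil_add_left, bil_add_right, bil_smul_left, bil_smul_right, hyp_self,
      bil_comm y.1 x.1] at hz
  have := mul_nonneg (mul_nonneg hs ht) (sub_nonneg.2 (one_le_neg_bil x y))
  nlinarith

/-- Balls are convex: `cosh` of the distance to `p` is the restriction of a linear function, and the
weights have sum at most `1`. -/
theorem hdist_lt_of_between {p x y z : Hyp S e} {s t r : ℝ} (hs : 0 ≤ s) (ht : 0 ≤ t)
    (h : z.1 = s • x.1 + t • y.1) (hx : hdist p x < r) (hy : hdist p y < r) : hdist p z < r := by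
  have hr : 0 ≤ r := (hdist_nonneg p x).trans hx.le
  rw [hdist_lt_iff hr] at *
  have h1 := add_le_one_of_between hs ht h
  have h2 : -bil S p.1 z.1 = s * -bil S p.1 x.1 + t * -bil S p.1 y.1 := by
    rw [h, bil_add_right, bil_smul_right, bil_smul_right]; ring
  have hst : 0 < s + t := by
    rcases (add_nonneg hs ht).eq_or_lt with h0 | h0
    · have hs0 : s = 0 := by linarith
      have ht0 : t = 0 := by linarith
      have := one_le_neg_bil p z
      rw [h2, hs0, ht0] at this
      norm_num at this
    · exact h0
  have hc := Real.cosh_pos r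
  rw [h2]
  rcases hs.eq_or_lt with h0 | h0
  · subst h0
    nlinarith
  · nlinarith

/-- For a small nonzero `t` the point on the line through `x + t • w` still lies in `U`, so `w` is a
combination of this point and `x`. -/
theorem span_eq_top_of_isOpen {U : Set (Hyp S e)} (hU : IsOpen U) (hne : U.Nonempty) :
    Submodule.span ℝ (Subtype.val '' U) = ⊤ := by
  obtain ⟨x, hx⟩ := hne
  rw [eq_top_iff]
  rintro w -
  let p : ℝ → Fin (n + 1) → ℝ := fun t => x.1 + t • w
  have hp : Continuous p := by fun_prop
  have hq : Continuous fun t => bil S (p t) (p t) := continuous_bil S hp hp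
  have hq' : Continuous fun t => bil S x.1 (p t) := continuous_bil S continuous_const hp
  have h0 : p 0 = x.1 := by simp [p]
  let V : Set ℝ := {t | bil S (p t) (p t) < 0 ∧ bil S x.1 (p t) < 0}
  have hV : IsOpen V := (isOpen_lt hq continuous_const).inter (isOpen_lt hq' continuous_const)
  have h0V : (0 : ℝ) ∈ V := by
    simp only [V, Set.mem_ofPred_eq, h0, hyp_self]; norm_num
  let f : V → Hyp S e := fun t => hypNormalize x (p t) t.2.1 t.2.2
  have hf : Continuous f := by
    have hps : Continuous fun t : V => p t := hp.comp continuous_subtype_val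
    have hf' : Continuous fun t : V => (√(-bil S (p t) (p t)))⁻¹ • p t :=
      ((continuous_bil S hps hps).neg.sqrt.inv₀ fun t =>
        (Real.sqrt_pos.2 (neg_pos.2 t.2.1)).ne').smul hps
    exact hf'.subtype_mk _
  have hf0 : f ⟨0, h0V⟩ = x := Subtype.ext (by simp [f, hypNormalize, h0, hyp_self])
  have h1 : f ⁻¹' U ∈ nhds (⟨0, h0V⟩ : V) := hf.continuousAt.preimage_mem_nhds (by
    rw [hf0]; exact hU.mem_nhds hx)
  have h2 : Subtype.val '' (f ⁻¹' U) ∈ nhds (0 : ℝ) :=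
    hV.isOpenMap_subtype_val.image_mem_nhds h1
  obtain ⟨ε, hε, h3⟩ := Metric.mem_nhds_iff.1 h2
  obtain ⟨⟨t, htV⟩, ht, hte⟩ := h3 (show ε / 2 ∈ Metric.ball 0 ε by
    rw [Metric.mem_ball, Real.dist_eq, sub_zero, abs_of_pos (by linarith)]; linarith)
  simp only at hte
  have ht0 : t ≠ 0 := by rw [hte]; positivity
  have hs : √(-bil S (p t) (p t)) ≠ 0 := (Real.sqrt_pos.2 (neg_pos.2 htV.1)).ne'
  have h4 : (f ⟨t, htV⟩).1 ∈ Submodule.span ℝ (Subtype.val '' U) :=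
    Submodule.subset_span ⟨_, ht, rfl⟩
  have h5 : p t ∈ Submodule.span ℝ (Subtype.val '' U) := by
    have := Submodule.smul_mem _ (√(-bil S (p t) (p t))) h4
    simpa [f, hypNormalize, smul_smul, hs] using this
  have h6 := Submodule.sub_mem _ h5 (Submodule.subset_span ⟨x, hx, rfl⟩)
  have h7 := Submodule.smul_mem _ t⁻¹ h6
  simpa [p, smul_smul, ht0] using h7

/-! ## Isometries -/

theorem smul_val (g : ↥(PO S e)) (x : Hyp S e) : (g • x).1 = g.1.1.mulVec x.1 := rfl

theorem bil_PO (g : ↥(PO S e)) (x y : Fin (n + 1) → ℝ) :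
    bil S (g.1.1.mulVec x) (g.1.1.mulVec y) = bil S x y := by
  rw [bil_mulVec_mulVec, g.2.1]

theorem hdist_smul (g : ↥(PO S e)) (x y : Hyp S e) : hdist (g • x) (g • y) = hdist x y := by
  rw [hdist, hdist, smul_val, smul_val, bil_PO]

theorem hdist_smul_left (g : ↥(PO S e)) (x y : Hyp S e) : hdist (g • x) y = hdist x (g⁻¹ • y) := by
  rw [← hdist_smul g x, smul_inv_smul]

instance : ContinuousSMul ↥(PO S e) (Hyp S e) where
  continuous_smul := by
    refine Continuous.subtype_mk ?_ _
    have h1 : Continuous fun p : ↥(PO S e) × Hyp S e => p.1.1.1 :=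
      Units.continuous_val.comp (continuous_subtype_val.comp continuous_fst)
    exact h1.matrix_mulVec (continuous_subtype_val.comp continuous_snd)

/-- An orthogonal matrix either preserves or exchanges the two sheets, which can be tested at a
single point. -/
theorem mem_PO_iff (x : Hyp S e) (g : GL (Fin (n + 1)) ℝ) :
    g ∈ PO S e ↔ g.1.transpose * S * g.1 = S ∧
      bil S x.1 (g.1.mulVec x.1) < 0 := by
  refine ⟨fun h => ⟨h.1, ((mem_hypSet_iff x _).1 ((h.2 x.1).2 x.2)).2⟩, fun ⟨h1, h2⟩ => ⟨h1, ?_⟩⟩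
  have h3 : ∀ y z, bil S (g.1.mulVec y) (g.1.mulVec z) =
      bil S y z := fun y z => by rw [bil_mulVec_mulVec, h1]
  have h4 : g.1.mulVec x.1 ∈ hypSet S e :=
    (mem_hypSet_iff x _).2 ⟨by rw [h3, hyp_self], h2⟩
  intro y
  rw [mem_hypSet_iff x y, mem_hypSet_iff ⟨_, h4⟩, h3, h3]

theorem eq_of_eqOn_isOpen {U : Set (Hyp S e)} (hU : IsOpen U) (hne : U.Nonempty)
    {g h : ↥(PO S e)} (hgh : ∀ x ∈ U, g • x = h • x) : g = h := by
  have h1 : g.1.1.mulVecLin = h.1.1.mulVecLin := by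
    refine LinearMap.ext_on (span_eq_top_of_isOpen hU hne) ?_
    rintro _ ⟨x, hx, rfl⟩
    exact congrArg Subtype.val (hgh x hx)
  exact Subtype.ext (Units.ext (Matrix.toLin'.injective h1))

theorem exists_PO_of_linearMap {f : (Fin (n + 1) → ℝ) →ₗ[ℝ] (Fin (n + 1) → ℝ)}
    (hf : ∀ x y, bil S (f x) (f y) = bil S x y) {x x' : Hyp S e} (hx : f x.1 = x'.1) :
    ∃ g : ↥(PO S e), ∀ y, g.1.1.mulVec y = f y := by
  have h1 : (LinearMap.toMatrix' f).transpose * S * LinearMap.toMatrix' f = S := by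
    refine eq_of_forall_bil_eq fun x y => ?_
    rw [← bil_mulVec_mulVec, LinearMap.toMatrix'_mulVec, LinearMap.toMatrix'_mulVec, hf]
  have h2 : (LinearMap.toMatrix' f).det ≠ 0 := by
    intro h
    have := congrArg Matrix.det h1
    rw [Matrix.det_mul, h, mul_zero] at this
    exact det_ne_zero this.symm
  refine ⟨⟨Matrix.GeneralLinearGroup.mkOfDetNeZero _ h2, (mem_PO_iff x _).2 ⟨h1, ?_⟩⟩, ?_⟩
  · change bil S x.1 ((LinearMap.toMatrix' f).mulVec x.1) < 0
    rw [LinearMap.toMatrix'_mulVec, hx]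
    exact bil_hyp_neg x x'
  · intro y
    exact LinearMap.toMatrix'_mulVec f y

/-- A distance preserving map defined on a nonempty open set is the restriction of an isometry. -/
theorem exists_PO_of_isometry {U : Set (Hyp S e)} (hU : IsOpen U) (hne : U.Nonempty)
    (f : Hyp S e → Hyp S e) (hf : ∀ x ∈ U, ∀ y ∈ U, hdist (f x) (f y) = hdist x y) :
    ∃ g : ↥(PO S e), ∀ x ∈ U, g • x = f x := by
  -- Points of `U` contain a basis of `ℝⁿ⁺¹`. Its images under `f` define a linear map `L`, the only
  -- candidate for the extension.
  obtain ⟨B, hBU, hspan, hli⟩ := exists_linearIndependent ℝ (Subtype.val '' U)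
  rw [span_eq_top_of_isOpen hU hne] at hspan
  let b : Module.Basis B ℝ (Fin (n + 1) → ℝ) := Module.Basis.mk hli (by simp [hspan])
  have hb : ∀ i, b i = i.1 := fun i => by simp [b]
  have hmem : ∀ i : B, ∃ x ∈ U, x.1 = i.1 := fun i => hBU i.2
  choose u huU hu using hmem
  let L := b.constr ℝ fun i => (f (u i)).1
  have hL : ∀ i, L i.1 = (f (u i)).1 := fun i => by rw [← hb i]; simp [L]
  have ind : ∀ P : (Fin (n + 1) → ℝ) → Prop, P 0 → (∀ y z, P y → P z → P (y + z)) →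
      (∀ (r : ℝ) y, P y → P (r • y)) → (∀ i, P (b i)) → ∀ y, P y := by
    intro P h0 ha hs hi y
    have hy : y ∈ Submodule.span ℝ (Set.range b) := by rw [b.span_eq]; trivial
    induction hy using Submodule.span_induction with
    | mem y hy => obtain ⟨i, rfl⟩ := hy; exact hi i
    | zero => exact h0
    | add y z _ _ hy hz => exact ha y z hy hz
    | smul r y _ hy => exact hs r y hy
  -- On basis vectors this is the preservation of distances by `f`; it extends linearly in `y`, and
  -- then `hbil` extends it in the other variable.
  have key : ∀ x ∈ U, ∀ y, bil S (f x).1 (L y) = bil S x.1 y := by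
    intro x hx
    refine ind _ (by simp) (fun y z hy hz => ?_) (fun r y hy => ?_) fun i => ?_
    · rw [map_add, bil_add_right, bil_add_right, hy, hz]
    · rw [map_smul, bil_smul_right, bil_smul_right, hy]
    · rw [hb, hL, ← hu i, ← hdist_eq_hdist_iff]
      exact hf _ hx _ (huU i)
  have hbil : ∀ x y, bil S (L x) (L y) = bil S x y := by
    intro x y
    revert x
    refine ind _ (by simp) (fun y z hy hz => ?_) (fun r y hy => ?_) fun i => ?_
    · rw [map_add, bil_add_left, bil_add_left, hy, hz]
    · rw [map_smul, bil_smul_left, bil_smul_left, hy]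
    · rw [hb, hL, ← hu i, key _ (huU i)]
  have hinj : Function.Injective L := by
    rw [injective_iff_map_eq_zero]
    intro x hx
    refine eq_zero_of_forall_bil_eq_zero (S := S) fun y => ?_
    rw [← hbil, hx, bil_zero_left]
  have hsurj : Function.Surjective L := LinearMap.surjective_of_injective hinj
  -- The difference is orthogonal to the image of `L`, which is the whole space.
  have hfL : ∀ x ∈ U, L x.1 = (f x).1 := by
    intro x hx
    rw [← sub_eq_zero]
    refine eq_zero_of_forall_bil_eq_zero (S := S) fun y => ?_
    obtain ⟨z, rfl⟩ := hsurj y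
    rw [bil_sub_left, hbil, key x hx, sub_self]
  obtain ⟨x, hx⟩ := hne
  obtain ⟨g, hg⟩ := exists_PO_of_linearMap hbil (hfL x hx)
  exact ⟨g, fun y hy => Subtype.ext (by rw [smul_val, hg, hfL y hy])⟩

/-! ## Compactness and discreteness -/

/-- The inverse has to be bounded too: the topology of the unit group is that of the closed set of
pairs `(u, u⁻¹)`. -/
theorem isCompact_GL_of_bounded {m : Type*} [Fintype m] [DecidableEq m] (B : ℝ) :
    IsCompact {u : GL m ℝ | (∀ i j, |u.1 i j| ≤ B) ∧ ∀ i j, |(u⁻¹).1 i j| ≤ B} := by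
  have h1 : IsCompact {a : Matrix m m ℝ | ∀ i j, |a i j| ≤ B} := by
    have : {a : Matrix m m ℝ | ∀ i j, |a i j| ≤ B} =
        Set.pi Set.univ fun _ => Set.pi Set.univ fun _ => Set.Icc (-B) B := by
      ext a
      exact ⟨fun h i _ j _ => abs_le.1 (h i j), fun h i j => abs_le.2 (h i trivial j trivial)⟩
    rw [this]
    exact isCompact_univ_pi fun _ => isCompact_univ_pi fun _ => isCompact_Icc
  have h2 := h1.prod (h1.image (f := MulOpposite.op) MulOpposite.continuous_op)
  have h3 := (Units.isClosedEmbedding_embedProduct (α := Matrix m m ℝ)).isCompact_preimage h2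
  convert h3 using 1
  ext u
  refine and_congr_right fun _ => ⟨fun h => ⟨_, h, rfl⟩, ?_⟩
  rintro ⟨x, hx, h⟩
  rw [← MulOpposite.op_injective h]
  exact hx

instance : Nonempty (Hyp S e) := by
  have he : bil S e e < 0 := Timelike.neg
  have h1 : 0 < √(-bil S e e) := Real.sqrt_pos.2 (neg_pos.2 he)
  have h2 := Real.sq_sqrt (neg_pos.2 he).le
  refine ⟨⟨(√(-bil S e e))⁻¹ • e, ?_, ?_⟩⟩
  · simp only [bil_smul_left, bil_smul_right]
    field_simp
    linarith
  · rw [bil_smul_left]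
    exact mul_neg_of_pos_of_neg (inv_pos.2 h1) he

theorem isClosed_PO : IsClosed (PO S e : Set (GL (Fin (n + 1)) ℝ)) := by
  obtain ⟨x⟩ : Nonempty (Hyp S e) := inferInstance
  have h0 : (PO S e : Set (GL (Fin (n + 1)) ℝ)) = {g | g.1.transpose * S * g.1 = S} ∩
      {g | bil S x.1 (g.1.mulVec x.1) ≤ -1} := by
    ext g
    rw [SetLike.mem_coe, mem_PO_iff x]
    refine and_congr_right fun h => ⟨fun h' => ?_, fun h' => lt_of_le_of_lt h' (by norm_num)⟩
    have := bil_sq_le_of_hyp x (g.1.mulVec x.1)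
    rw [bil_mulVec_mulVec, h, hyp_self] at this
    simp only [Set.mem_ofPred_eq]
    nlinarith
  have hv : Continuous fun g : GL (Fin (n + 1)) ℝ => g.1 := Units.continuous_val
  rw [h0]
  exact (isClosed_eq (by fun_prop) continuous_const).inter
    (isClosed_le (continuous_bil S continuous_const (by fun_prop)) continuous_const)

/-- The pairing of `o` with `g y` equals that of `g⁻¹ o` with `y`, and `g⁻¹ o` stays in a compact
ball. As `g` preserves the form, the definite form at `o` is bounded on each column of `g`. -/
theorem abs_le_of_hdist_le (o : Hyp S e) (R : ℝ) :
    ∃ B : ℝ, ∀ g : ↥(PO S e), hdist o (g • o) ≤ R → ∀ i j, |g.1.1 i j| ≤ B := by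
  obtain ⟨C, hC, hb⟩ := exists_norm_sq_le_bil o
  -- the entries of `g` in a column `y` are bounded by the positive definite form at `g y`
  have hcol : ∀ y : Fin (n + 1) → ℝ, ∃ B : ℝ, ∀ g : ↥(PO S e), hdist o (g • o) ≤ R →
      ‖g.1.1.mulVec y‖ ≤ B := by
    intro y
    have hK : IsCompact {z : Hyp S e | hdist o z ≤ R} :=
      isCompact_of_bounded (isClosed_hball o R) o R fun _ h => h
    obtain ⟨B, hB⟩ := hK.exists_bound_of_continuousOn
      (continuous_bil S continuous_subtype_val (continuous_const (y := y))).continuousOn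
    refine ⟨√(C * (bil S y y + 2 * B ^ 2)), fun g hg => Real.le_sqrt_of_sq_le ((hb _).trans ?_)⟩
    have h1 : bil S o.1 (g.1.1.mulVec y) = bil S (g⁻¹ • o).1 y := by
      rw [← bil_PO g (g⁻¹ • o).1, ← smul_val, smul_inv_smul]
    have h2 := hB (g⁻¹ • o) (by
      simp only [Set.mem_ofPred_eq]; rwa [hdist_comm, hdist_smul_left, inv_inv])
    rw [bil_PO, h1]
    gcongr C * (_ + 2 * ?_)
    rw [← sq_abs]
    exact pow_le_pow_left₀ (abs_nonneg _) h2 2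
  choose B hB using fun j : Fin (n + 1) => hcol (Pi.single j 1)
  refine ⟨∑ j, |B j|, fun g hg i j => ?_⟩
  have h1 := (norm_le_pi_norm _ i).trans (hB j g hg)
  rw [Matrix.mulVec_single_one] at h1
  exact h1.trans ((le_abs_self _).trans
    (Finset.single_le_sum (f := fun j => |B j|) (fun j _ => abs_nonneg _) (Finset.mem_univ j)))

theorem isCompact_PO_of_bounded (o : Hyp S e) (R : ℝ) :
    IsCompact {g : ↥(PO S e) | hdist o (g • o) ≤ R} := by
  obtain ⟨B, hB⟩ := abs_le_of_hdist_le o R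
  have hemb : Topology.IsClosedEmbedding (Subtype.val : ↥(PO S e) → GL (Fin (n + 1)) ℝ) :=
    isClosed_PO.isClosedEmbedding_subtypeVal
  refine (hemb.isCompact_preimage (isCompact_GL_of_bounded B)).of_isClosed_subset ?_ ?_
  · exact isClosed_le (continuous_hdist continuous_const (by fun_prop)) continuous_const
  · intro g hg
    refine ⟨hB g hg, hB g⁻¹ ?_⟩
    rwa [hdist_comm, hdist_smul_left, inv_inv]

/-- Only finitely many elements of `Γ` move a given point by a bounded distance. -/
def ProperlyDiscontinuous (Γ : Subgroup ↥(PO S e)) : Prop :=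
  ∀ (x : Hyp S e) (R : ℝ), {g | g ∈ Γ ∧ hdist x (g • x) ≤ R}.Finite

/-- No nontrivial element of `Γ` has a fixed point. -/
def ActsFreely (Γ : Subgroup ↥(PO S e)) : Prop :=
  ∀ g ∈ Γ, ∀ x : Hyp S e, g • x = x → g = 1

/-- A discrete subgroup is closed, hence meets the compact set of isometries with bounded
displacement in a finite set. -/
theorem properlyDiscontinuous_of_discrete (Γ : Subgroup ↥(PO S e)) [DiscreteTopology ↥Γ] :
    ProperlyDiscontinuous Γ := by
  intro x R
  have h1 : IsClosed (Γ : Set ↥(PO S e)) := Subgroup.isClosed_of_discrete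
  have h2 : IsCompact {g | g ∈ Γ ∧ hdist x (g • x) ≤ R} := (isCompact_PO_of_bounded x R).inter_left h1
  have h3 : IsDiscrete (Γ : Set ↥(PO S e)) := ⟨inferInstance⟩
  exact h2.finite (h3.mono fun g hg => hg.1)

theorem ProperlyDiscontinuous.mono {Γ Γ' : Subgroup ↥(PO S e)} (h : Γ' ≤ Γ)
    (hΓ : ProperlyDiscontinuous Γ) : ProperlyDiscontinuous Γ' := fun x R =>
  (hΓ x R).subset fun _ hg => ⟨h hg.1, hg.2⟩

theorem ActsFreely.mono {Γ Γ' : Subgroup ↥(PO S e)} (h : Γ' ≤ Γ)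
    (hΓ : ActsFreely Γ) : ActsFreely Γ' := fun g hg => hΓ g (h hg)

/-- All powers of an element with a fixed point have displacement `0` there, so they are finite in
number and the element has finite order. -/
theorem ProperlyDiscontinuous.actsFreely {Γ : Subgroup ↥(PO S e)} (h : ProperlyDiscontinuous Γ)
    (htf : ∀ g ∈ Γ, IsOfFinOrder g → g = 1) : ActsFreely Γ := by
  intro g hg x hx
  refine htf g hg ?_
  by_contra hinf
  rw [← injective_pow_iff_not_isOfFinOrder] at hinf
  refine Set.infinite_range_of_injective hinf ((h x 0).subset ?_)
  rintro _ ⟨k, rfl⟩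
  refine ⟨Γ.pow_mem hg k, ?_⟩
  have : g ^ k • x = x := by
    induction k with
    | zero => simp
    | succ k ih => rw [pow_succ, mul_smul, hx, ih]
  simp only [this, hdist_self, le_refl]

theorem ProperlyDiscontinuous.finite_pair {Γ : Subgroup ↥(PO S e)} (h : ProperlyDiscontinuous Γ)
    (x y : Hyp S e) (R : ℝ) : {g | g ∈ Γ ∧ hdist x (g • y) ≤ R}.Finite := by
  refine (h x (R + hdist y x)).subset fun g hg => ⟨hg.1, ?_⟩
  refine (hdist_triangle x (g • y) (g • x)).trans ?_
  rw [hdist_smul]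
  linarith [hg.2]

/-- Only finitely many elements move `x` by at most `1`; `r` is the least positive displacement
among them, or `1` if there is none. -/
theorem exists_injectivity_radius {Γ : Subgroup ↥(PO S e)} (h : ProperlyDiscontinuous Γ)
    (hfree : ActsFreely Γ) (x : Hyp S e) :
    ∃ r > 0, ∀ g ∈ Γ, g ≠ 1 → r ≤ hdist x (g • x) := by
  have hfin : {g | (g ∈ Γ ∧ hdist x (g • x) ≤ 1) ∧ g ≠ 1}.Finite :=
    (h x 1).subset fun g hg => hg.1
  rcases Set.eq_empty_or_nonempty {g | (g ∈ Γ ∧ hdist x (g • x) ≤ 1) ∧ g ≠ 1} with h0 | h0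
  · refine ⟨1, one_pos, fun g hg hg1 => ?_⟩
    by_contra! hlt
    have : g ∈ {g | (g ∈ Γ ∧ hdist x (g • x) ≤ 1) ∧ g ≠ 1} := ⟨⟨hg, hlt.le⟩, hg1⟩
    rw [h0] at this
    exact this
  · obtain ⟨k, ⟨hk, hk1⟩, hmin⟩ := hfin.exists_minimalFor (fun g => hdist x (g • x)) _ h0
    refine ⟨hdist x (k • x), ?_, fun g hg hg1 => ?_⟩
    · refine (hdist_nonneg _ _).lt_of_ne fun h0 => hk1 (hfree k hk.1 x ?_)
      exact (eq_of_hdist_eq_zero h0.symm).symm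
    · by_contra! hlt
      exact absurd (hmin (j := g) ⟨⟨hg, hlt.le.trans hk.2⟩, hg1⟩ hlt.le) (not_le.2 hlt)

/-! ## Quotient distances -/

section QuotDist

variable {X : Type*} {s : Setoid X} {d : X → X → ℝ}

theorem quotDist_bddBelow (hd : ∀ x y, 0 ≤ d x y) (a b : Quotient s) :
    BddBelow {r | ∃ x y : X, Quotient.mk s x = a ∧ Quotient.mk s y = b ∧ r = d x y} :=
  ⟨0, by rintro _ ⟨x, y, -, -, rfl⟩; exact hd x y⟩

theorem quotDist_mk_le (hd : ∀ x y, 0 ≤ d x y) (x y : X) :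
    quotDist s d (Quotient.mk s x) (Quotient.mk s y) ≤ d x y :=
  csInf_le (quotDist_bddBelow hd _ _) ⟨x, y, rfl, rfl, rfl⟩

theorem quotDist_nonneg (hd : ∀ x y, 0 ≤ d x y) (a b : Quotient s) : 0 ≤ quotDist s d a b :=
  Real.sInf_nonneg (by rintro _ ⟨x, y, -, -, rfl⟩; exact hd x y)

theorem exists_of_quotDist_lt {a b : Quotient s} {c : ℝ} (h : quotDist s d a b < c) :
    ∃ x y, Quotient.mk s x = a ∧ Quotient.mk s y = b ∧ d x y < c := by
  obtain ⟨x₀, rfl⟩ := Quotient.exists_rep a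
  obtain ⟨y₀, rfl⟩ := Quotient.exists_rep b
  obtain ⟨_, ⟨x, y, hx, hy, rfl⟩, hlt⟩ := exists_lt_of_csInf_lt (by exact ⟨_, x₀, y₀, rfl, rfl, rfl⟩) h
  exact ⟨x, y, hx, hy, hlt⟩

theorem quotDist_comm (hd : ∀ x y, d x y = d y x) (a b : Quotient s) :
    quotDist s d a b = quotDist s d b a := by
  unfold quotDist
  congr 1
  ext r
  constructor <;> rintro ⟨x, y, hx, hy, rfl⟩ <;> exact ⟨y, x, hy, hx, hd _ _⟩

end QuotDist

/-- `s` identifies the points of `X → ℍⁿ` with the same image modulo `Γ`. -/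
structure IsGroupSetoid (Γ : Subgroup ↥(PO S e)) {X : Type*} (ι : X → Hyp S e) (s : Setoid X) :
    Prop where
  rel : ∀ x y, s x y ↔ ∃ g ∈ Γ, g • ι x = ι y
  smul_mem : ∀ g ∈ Γ, ∀ x, ∃ y, ι y = g • ι x

namespace IsGroupSetoid

variable {Γ : Subgroup ↥(PO S e)} {X : Type*} {ι : X → Hyp S e} {s : Setoid X}
  (hs : IsGroupSetoid Γ ι s)

/-- The quotient distance of the hyperbolic distance. -/
abbrev qdist (ι : X → Hyp S e) (s : Setoid X) : Quotient s → Quotient s → ℝ :=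
  quotDist s fun x y => hdist (ι x) (ι y)

include hs

theorem mk_eq_iff {x y : X} : Quotient.mk s x = Quotient.mk s y ↔ ∃ g ∈ Γ, g • ι x = ι y := by
  rw [Quotient.eq, hs.rel]

theorem exists_smul_of_lt {x y : X} {c : ℝ}
    (h : qdist ι s (Quotient.mk s x) (Quotient.mk s y) < c) :
    ∃ g ∈ Γ, hdist (ι x) (g • ι y) < c := by
  obtain ⟨x', y', hx, hy, hlt⟩ := exists_of_quotDist_lt h
  obtain ⟨a, ha, hax⟩ := hs.mk_eq_iff.1 hx
  obtain ⟨b, hb, hby⟩ := hs.mk_eq_iff.1 hy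
  refine ⟨a * b⁻¹, Γ.mul_mem ha (Γ.inv_mem hb), ?_⟩
  rwa [← hax, ← hby, mul_smul, inv_smul_smul, hdist_smul]

theorem le_qdist {x y : X} {c : ℝ} (h : ∀ g ∈ Γ, c ≤ hdist (ι x) (g • ι y)) :
    c ≤ qdist ι s (Quotient.mk s x) (Quotient.mk s y) := by
  by_contra! hlt
  obtain ⟨g, hg, hlt⟩ := hs.exists_smul_of_lt hlt
  exact absurd (h g hg) (not_le.2 hlt)

theorem qdist_le_smul {x y : X} {g : ↥(PO S e)} (hg : g ∈ Γ) :
    qdist ι s (Quotient.mk s x) (Quotient.mk s y) ≤ hdist (ι x) (g • ι y) := by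
  obtain ⟨z, hz⟩ := hs.smul_mem g hg y
  have : Quotient.mk s y = Quotient.mk s z := hs.mk_eq_iff.2 ⟨g, hg, hz.symm⟩
  rw [this, ← hz]
  exact quotDist_mk_le (fun _ _ => hdist_nonneg _ _) x z

theorem qdist_triangle (a b c : Quotient s) :
    qdist ι s a c ≤ qdist ι s a b + qdist ι s b c := by
  obtain ⟨x, rfl⟩ := Quotient.exists_rep a
  obtain ⟨y, rfl⟩ := Quotient.exists_rep b
  obtain ⟨z, rfl⟩ := Quotient.exists_rep c
  refine le_of_forall_pos_lt_add fun ε hε => ?_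
  obtain ⟨g, hg, h1⟩ := hs.exists_smul_of_lt (lt_add_of_pos_right
    (qdist ι s (Quotient.mk s x) (Quotient.mk s y)) (half_pos hε))
  obtain ⟨k, hk, h2⟩ := hs.exists_smul_of_lt (lt_add_of_pos_right
    (qdist ι s (Quotient.mk s y) (Quotient.mk s z)) (half_pos hε))
  have h3 := hs.qdist_le_smul (x := x) (y := z) (Γ.mul_mem hg hk)
  have h4 := hdist_triangle (ι x) (g • ι y) ((g * k) • ι z)
  rw [mul_smul, hdist_smul] at h4
  rw [mul_smul] at h3
  linarith

/-- The projection preserves distances on small balls. -/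
theorem qdist_eq_hdist (x₀ : Hyp S e) {r : ℝ} (hr : ∀ g ∈ Γ, g ≠ 1 → r ≤ hdist x₀ (g • x₀))
    {x y : X} (hx : hdist x₀ (ι x) < r / 4) (hy : hdist x₀ (ι y) < r / 4) :
    qdist ι s (Quotient.mk s x) (Quotient.mk s y) = hdist (ι x) (ι y) := by
  refine le_antisymm (quotDist_mk_le (fun _ _ => hdist_nonneg _ _) x y) (hs.le_qdist ?_)
  intro g hg
  rcases eq_or_ne g 1 with rfl | hg1
  · rw [one_smul]
  -- A nontrivial translate of `ι y` is farther than `r - r/4 - r/4 = r/2` from `ι x`, while the two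
  -- points are closer than `r/2`; hence the choice of `r/4`.
  · have h1 := hr g hg hg1
    have h2 := hdist_triangle x₀ (ι x) (g • x₀)
    have h3 := hdist_triangle (ι x) (g • ι y) (g • x₀)
    have h4 := hdist_triangle (ι x) x₀ (ι y)
    rw [hdist_smul, hdist_comm (ι y)] at h3
    rw [hdist_comm (ι x) x₀] at h4
    linarith

/-- By proper discontinuity the infimum over the orbit is attained. -/
theorem eq_of_qdist_eq_zero (hΓ : ProperlyDiscontinuous Γ) {a b : Quotient s}
    (h : qdist ι s a b = 0) : a = b := by
  obtain ⟨x, rfl⟩ := Quotient.exists_rep a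
  obtain ⟨y, rfl⟩ := Quotient.exists_rep b
  obtain ⟨g₁, hg₁, h1⟩ := hs.exists_smul_of_lt (c := 1) (by rw [h]; exact one_pos)
  obtain ⟨k, hk, hmin⟩ := (hΓ.finite_pair (ι x) (ι y) 1).exists_minimalFor
    (fun g => hdist (ι x) (g • ι y)) _ ⟨g₁, hg₁, h1.le⟩
  have h0 : hdist (ι x) (k • ι y) = 0 := by
    by_contra hne
    have hpos := (hdist_nonneg _ _).lt_of_ne (Ne.symm hne)
    rw [← h] at hpos
    obtain ⟨g, hg, hlt⟩ := hs.exists_smul_of_lt hpos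
    exact absurd (hmin (j := g) ⟨hg, hlt.le.trans hk.2⟩ hlt.le) (not_le.2 hlt)
  refine hs.mk_eq_iff.2 ⟨k⁻¹, Γ.inv_mem hk.1, ?_⟩
  rw [eq_of_hdist_eq_zero h0, inv_smul_smul]

end IsGroupSetoid

theorem isGroupSetoid_orbitRel (Γ : Subgroup ↥(PO S e)) :
    IsGroupSetoid Γ (fun x : Hyp S e => x) (MulAction.orbitRel ↥Γ (Hyp S e)) where
  rel x y := by
    rw [MulAction.orbitRel_apply]
    constructor
    · rintro ⟨g, rfl⟩
      exact ⟨g.1⁻¹, Γ.inv_mem g.2, inv_smul_smul g.1 y⟩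
    · rintro ⟨g, hg, rfl⟩
      exact ⟨⟨g, hg⟩⁻¹, inv_smul_smul g x⟩
  smul_mem g _ x := ⟨g • x, rfl⟩

theorem smul_mem_closure {C : Set (Hyp S e)} {g : ↥(PO S e)} (hg : g • C = C) {x : Hyp S e}
    (hx : x ∈ closure C) : g • x ∈ closure C := by
  have h1 := image_closure_subset_closure_image (s := C) (continuous_const_smul g)
    (Set.mem_image_of_mem _ hx)
  rwa [Set.image_smul, hg] at h1

theorem isGroupSetoid_pieceSetoid (Λ : Subgroup ↥(PO S e)) (C : Set (Hyp S e)) :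
    IsGroupSetoid (pieceGroup Λ C) (fun x : ↥(closure C) => (x : Hyp S e))
      (pieceSetoid (pieceGroup Λ C) C) where
  rel _ _ := Iff.rfl
  smul_mem g hg x := ⟨⟨g • (x : Hyp S e), smul_mem_closure hg.2 x.2⟩, rfl⟩

/-! ## Hyperplanes and reflections -/

/-- The matrix of the reflection in the orthogonal complement of `v`. -/
def reflMatrix {F : Type*} [Field F] (B : Matrix (Fin (n + 1)) (Fin (n + 1)) F)
    (v : Fin (n + 1) → F) : Matrix (Fin (n + 1)) (Fin (n + 1)) F :=
  1 - (2 / bil B v v) • Matrix.vecMulVec v (Matrix.vecMul v B)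

theorem reflMatrix_mulVec {F : Type*} [Field F] (B : Matrix (Fin (n + 1)) (Fin (n + 1)) F)
    (v y : Fin (n + 1) → F) :
    (reflMatrix B v).mulVec y = y - (2 / bil B v v * bil B v y) • v := by
  rw [reflMatrix, Matrix.sub_mulVec, Matrix.one_mulVec, Matrix.smul_mulVec,
    Matrix.vecMulVec_mulVec, ← Matrix.dotProduct_mulVec]
  simp only [bil, op_smul_eq_smul, smul_smul]

theorem reflMatrix_mul_self {F : Type*} [Field F] {B : Matrix (Fin (n + 1)) (Fin (n + 1)) F}
    {v : Fin (n + 1) → F} (hv : bil B v v ≠ 0) : reflMatrix B v * reflMatrix B v = 1 := by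
  refine Matrix.toLin'.injective (LinearMap.ext fun y => ?_)
  rw [Matrix.toLin'_mul, LinearMap.comp_apply, Matrix.toLin'_apply, Matrix.toLin'_apply,
    reflMatrix_mulVec, reflMatrix_mulVec, Matrix.toLin'_one, LinearMap.id_apply, bil_sub_right,
    bil_smul_right, sub_sub, ← add_smul]
  have : 2 / bil B v v * bil B v y +
      2 / bil B v v * (bil B v y - 2 / bil B v v * bil B v y * bil B v v) = 0 := by
    field_simp
    ring
  rw [this, zero_smul, sub_zero]

/-- The reflection in a vector that is not isotropic. -/
def reflGL {F : Type*} [Field F] (B : Matrix (Fin (n + 1)) (Fin (n + 1)) F)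
    (v : Fin (n + 1) → F) (hv : bil B v v ≠ 0) : GL (Fin (n + 1)) F :=
  ⟨reflMatrix B v, reflMatrix B v, reflMatrix_mul_self hv, reflMatrix_mul_self hv⟩

theorem map_reflMatrix {F F' : Type*} [Field F] [Field F'] (i : F →+* F')
    (B : Matrix (Fin (n + 1)) (Fin (n + 1)) F) (v : Fin (n + 1) → F) :
    (reflMatrix B v).map i = reflMatrix (B.map i) (fun k => i (v k)) := by
  ext k l
  simp [reflMatrix, Matrix.one_apply, apply_ite i, Matrix.vecMulVec_apply, Matrix.vecMul,
    dotProduct, map_bil]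
  exact Or.inl (by rw [map_ofNat])

variable (e) in
/-- The reflection of hyperbolic space in the hyperplane orthogonal to a positive vector. -/
def hypReflection {v : Fin (n + 1) → ℝ} (hv : 0 < bil S v v) : ↥(PO S e) :=
  ⟨reflGL S v hv.ne', by
    obtain ⟨x⟩ : Nonempty (Hyp S e) := inferInstance
    refine (mem_PO_iff x _).2 ⟨eq_of_forall_bil_eq fun y z => ?_, ?_⟩
    · rw [← bil_mulVec_mulVec]
      simp only [reflGL, reflMatrix_mulVec, bil_sub_left, bil_sub_right, bil_smul_left,
        bil_smul_right, bil_comm y v]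
      field_simp
      ring
    · simp only [reflGL, reflMatrix_mulVec, bil_sub_right, bil_smul_right, hyp_self,
        bil_comm x.1 v]
      have : 0 ≤ 2 / bil S v v * bil S v x.1 * bil S v x.1 := by
        rw [mul_assoc]
        exact mul_nonneg (by positivity) (mul_self_nonneg _)
      linarith⟩

section Reflection

variable {v : Fin (n + 1) → ℝ} (hv : 0 < bil S v v)

theorem hypReflection_smul_val (x : Hyp S e) :
    (hypReflection e hv • x).1 = x.1 - (2 / bil S v v * bil S v x.1) • v :=
  reflMatrix_mulVec S v x.1

theorem bil_hypReflection_smul (x : Hyp S e) :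
    bil S v (hypReflection e hv • x).1 = -bil S v x.1 := by
  rw [hypReflection_smul_val, bil_sub_right, bil_smul_right]
  field_simp
  ring

theorem hypReflection_smul_of_mem {x : Hyp S e} (hx : x ∈ hyperplane S e v) :
    hypReflection e hv • x = x :=
  Subtype.ext (by
    rw [hypReflection_smul_val, show bil S v x.1 = 0 from hx, mul_zero, zero_smul, sub_zero])

theorem hypReflection_mul_self : hypReflection e hv * hypReflection e hv = 1 :=
  Subtype.ext (Units.ext (reflMatrix_mul_self hv.ne'))

theorem hypReflection_inv : (hypReflection e hv)⁻¹ = hypReflection e hv :=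
  inv_eq_of_mul_eq_one_left (hypReflection_mul_self hv)

theorem hypReflection_smul_smul (x : Hyp S e) :
    hypReflection e hv • hypReflection e hv • x = x := by
  rw [smul_smul, hypReflection_mul_self, one_smul]

theorem hypReflection_ne_one : hypReflection e hv ≠ 1 := by
  intro h
  have h1 : (reflMatrix S v).mulVec v = v := by
    have : reflMatrix S v = 1 := congrArg (fun g : ↥(PO S e) => g.1.1) h
    rw [this, Matrix.one_mulVec]
  rw [reflMatrix_mulVec, div_mul_cancel₀ _ hv.ne'] at h1
  have h2 : bil S v (v - (2 : ℝ) • v) = bil S v v := by rw [h1]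
  rw [bil_sub_right, bil_smul_right] at h2
  linarith

theorem isReflectionIn_hypReflection :
    IsReflectionIn (hypReflection e hv) (hyperplane S e v) :=
  ⟨hypReflection_ne_one hv, fun _ hx => hypReflection_smul_of_mem hv hx⟩

theorem hdist_hypReflection_of_mem {p : Hyp S e} (hp : p ∈ hyperplane S e v) (x : Hyp S e) :
    hdist p (hypReflection e hv • x) = hdist p x := by
  rw [← hdist_smul (hypReflection e hv) p x, hypReflection_smul_of_mem hv hp]

include hv in
theorem exists_bil_ne_zero {U : Set (Hyp S e)} (hU : IsOpen U) (hne : U.Nonempty) :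
    ∃ x ∈ U, bil S v x.1 ≠ 0 := by
  by_contra! h
  have hall : ∀ y, bil S v y = 0 := by
    intro y
    have hy : y ∈ Submodule.span ℝ (Subtype.val '' U) := by
      rw [span_eq_top_of_isOpen hU hne]; trivial
    induction hy using Submodule.span_induction with
    | mem y hy => obtain ⟨x, hx, rfl⟩ := hy; exact h x hx
    | zero => simp
    | add y z _ _ hy hz => rw [bil_add_right, hy, hz, add_zero]
    | smul r y _ hy => rw [bil_smul_right, hy, mul_zero]
  exact hv.ne' (hall v)

include hv in
theorem exists_pos_of_mem_hyperplane {p : Hyp S e} (hp : p ∈ hyperplane S e v) {r : ℝ}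
    (hr : 0 < r) : ∃ x, hdist p x < r ∧ 0 < bil S v x.1 := by
  obtain ⟨x, hx, hne⟩ := exists_bil_ne_zero hv (isOpen_hball p r) ⟨p, by simpa using hr⟩
  rcases hne.lt_or_gt with h | h
  · refine ⟨hypReflection e hv • x, by rwa [hdist_hypReflection_of_mem hv hp], ?_⟩
    rw [bil_hypReflection_smul]; linarith
  · exact ⟨x, hx, h⟩

end Reflection

theorem smul_hyperplane (g : ↥(PO S e)) (v : Fin (n + 1) → ℝ) :
    g • hyperplane S e v = hyperplane S e (g.1.1.mulVec v) := by
  ext x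
  rw [Set.mem_smul_set_iff_inv_smul_mem]
  change bil S v (g⁻¹ • x).1 = 0 ↔ bil S (g.1.1.mulVec v) x.1 = 0
  rw [← bil_PO g v, ← smul_val, smul_inv_smul]

theorem continuous_bil_val (v : Fin (n + 1) → ℝ) :
    Continuous fun x : Hyp S e => bil S v x.1 :=
  continuous_bil S continuous_const continuous_subtype_val

theorem isClosed_hyperplane (v : Fin (n + 1) → ℝ) : IsClosed (hyperplane S e v) :=
  isClosed_eq (continuous_bil_val v) continuous_const

theorem isPreconnected_hyperplane (v : Fin (n + 1) → ℝ) : IsPreconnected (hyperplane S e v) :=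
  isPreconnected_of_segments fun x hx y hy z s t _ _ h => by
    change bil S v z.1 = 0
    rw [h, bil_add_right, bil_smul_right, bil_smul_right, show bil S v x.1 = 0 from hx,
      show bil S v y.1 = 0 from hy]
    ring

theorem isPreconnected_hball (p : Hyp S e) (r : ℝ) : IsPreconnected {x : Hyp S e | hdist p x < r} :=
  isPreconnected_of_segments fun _ hx _ hy _ _ _ hs ht h => hdist_lt_of_between hs ht h hx hy

theorem isPreconnected_halfBall (p : Hyp S e) (r : ℝ) (v : Fin (n + 1) → ℝ) :
    IsPreconnected {x : Hyp S e | hdist p x < r ∧ 0 < bil S v x.1} := by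
  refine isPreconnected_of_segments fun x hx y hy z s t hs ht h =>
    ⟨hdist_lt_of_between hs ht h hx.1 hy.1, ?_⟩
  have h1 : bil S v z.1 = s * bil S v x.1 + t * bil S v y.1 := by
    rw [h, bil_add_right, bil_smul_right, bil_smul_right]
  have hst : 0 < s ∨ 0 < t := by
    by_contra! h0
    have hs0 : s = 0 := le_antisymm h0.1 hs
    have ht0 : t = 0 := le_antisymm h0.2 ht
    have := hyp_self z
    rw [h, hs0, ht0] at this
    simp at this
  rw [h1]
  rcases hst with h0 | h0
  · exact add_pos_of_pos_of_nonneg (mul_pos h0 hx.2) (mul_nonneg ht hy.2.le)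
  · exact add_pos_of_nonneg_of_pos (mul_nonneg hs hx.2.le) (mul_pos h0 hy.2)

/-- A geodesic segment between the two sides of a hyperplane meets the hyperplane. -/
theorem exists_between_mem_hyperplane {v : Fin (n + 1) → ℝ} {x y : Hyp S e}
    (hx : 0 ≤ bil S v x.1) (hy : bil S v y.1 < 0) :
    ∃ z ∈ hyperplane S e v, ∃ s t : ℝ, 0 ≤ s ∧ 0 ≤ t ∧ z.1 = s • x.1 + t • y.1 := by
  have hxy := one_le_neg_bil x y
  -- These weights make the pairing with `v` vanish. The combination is a negative vector, and
  -- normalising it gives the crossing point.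
  have h1 : bil S ((-bil S v y.1) • x.1 + bil S v x.1 • y.1)
      ((-bil S v y.1) • x.1 + bil S v x.1 • y.1) < 0 := by
    simp only [bil_add_left, bil_add_right, bil_smul_left, bil_smul_right, hyp_self,
      bil_comm y.1 x.1]
    have := mul_nonneg hx (neg_pos.2 hy).le
    nlinarith [pow_pos (neg_pos.2 hy) 2, pow_nonneg hx 2]
  have h2 : bil S x.1 ((-bil S v y.1) • x.1 + bil S v x.1 • y.1) < 0 := by
    simp only [bil_add_right, bil_smul_right, hyp_self]
    nlinarith
  obtain ⟨r, hr, hz⟩ : ∃ r : ℝ, 0 ≤ r ∧ (hypNormalize x _ h1 h2).1 =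
      r • ((-bil S v y.1) • x.1 + bil S v x.1 • y.1) :=
    ⟨_, inv_nonneg.2 (Real.sqrt_nonneg _), rfl⟩
  refine ⟨hypNormalize x _ h1 h2, ?_, r * -bil S v y.1, r * bil S v x.1,
    mul_nonneg hr (neg_pos.2 hy).le, mul_nonneg hr hx, ?_⟩
  · change bil S v (hypNormalize x _ h1 h2).1 = 0
    rw [hz]
    simp only [bil_smul_right, bil_add_right]
    ring
  · rw [hz, smul_add, smul_smul, smul_smul]

/-! ## Locally finite families of disjoint hyperplanes and their chambers -/

/-- A locally finite family of hyperplanes, given by positive normal vectors, two of which are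
equal or disjoint. -/
structure IsArrangement (e : Fin (n + 1) → ℝ) (𝓥 : Set (Fin (n + 1) → ℝ))
    (T : Set (Hyp S e)) : Prop where
  mem_iff : ∀ x, x ∈ T ↔ ∃ v ∈ 𝓥, x ∈ hyperplane S e v
  pos : ∀ v ∈ 𝓥, 0 < bil S v v
  eq_of_mem : ∀ v ∈ 𝓥, ∀ w ∈ 𝓥, ∀ x, x ∈ hyperplane S e v → x ∈ hyperplane S e w →
    hyperplane S e v = hyperplane S e w
  finite : ∀ (x : Hyp S e) (R : ℝ), {v | v ∈ 𝓥 ∧ ∃ y ∈ hyperplane S e v, hdist x y ≤ R}.Finite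

/-- `C` is a connected component of the complement of `T`. -/
def IsChamber (T C : Set (Hyp S e)) : Prop :=
  ∃ x ∈ Tᶜ, C = connectedComponentIn Tᶜ x

theorem IsChamber.subset_compl {T C : Set (Hyp S e)} (hC : IsChamber T C) : C ⊆ Tᶜ := by
  obtain ⟨x, -, rfl⟩ := hC
  exact connectedComponentIn_subset _ _

theorem IsChamber.nonempty {T C : Set (Hyp S e)} (hC : IsChamber T C) : C.Nonempty := by
  obtain ⟨x, hx, rfl⟩ := hC
  exact ⟨x, mem_connectedComponentIn hx⟩

theorem IsChamber.isPreconnected {T C : Set (Hyp S e)} (hC : IsChamber T C) :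
    IsPreconnected C := by
  obtain ⟨x, -, rfl⟩ := hC
  exact isPreconnected_connectedComponentIn

theorem IsChamber.subset_of_inter {T C : Set (Hyp S e)} (hC : IsChamber T C)
    {U : Set (Hyp S e)} (hU : IsPreconnected U) (hUT : U ⊆ Tᶜ) (h : (U ∩ C).Nonempty) :
    U ⊆ C := by
  obtain ⟨x, hx, rfl⟩ := hC
  obtain ⟨y, hyU, hyC⟩ := h
  rw [connectedComponentIn_eq hyC]
  exact hU.subset_connectedComponentIn hyU hUT

theorem IsChamber.eq_of_inter {T C C' : Set (Hyp S e)} (hC : IsChamber T C)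
    (hC' : IsChamber T C') (h : (C ∩ C').Nonempty) : C = C' :=
  (hC'.subset_of_inter hC.isPreconnected hC.subset_compl h).antisymm
    (hC.subset_of_inter hC'.isPreconnected hC'.subset_compl (by rwa [Set.inter_comm]))

theorem IsChamber.smul {T C : Set (Hyp S e)} (hC : IsChamber T C) {g : ↥(PO S e)}
    (hg : g • T = T) : IsChamber T (g • C) := by
  obtain ⟨x, hx, rfl⟩ := hC
  have hg' : g • Tᶜ = Tᶜ := by rw [Set.smul_set_compl, hg]
  refine ⟨g • x, by rw [← hg']; exact Set.smul_mem_smul_set hx, ?_⟩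
  have := (Homeomorph.smul g).image_connectedComponentIn hx
  change g • connectedComponentIn Tᶜ x = connectedComponentIn (g • Tᶜ) (g • x) at this
  rw [this, hg']

/-- The set `C` lies on the positive side of `v`, and near every point of the hyperplane of `v` it
is the open half-space of `v`. -/
structure IsFacet (C : Set (Hyp S e)) (v : Fin (n + 1) → ℝ) : Prop where
  pos : 0 < bil S v v
  side : ∀ x ∈ C, 0 < bil S v x.1
  subset_frontier : hyperplane S e v ⊆ frontier C
  exists_ball : ∀ p ∈ hyperplane S e v, ∃ r > 0, ∀ y, hdist p y < r → 0 < bil S v y.1 → y ∈ C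

theorem IsFacet.nonneg_of_mem_closure {C : Set (Hyp S e)} {v : Fin (n + 1) → ℝ}
    (h : IsFacet C v) {x : Hyp S e} (hx : x ∈ closure C) : 0 ≤ bil S v x.1 :=
  closure_minimal (fun y hy => (h.side y hy).le)
    (isClosed_le continuous_const (continuous_bil_val v)) hx

theorem IsFacet.mem_closure {C : Set (Hyp S e)} {v : Fin (n + 1) → ℝ}
    (h : IsFacet C v) {x : Hyp S e} (hx : x ∈ hyperplane S e v) : x ∈ closure C :=
  frontier_subset_closure (h.subset_frontier hx)

namespace IsArrangement

variable {𝓥 : Set (Fin (n + 1) → ℝ)} {T : Set (Hyp S e)} (hT : IsArrangement e 𝓥 T)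

include hT

/-- By local finiteness a small ball around `p` meets only those hyperplanes of the family that pass
through `p`. -/
theorem exists_ball (p : Hyp S e) :
    ∃ r > 0, ∀ v ∈ 𝓥, ∀ y ∈ hyperplane S e v, hdist p y < r → p ∈ hyperplane S e v := by
  have hfin : {v | (v ∈ 𝓥 ∧ ∃ y ∈ hyperplane S e v, hdist p y ≤ 1) ∧ p ∉ hyperplane S e v}.Finite :=
    (hT.finite p 1).subset fun v hv => hv.1
  have hU : (⋂ v ∈ {v | (v ∈ 𝓥 ∧ ∃ y ∈ hyperplane S e v, hdist p y ≤ 1) ∧ p ∉ hyperplane S e v},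
      (hyperplane S e v)ᶜ) ∈ nhds p :=
    (Filter.biInter_mem hfin).2 fun v hv => (isClosed_hyperplane v).isOpen_compl.mem_nhds hv.2
  obtain ⟨r, hr, h⟩ := exists_hball_subset hU
  refine ⟨min r 1, lt_min hr one_pos, fun v hv y hy hlt => ?_⟩
  by_contra hp
  have := h y (hlt.trans_le (min_le_left _ _))
  simp only [Set.mem_iInter] at this
  exact this v ⟨⟨hv, y, hy, (hlt.trans_le (min_le_right _ _)).le⟩, hp⟩ hy

theorem isClosed : IsClosed T := by
  rw [← isOpen_compl_iff, isOpen_iff_mem_nhds]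
  intro p hp
  obtain ⟨r, hr, h⟩ := hT.exists_ball p
  refine Filter.mem_of_superset (hball_mem_nhds p hr) fun y hy hyT => hp ?_
  obtain ⟨v, hv, hyv⟩ := (hT.mem_iff y).1 hyT
  exact (hT.mem_iff p).2 ⟨v, hv, h v hv y hyv hy⟩

variable {C : Set (Hyp S e)} (hC : IsChamber T C)

include hC

/-- A ball avoiding `T` is connected and meets `C`, hence lies in the component `C`. -/
theorem mem_of_mem_closure {p : Hyp S e} (hp : p ∈ closure C) (hpT : p ∉ T) :
    ∃ r > 0, ∀ y, hdist p y < r → y ∈ C := by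
  obtain ⟨r, hr, h⟩ := exists_hball_subset (hT.isClosed.isOpen_compl.mem_nhds hpT)
  refine ⟨r, hr, hC.subset_of_inter (isPreconnected_hball p r) h ?_⟩
  exact mem_closure_iff.1 hp _ (isOpen_hball p r)
      (show hdist p p < r by simpa using hr)

theorem isOpen_chamber : IsOpen C := by
  rw [isOpen_iff_mem_nhds]
  intro p hp
  obtain ⟨r, hr, h⟩ := hT.mem_of_mem_closure hC (subset_closure hp) (hC.subset_compl hp)
  exact Filter.mem_of_superset (hball_mem_nhds p hr) h

theorem mem_frontier_iff {p : Hyp S e} : p ∈ frontier C ↔ p ∈ closure C ∧ p ∈ T := by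
  rw [(hT.isOpen_chamber hC).frontier_eq]
  refine and_congr_right fun hp => ⟨fun h => ?_, fun h h' => hC.subset_compl h' h⟩
  by_contra hpT
  obtain ⟨r, hr, h'⟩ := hT.mem_of_mem_closure hC hp hpT
  exact h (h' p (by simpa using hr))

theorem side {v : Fin (n + 1) → ℝ} (hv : v ∈ 𝓥) :
    (∀ x ∈ C, 0 < bil S v x.1) ∨ ∀ x ∈ C, 0 < bil S (-v) x.1 := by
  have h0 : ∀ x ∈ C, bil S v x.1 ≠ 0 := fun x hx h =>
    hC.subset_compl hx ((hT.mem_iff x).2 ⟨v, hv, h⟩)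
  have hdisj : Disjoint {x : Hyp S e | 0 < bil S v x.1} {x : Hyp S e | bil S v x.1 < 0} :=
    Set.disjoint_left.2 fun x (hx : 0 < bil S v x.1) (hx' : bil S v x.1 < 0) => lt_asymm hx hx'
  rcases IsPreconnected.subset_or_subset
    (isOpen_lt continuous_const (continuous_bil_val v))
    (isOpen_lt (continuous_bil_val v) continuous_const) hdisj
    (fun x hx => (h0 x hx).lt_or_gt.symm) hC.isPreconnected with h | h
  · exact Or.inl h
  · exact Or.inr fun x hx => by rw [bil_neg_left]; exact neg_pos.2 (h hx)

omit hC in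
theorem hyperplane_neg (v : Fin (n + 1) → ℝ) : hyperplane S e (-v) = hyperplane S e v := by
  ext x
  change bil S (-v) x.1 = 0 ↔ bil S v x.1 = 0
  rw [bil_neg_left, neg_eq_zero]

/-- All hyperplanes of the family through `p` coincide with that of `v`. A small open half-ball
therefore avoids `T`; it is connected and meets `C` because `p` is in the frontier. -/
theorem exists_halfBall {v w : Fin (n + 1) → ℝ} (hv : v ∈ 𝓥) (hw : w = v ∨ w = -v)
    (hside : ∀ x ∈ C, 0 < bil S w x.1) {p : Hyp S e} (hp : p ∈ hyperplane S e v)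
    (hpC : p ∈ frontier C) :
    ∃ r > 0, ∀ y, hdist p y < r → 0 < bil S w y.1 → y ∈ C := by
  obtain ⟨r, hr, h⟩ := hT.exists_ball p
  refine ⟨r, hr, ?_⟩
  have := hC.subset_of_inter (isPreconnected_halfBall p r w) (fun y hy hyT => ?_) ?_
  · exact fun y hy hy' => this ⟨hy, hy'⟩
  · obtain ⟨u, hu, hyu⟩ := (hT.mem_iff y).1 hyT
    rw [hT.eq_of_mem u hu v hv p (h u hu y hyu hy.1) hp] at hyu
    have h0 : bil S v y.1 = 0 := hyu
    have h1 := hy.2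
    rcases hw with rfl | rfl
    · exact h1.ne' h0
    · rw [bil_neg_left, h0, neg_zero] at h1
      exact h1.false
  · obtain ⟨x, hx, hxC⟩ := mem_closure_iff.1 (frontier_subset_closure hpC) _ (isOpen_hball p r)
      (by simpa using hr)
    exact ⟨x, ⟨hx, hside x hxC⟩, hxC⟩

/-- A hyperplane is connected, and its part in the frontier of `C` is closed and, by the half-ball
description, relatively open. -/
theorem hyperplane_subset_frontier {v : Fin (n + 1) → ℝ} (hv : v ∈ 𝓥) {p : Hyp S e}
    (hp : p ∈ hyperplane S e v) (hpC : p ∈ frontier C) : hyperplane S e v ⊆ frontier C := by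
  obtain ⟨w, hw, hside⟩ : ∃ w, (w = v ∨ w = -v) ∧ ∀ x ∈ C, 0 < bil S w x.1 := by
    rcases hT.side hC hv with h | h
    · exact ⟨v, Or.inl rfl, h⟩
    · exact ⟨-v, Or.inr rfl, h⟩
  have hwv : hyperplane S e w = hyperplane S e v := by
    rcases hw with rfl | rfl
    · rfl
    · exact hT.hyperplane_neg v
  have hwpos : 0 < bil S w w := by
    rcases hw with rfl | rfl
    · exact hT.pos _ hv
    · rw [bil_neg_left, bil_neg_right, neg_neg]; exact hT.pos _ hv
  -- `U` is the union of the balls, centred on the hyperplane, whose positive half lies in `C`. It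
  -- is open and cuts out of the hyperplane exactly the frontier points.
  let U : Set (Hyp S e) := {y | ∃ q ∈ hyperplane S e v, ∃ r > 0,
    (∀ y, hdist q y < r → 0 < bil S w y.1 → y ∈ C) ∧ hdist q y < r}
  have hU : IsOpen U := by
    rw [isOpen_iff_mem_nhds]
    rintro y ⟨q, hq, r, hr, h, hy⟩
    exact Filter.mem_of_superset ((isOpen_hball q r).mem_nhds hy) fun z hz => ⟨q, hq, r, hr, h, hz⟩
  have hUf : ∀ y ∈ hyperplane S e v, y ∈ U → y ∈ frontier C := by
    rintro y hyv ⟨q, hq, r, hr, h, hy⟩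
    refine (hT.mem_frontier_iff hC).2 ⟨?_, (hT.mem_iff y).2 ⟨v, hv, hyv⟩⟩
    rw [mem_closure_iff_nhds]
    intro V hV
    obtain ⟨r', hr', hV'⟩ := exists_hball_subset
      (Filter.inter_mem hV ((isOpen_hball q r).mem_nhds hy))
    obtain ⟨x, hx, hxpos⟩ := exists_pos_of_mem_hyperplane hwpos (hwv ▸ hyv) hr'
    exact ⟨x, (hV' x hx).1, h x (hV' x hx).2 hxpos⟩
  have hfU : ∀ y ∈ hyperplane S e v, y ∈ frontier C → y ∈ U := by
    intro y hyv hyf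
    obtain ⟨r, hr, h⟩ := hT.exists_halfBall hC hv hw hside hyv hyf
    exact ⟨y, hyv, r, hr, h, by simpa using hr⟩
  intro y hy
  by_contra hyf
  obtain ⟨z, hz, hzU, hzf⟩ := isPreconnected_hyperplane v U (frontier C)ᶜ hU
    isClosed_frontier.isOpen_compl
    (fun z hz => by
      by_cases h : z ∈ frontier C
      · exact Or.inl (hfU z hz h)
      · exact Or.inr h) ⟨p, hp, hfU p hp hpC⟩ ⟨y, hy, hyf⟩
  exact hzf (hUf z hz hzU)

theorem exists_isFacet {v : Fin (n + 1) → ℝ} (hv : v ∈ 𝓥) {p : Hyp S e}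
    (hp : p ∈ hyperplane S e v) (hpC : p ∈ frontier C) :
    ∃ w, (w = v ∨ w = -v) ∧ hyperplane S e w = hyperplane S e v ∧ IsFacet C w := by
  have hsub := hT.hyperplane_subset_frontier hC hv hp hpC
  rcases hT.side hC hv with h | h
  · exact ⟨v, Or.inl rfl, rfl, hT.pos v hv, h, hsub, fun q hq =>
      hT.exists_halfBall hC hv (Or.inl rfl) h hq (hsub hq)⟩
  · refine ⟨-v, Or.inr rfl, hT.hyperplane_neg v, ?_, h, by rwa [hT.hyperplane_neg], fun q hq => ?_⟩
    · rw [bil_neg_left, bil_neg_right, neg_neg]; exact hT.pos _ hv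
    · rw [hT.hyperplane_neg] at hq
      exact hT.exists_halfBall hC hv (Or.inr rfl) h hq (hsub hq)

end IsArrangement

/-- A chamber is determined by one oriented facet: both chambers contain a small half-ball on the
same side of it. -/
theorem IsFacet.eq_of_isFacet {T C C' : Set (Hyp S e)} (hC : IsChamber T C) (hC' : IsChamber T C')
    {v : Fin (n + 1) → ℝ} (h : IsFacet C v) (h' : IsFacet C' v)
    (hne : (hyperplane S e v).Nonempty) : C = C' := by
  obtain ⟨p, hp⟩ := hne
  obtain ⟨r, hr, hb⟩ := h.exists_ball p hp
  obtain ⟨r', hr', hb'⟩ := h'.exists_ball p hp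
  obtain ⟨x, hx, hpos⟩ := exists_pos_of_mem_hyperplane h.pos hp (lt_min hr hr')
  exact hC.eq_of_inter hC' ⟨x, hb x (hx.trans_le (min_le_left _ _)) hpos,
    hb' x (hx.trans_le (min_le_right _ _)) hpos⟩

/-! ## Chambers of an arrangement invariant under a group -/

theorem smul_frontier (g : ↥(PO S e)) (C : Set (Hyp S e)) : frontier (g • C) = g • frontier C :=
  ((Homeomorph.smul g).image_frontier C).symm

theorem smul_closure' (g : ↥(PO S e)) (C : Set (Hyp S e)) : closure (g • C) = g • closure C :=
  ((Homeomorph.smul g).image_closure C).symm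

theorem arrangement_eq_of_mem (Λ : Subgroup ↥(PO S e)) (H₀ H₁ : Set (Hyp S e)) {g : ↥(PO S e)}
    (hg : g ∈ Λ) : g • arrangement Λ H₀ H₁ = arrangement Λ H₀ H₁ := by
  have key : ∀ k ∈ Λ, k • arrangement Λ H₀ H₁ ⊆ arrangement Λ H₀ H₁ := by
    rintro k hk _ ⟨x, ⟨a, ha, hx⟩, rfl⟩
    refine ⟨k * a, Λ.mul_mem hk ha, ?_⟩
    simp only [mul_smul]
    exact hx.imp Set.smul_mem_smul_set Set.smul_mem_smul_set
  refine (key g hg).antisymm ?_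
  rw [Set.subset_smul_set_iff]
  exact key _ (Λ.inv_mem hg)

/-- The normal vectors of the translates of the hyperplanes orthogonal to `v₀` and `v₁`. -/
def normals (Λ : Subgroup ↥(PO S e)) (v₀ v₁ : Fin (n + 1) → ℝ) : Set (Fin (n + 1) → ℝ) :=
  {w | ∃ g ∈ Λ, w = g.1.1.mulVec v₀ ∨ w = g.1.1.mulVec v₁}

theorem eq_of_embeddedIn {Λ : Subgroup ↥(PO S e)} {H : Set (Hyp S e)} (h : EmbeddedIn Λ H)
    {g k : ↥(PO S e)} (hg : g ∈ Λ) (hk : k ∈ Λ) {x : Hyp S e} (hx : x ∈ g • H) (hx' : x ∈ k • H) :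
    g • H = k • H := by
  rcases h (k⁻¹ * g) (Λ.mul_mem (Λ.inv_mem hk) hg) with h | h
  · rw [mul_smul] at h
    rw [← h, smul_inv_smul, h]
  · exfalso
    rw [Set.mem_smul_set_iff_inv_smul_mem] at hx'
    have h2 : k⁻¹ • x ∈ (k⁻¹ * g) • H := by
      rw [mul_smul]
      exact Set.smul_mem_smul_set hx
    exact Set.disjoint_left.1 h h2 hx'

theorem not_mem_of_disjoint {Λ : Subgroup ↥(PO S e)} {H₀ H₁ : Set (Hyp S e)}
    (h : ∀ g ∈ Λ, Disjoint (g • H₀) H₁)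
    {g k : ↥(PO S e)} (hg : g ∈ Λ) (hk : k ∈ Λ) {x : Hyp S e} (hx : x ∈ g • H₀) : x ∉ k • H₁ := by
  intro hx'
  rw [Set.mem_smul_set_iff_inv_smul_mem] at hx'
  have h2 : k⁻¹ • x ∈ (k⁻¹ * g) • H₀ := by
    rw [mul_smul]
    exact Set.smul_mem_smul_set hx
  exact Set.disjoint_left.1 (h (k⁻¹ * g) (Λ.mul_mem (Λ.inv_mem hk) hg)) h2 hx'

theorem isArrangement_normals {Λ : Subgroup ↥(PO S e)} {v₀ v₁ : Fin (n + 1) → ℝ}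
    (hv₀ : 0 < bil S v₀ v₀) (hv₁ : 0 < bil S v₁ v₁)
    (hemb₀ : EmbeddedIn Λ (hyperplane S e v₀)) (hemb₁ : EmbeddedIn Λ (hyperplane S e v₁))
    (hdisj : ∀ g ∈ Λ, Disjoint (g • hyperplane S e v₀) (hyperplane S e v₁))
    (hfin : ∀ (x : Hyp S e) (R : ℝ),
      {v | v ∈ normals Λ v₀ v₁ ∧ ∃ y ∈ hyperplane S e v, hdist x y ≤ R}.Finite) :
    IsArrangement e (normals Λ v₀ v₁)
      (arrangement Λ (hyperplane S e v₀) (hyperplane S e v₁)) where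
  mem_iff x := by
    simp only [arrangement, normals, Set.mem_ofPred_eq]
    constructor
    · rintro ⟨g, hg, h | h⟩
      · exact ⟨_, ⟨g, hg, Or.inl rfl⟩, by rwa [← smul_hyperplane]⟩
      · exact ⟨_, ⟨g, hg, Or.inr rfl⟩, by rwa [← smul_hyperplane]⟩
    · rintro ⟨_, ⟨g, hg, rfl | rfl⟩, h⟩
      · exact ⟨g, hg, Or.inl (by rwa [smul_hyperplane])⟩
      · exact ⟨g, hg, Or.inr (by rwa [smul_hyperplane])⟩
  pos := by
    rintro _ ⟨g, hg, rfl | rfl⟩ <;> rw [bil_PO] <;> assumption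
  eq_of_mem := by
    rintro _ ⟨g, hg, rfl | rfl⟩ _ ⟨k, hk, rfl | rfl⟩ x hx hx' <;>
      rw [← smul_hyperplane] at hx hx' <;> rw [← smul_hyperplane, ← smul_hyperplane]
    · exact eq_of_embeddedIn hemb₀ hg hk hx hx'
    · exact absurd hx' (not_mem_of_disjoint hdisj hg hk hx)
    · exact absurd hx (not_mem_of_disjoint hdisj hk hg hx')
    · exact eq_of_embeddedIn hemb₁ hg hk hx hx'
  finite := hfin

section Sides

variable {Λ : Subgroup ↥(PO S e)} {𝓥 : Set (Fin (n + 1) → ℝ)} {T C : Set (Hyp S e)}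
  (hT : IsArrangement e 𝓥 T) (hΛ : ∀ g ∈ Λ, g • T = T) (hC : IsChamber T C)

include hT hΛ hC

/-- Pulling `C` back by `g` turns the question of which translates of the hyperplane bound `C` into
the question on which side of the fixed hyperplane a translate of `C` lies. -/
theorem isFacet_or_isFacet_neg {v : Fin (n + 1) → ℝ} (hv : v ∈ 𝓥)
    (hne : (hyperplane S e v).Nonempty) {g : ↥(PO S e)} (hg : g ∈ Λ)
    (hsub : g • hyperplane S e v ⊆ frontier C) :
    IsFacet (g⁻¹ • C) v ∨ IsFacet (g⁻¹ • C) (-v) := by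
  obtain ⟨p, hp⟩ := hne
  have hpf : p ∈ frontier (g⁻¹ • C) := by
    rw [smul_frontier, Set.mem_inv_smul_set_iff]
    exact hsub (Set.smul_mem_smul_set hp)
  obtain ⟨w, rfl | rfl, -, h⟩ :=
    hT.exists_isFacet (hC.smul (hΛ _ (Λ.inv_mem hg))) hv hp hpf
  exacts [Or.inl h, Or.inr h]

-- Two translates of `C` on the same side of one hyperplane coincide, so the quotient of the two
-- group elements stabilises `C`.
omit hT in
theorem mul_inv_mem_pieceGroup {w : Fin (n + 1) → ℝ} (hne : (hyperplane S e w).Nonempty)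
    {g k : ↥(PO S e)} (hg : g ∈ Λ) (hk : k ∈ Λ) (h : IsFacet (g⁻¹ • C) w)
    (h' : IsFacet (k⁻¹ • C) w) : k * g⁻¹ ∈ pieceGroup Λ C := by
  refine ⟨Λ.mul_mem hk (Λ.inv_mem hg), ?_⟩
  have := h.eq_of_isFacet (hC.smul (hΛ _ (Λ.inv_mem hg))) (hC.smul (hΛ _ (Λ.inv_mem hk))) h' hne
  change (k * g⁻¹) • C = C
  rw [mul_smul, this, smul_inv_smul]

/-- The translates of one hyperplane in the boundary of a chamber form at most two classes. -/
theorem exists_orbit_representatives {v : Fin (n + 1) → ℝ} (hv : v ∈ 𝓥)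
    (hne : (hyperplane S e v).Nonempty) (hsub : hyperplane S e v ⊆ frontier C) :
    (∀ g ∈ Λ, g • hyperplane S e v ⊆ frontier C →
      ∃ γ ∈ pieceGroup Λ C, γ • hyperplane S e v = g • hyperplane S e v) ∨
    ∃ k ∈ Λ, k • hyperplane S e v ⊆ frontier C ∧
      (¬ ∃ γ ∈ pieceGroup Λ C, γ • hyperplane S e v = k • hyperplane S e v) ∧
      ∀ g ∈ Λ, g • hyperplane S e v ⊆ frontier C →
        (∃ γ ∈ pieceGroup Λ C, γ • hyperplane S e v = g • hyperplane S e v) ∨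
        ∃ γ ∈ pieceGroup Λ C, γ • k • hyperplane S e v = g • hyperplane S e v := by
  by_cases h : ∀ g ∈ Λ, g • hyperplane S e v ⊆ frontier C →
      ∃ γ ∈ pieceGroup Λ C, γ • hyperplane S e v = g • hyperplane S e v
  · exact Or.inl h
  · right
    push Not at h
    obtain ⟨k, hk, hksub, hkne⟩ := h
    refine ⟨k, hk, hksub, fun ⟨γ, hγ, h⟩ => hkne γ hγ h, fun g hg hgsub => ?_⟩
    have hne' : (hyperplane S e (-v)).Nonempty := by rwa [hT.hyperplane_neg]
    have conv : ∀ a ∈ Λ, ∀ b ∈ Λ, b * a⁻¹ ∈ pieceGroup Λ C →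
        ∃ γ ∈ pieceGroup Λ C, γ • a • hyperplane S e v = b • hyperplane S e v :=
      fun a _ b _ hab => ⟨_, hab, by rw [mul_smul, inv_smul_smul]⟩
    have h1 := isFacet_or_isFacet_neg hT hΛ hC hv hne Λ.one_mem (by rwa [one_smul])
    have h2 := isFacet_or_isFacet_neg hT hΛ hC hv hne hk hksub
    have h3 := isFacet_or_isFacet_neg hT hΛ hC hv hne hg hgsub
    have hmul := fun {a b : ↥(PO S e)} (ha : a ∈ Λ) (hb : b ∈ Λ) =>
      mul_inv_mem_pieceGroup (C := C) hΛ hC hne ha hb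
    have hmul' := fun {a b : ↥(PO S e)} (ha : a ∈ Λ) (hb : b ∈ Λ) =>
      mul_inv_mem_pieceGroup (C := C) hΛ hC hne' ha hb
    have hk1 : ¬ (k * 1⁻¹ ∈ pieceGroup Λ C) := fun hmem => by
      obtain ⟨γ, hγ, h⟩ := conv 1 Λ.one_mem k hk hmem
      rw [one_smul] at h
      exact hkne γ hγ h
    have fin1 : g * 1⁻¹ ∈ pieceGroup Λ C →
        ∃ γ ∈ pieceGroup Λ C, γ • hyperplane S e v = g • hyperplane S e v := fun hmem => by
      obtain ⟨γ, hγ, h⟩ := conv 1 Λ.one_mem g hg hmem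
      rw [one_smul] at h
      exact ⟨γ, hγ, h⟩
    -- There are only two sides. Those belonging to `1` and `k` differ since their hyperplanes are
    -- inequivalent, so the side belonging to `g` agrees with one of them.
    rcases h1 with h1 | h1 <;> rcases h2 with h2 | h2
    · exact absurd (hmul Λ.one_mem hk h1 h2) hk1
    · rcases h3 with h3 | h3
      · exact Or.inl (fin1 (hmul Λ.one_mem hg h1 h3))
      · exact Or.inr (conv k hk g hg (hmul' hk hg h2 h3))
    · rcases h3 with h3 | h3
      · exact Or.inr (conv k hk g hg (hmul hk hg h2 h3))
      · exact Or.inl (fin1 (hmul' Λ.one_mem hg h1 h3))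
    · exact absurd (hmul' Λ.one_mem hk h1 h2) hk1

/-- Near a given point there are only finitely many translates of a chamber. -/
theorem exists_finite_translates (p : Hyp S e) :
    ∃ r > 0, ∃ Φ : Set ↥(PO S e), Φ.Finite ∧ ∀ g ∈ Λ,
      (∃ x ∈ closure C, hdist p (g • x) < r) → ∃ k ∈ Φ, k ∈ Λ ∧ g • C = k • C := by
  classical
  -- Near `p` the complement of `T` is covered by two connected sets: the two half-balls if `p` lies
  -- in `T`, and the ball itself, listed twice, if not.
  obtain ⟨r, hr, U₁, U₂, h1, h2, hc⟩ : ∃ r > 0, ∃ U₁ U₂ : Set (Hyp S e),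
      (IsPreconnected U₁ ∧ U₁ ⊆ Tᶜ) ∧ (IsPreconnected U₂ ∧ U₂ ⊆ Tᶜ) ∧
      ∀ y, hdist p y < r → y ∉ T → y ∈ U₁ ∨ y ∈ U₂ := by
    obtain ⟨r, hr, h⟩ := hT.exists_ball p
    by_cases hp : p ∈ T
    · obtain ⟨v, hv, hpv⟩ := (hT.mem_iff p).1 hp
      have key : ∀ w, (w = v ∨ w = -v) → {x : Hyp S e | hdist p x < r ∧ 0 < bil S w x.1} ⊆ Tᶜ := by
        rintro w hw y ⟨hy, hy'⟩ hyT
        obtain ⟨u, hu, hyu⟩ := (hT.mem_iff y).1 hyT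
        rw [hT.eq_of_mem u hu v hv p (h u hu y hyu hy) hpv] at hyu
        have h0 : bil S v y.1 = 0 := hyu
        rcases hw with rfl | rfl
        · exact hy'.ne' h0
        · rw [bil_neg_left, h0, neg_zero] at hy'
          exact hy'.false
      refine ⟨r, hr, _, _, ⟨isPreconnected_halfBall p r v, key v (Or.inl rfl)⟩,
        ⟨isPreconnected_halfBall p r (-v), key (-v) (Or.inr rfl)⟩, fun y hy hyT => ?_⟩
      have h0 : bil S v y.1 ≠ 0 := fun h0 => hyT ((hT.mem_iff y).2 ⟨v, hv, h0⟩)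
      rcases h0.lt_or_gt with h0 | h0
      · exact Or.inr ⟨hy, by rw [bil_neg_left]; linarith⟩
      · exact Or.inl ⟨hy, h0⟩
    · have hb : {y : Hyp S e | hdist p y < r} ⊆ Tᶜ := fun y hy hyT => hp (by
        obtain ⟨v, hv, hyv⟩ := (hT.mem_iff y).1 hyT
        exact (hT.mem_iff p).2 ⟨v, hv, h v hv y hyv hy⟩)
      exact ⟨r, hr, _, _, ⟨isPreconnected_hball p r, hb⟩, ⟨isPreconnected_hball p r, hb⟩,
        fun y hy _ => Or.inl hy⟩
  -- All translates of `C` that meet one connected set off `T` are equal, so one representative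
  -- suffices; `1` is a dummy value when there is none.
  have pick : ∀ U : Set (Hyp S e), IsPreconnected U ∧ U ⊆ Tᶜ → ∃ k : ↥(PO S e), ∀ g ∈ Λ,
      (U ∩ g • C).Nonempty → k ∈ Λ ∧ g • C = k • C := by
    rintro U ⟨hU, hUT⟩
    by_cases h : ∃ k ∈ Λ, (U ∩ k • C).Nonempty
    · obtain ⟨k, hk, hkU⟩ := h
      refine ⟨k, fun g hg hgU => ⟨hk, ?_⟩⟩
      have hgC := hC.smul (hΛ g hg)
      have hkC := hC.smul (hΛ k hk)
      obtain ⟨y, hyU, hy⟩ := hkU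
      exact hgC.eq_of_inter hkC ⟨y, hgC.subset_of_inter hU hUT hgU hyU, hy⟩
    · exact ⟨1, fun g hg hgU => absurd ⟨g, hg, hgU⟩ h⟩
  obtain ⟨k₁, hk₁⟩ := pick U₁ h1
  obtain ⟨k₂, hk₂⟩ := pick U₂ h2
  refine ⟨r, hr, {k₁, k₂}, Set.toFinite _, ?_⟩
  rintro g hg ⟨x, hx, hlt⟩
  have hx' : g • x ∈ closure (g • C) := by
    rw [smul_closure']; exact Set.smul_mem_smul_set hx
  obtain ⟨y, hy, hyC⟩ := mem_closure_iff.1 hx' _ (isOpen_hball p r) hlt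
  rcases hc y hy ((hC.smul (hΛ g hg)).subset_compl hyC) with h | h
  · exact ⟨k₁, Or.inl rfl, hk₁ g hg ⟨y, h, hyC⟩⟩
  · exact ⟨k₂, Or.inr rfl, hk₂ g hg ⟨y, h, hyC⟩⟩

/-- The stabiliser of a chamber acts cocompactly on its closure. -/
theorem exists_bound_pieceGroup (o : Hyp S e) {R : ℝ}
    (hR : ∀ x : Hyp S e, ∃ g ∈ Λ, hdist o (g • x) ≤ R) :
    ∃ R' : ℝ, ∀ x ∈ closure C, ∃ γ ∈ pieceGroup Λ C, hdist o (γ • x) ≤ R' := by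
  have hK : IsCompact {z : Hyp S e | hdist o z ≤ R} :=
    isCompact_of_bounded (isClosed_hball o R) o R fun _ h => h
  -- Local finiteness of the translates of `C` passes to the compact ball of radius `R` by induction
  -- over compact sets.
  obtain ⟨Φ, hΦ, h⟩ : ∃ Φ : Set ↥(PO S e), Φ.Finite ∧ ∀ g ∈ Λ,
      (∃ x ∈ closure C, g • x ∈ {z : Hyp S e | hdist o z ≤ R}) →
        ∃ k ∈ Φ, k ∈ Λ ∧ g • C = k • C := by
    refine hK.induction_on (p := fun Q => ∃ Φ : Set ↥(PO S e), Φ.Finite ∧ ∀ g ∈ Λ,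
      (∃ x ∈ closure C, g • x ∈ Q) → ∃ k ∈ Φ, k ∈ Λ ∧ g • C = k • C) ?_ ?_ ?_ ?_
    · exact ⟨∅, Set.finite_empty, by rintro g - ⟨x, -, hx⟩; exact hx.elim⟩
    · rintro Q Q' hQ ⟨Φ, hΦ, h⟩
      exact ⟨Φ, hΦ, fun g hg ⟨x, hx, hxQ⟩ => h g hg ⟨x, hx, hQ hxQ⟩⟩
    · rintro Q Q' ⟨Φ, hΦ, h⟩ ⟨Φ', hΦ', h'⟩
      refine ⟨Φ ∪ Φ', hΦ.union hΦ', ?_⟩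
      rintro g hg ⟨x, hx, hxQ | hxQ⟩
      · obtain ⟨k, hk, hk'⟩ := h g hg ⟨x, hx, hxQ⟩
        exact ⟨k, Or.inl hk, hk'⟩
      · obtain ⟨k, hk, hk'⟩ := h' g hg ⟨x, hx, hxQ⟩
        exact ⟨k, Or.inr hk, hk'⟩
    · intro p _
      obtain ⟨r, hr, Φ, hΦ, h⟩ := exists_finite_translates hT hΛ hC p
      exact ⟨_, mem_nhdsWithin_of_mem_nhds (hball_mem_nhds p hr), Φ, hΦ, h⟩
  obtain ⟨B, hB⟩ := (hΦ.image fun k => hdist (k • o) o).bddAbove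
  refine ⟨B + R, fun x hx => ?_⟩
  obtain ⟨g, hg, hgx⟩ := hR x
  obtain ⟨k, hkΦ, hk, hgk⟩ := h g hg ⟨x, hx, hgx⟩
  -- The element `g` moves `x` into the ball but moves `C` to `k • C`; undoing this with one of
  -- finitely many `k` costs a bounded distance.
  refine ⟨k⁻¹ * g, ⟨Λ.mul_mem (Λ.inv_mem hk) hg, ?_⟩, ?_⟩
  · change (k⁻¹ * g) • C = C
    rw [mul_smul, hgk, inv_smul_smul]
  · rw [mul_smul, ← hdist_smul_left]
    have h1 := hB ⟨k, hkΦ, rfl⟩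
    have h2 := hdist_triangle (k • o) o (g • x)
    simp only at h1
    linarith

end Sides

/-! ## The components of the boundary of the piece -/

section BoundarySystem

variable {Λ : Subgroup ↥(PO S e)} {v₀ v₁ : Fin (n + 1) → ℝ} {C : Set (Hyp S e)}
  (hT : IsArrangement e (normals Λ v₀ v₁)
    (arrangement Λ (hyperplane S e v₀) (hyperplane S e v₁)))
  (hC : IsChamber (arrangement Λ (hyperplane S e v₀) (hyperplane S e v₁)) C)

include hT hC

theorem smul_hyperplane_subset_frontier {g : ↥(PO S e)} (hg : g ∈ Λ) {v : Fin (n + 1) → ℝ}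
    (hv : v = v₀ ∨ v = v₁) {x : Hyp S e} (hx : x ∈ g • hyperplane S e v) (hxC : x ∈ frontier C) :
    g • hyperplane S e v ⊆ frontier C := by
  rw [smul_hyperplane] at hx ⊢
  exact hT.hyperplane_subset_frontier hC ⟨g, hg, by rcases hv with rfl | rfl <;> simp⟩ hx hxC

/-- Frontier hyperplanes sharing a point are equal, so `Γ₁`-classes of frontier points correspond to
classes of the hyperplanes containing them. It suffices to choose representatives of the latter. -/
theorem isBoundarySystem_of_representatives
    {m : ℕ} {H : Fin (m + 2) → Set (Hyp S e)}
    (h0 : H 0 = hyperplane S e v₀) (h1 : H 1 = hyperplane S e v₁)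
    (htr : ∀ j, ∃ g ∈ Λ, H j = g • hyperplane S e v₀ ∨ H j = g • hyperplane S e v₁)
    (hsub : ∀ j, H j ⊆ frontier C)
    (hinj : ∀ j k, (∃ γ ∈ pieceGroup Λ C, γ • H j = H k) → j = k)
    (hall₀ : ∀ g ∈ Λ, g • hyperplane S e v₀ ⊆ frontier C →
      ∃ j, ∃ γ ∈ pieceGroup Λ C, γ • H j = g • hyperplane S e v₀)
    (hall₁ : ∀ g ∈ Λ, g • hyperplane S e v₁ ⊆ frontier C →
      ∃ j, ∃ γ ∈ pieceGroup Λ C, γ • H j = g • hyperplane S e v₁) :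
    IsBoundarySystem Λ (hyperplane S e v₀) (hyperplane S e v₁) C H where
  zero := h0
  one := h1
  translate := htr
  subset_frontier := hsub
  existsUnique x hx := by
    have hmem : ∀ γ ∈ Λ, ∀ j, ∃ v ∈ normals Λ v₀ v₁, γ • H j = hyperplane S e v := by
      intro γ hγ j
      obtain ⟨g, hg, h | h⟩ := htr j <;> rw [h, ← mul_smul, smul_hyperplane]
      · exact ⟨_, ⟨γ * g, Λ.mul_mem hγ hg, Or.inl rfl⟩, rfl⟩
      · exact ⟨_, ⟨γ * g, Λ.mul_mem hγ hg, Or.inr rfl⟩, rfl⟩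
    obtain ⟨j, γ, hγ, hj⟩ : ∃ j, ∃ γ ∈ pieceGroup Λ C, γ • x ∈ H j := by
      obtain ⟨g, hg, h | h⟩ := ((hT.mem_frontier_iff hC).1 hx).2
      · obtain ⟨j, γ, hγ, hj⟩ := hall₀ g hg
          (smul_hyperplane_subset_frontier hT hC hg (Or.inl rfl) h hx)
        rw [← hj] at h
        exact ⟨j, γ⁻¹, inv_mem hγ, Set.mem_smul_set_iff_inv_smul_mem.1 h⟩
      · obtain ⟨j, γ, hγ, hj⟩ := hall₁ g hg
          (smul_hyperplane_subset_frontier hT hC hg (Or.inr rfl) h hx)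
        rw [← hj] at h
        exact ⟨j, γ⁻¹, inv_mem hγ, Set.mem_smul_set_iff_inv_smul_mem.1 h⟩
    refine ⟨j, ⟨γ, hγ, hj⟩, ?_⟩
    rintro k ⟨γ', hγ', hk⟩
    refine hinj k j ⟨γ * γ'⁻¹, mul_mem hγ (inv_mem hγ'), ?_⟩
    obtain ⟨v, hv, hv'⟩ := hmem (γ * γ'⁻¹) (mul_mem hγ.1 (inv_mem hγ'.1)) k
    obtain ⟨w, hw, hw'⟩ := hmem 1 Λ.one_mem j
    rw [one_smul] at hw'
    rw [hv', hw']
    refine hT.eq_of_mem v hv w hw (γ • x) ?_ (hw' ▸ hj)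
    rw [← hv', mul_smul, Set.smul_mem_smul_set_iff, Set.mem_inv_smul_set_iff]
    exact hk

/-- Each of the two given hyperplanes yields one or two classes, according to the sides on which `C`
meets its translates. Translates of different ones are never equivalent, being disjoint. The four
combinations give two, three, three or four components. -/
theorem exists_isBoundarySystem
    (hdisj : ∀ g ∈ Λ, Disjoint (g • hyperplane S e v₀) (hyperplane S e v₁))
    (hne₀ : (hyperplane S e v₀).Nonempty) (hne₁ : (hyperplane S e v₁).Nonempty)
    (hsub₀ : hyperplane S e v₀ ⊆ frontier C) (hsub₁ : hyperplane S e v₁ ⊆ frontier C) :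
    ∃ m : ℕ, m ≤ 2 ∧ ∃ H : Fin (m + 2) → Set (Hyp S e),
      IsBoundarySystem Λ (hyperplane S e v₀) (hyperplane S e v₁) C H := by
  have hΛ : ∀ g ∈ Λ, g • arrangement Λ (hyperplane S e v₀) (hyperplane S e v₁) =
      arrangement Λ (hyperplane S e v₀) (hyperplane S e v₁) :=
    fun g hg => arrangement_eq_of_mem Λ _ _ hg
  have hself : ∀ A : Set (Hyp S e), ∃ γ ∈ pieceGroup Λ C, γ • A = A :=
    fun A => ⟨1, one_mem _, one_smul _ _⟩
  have hsymm : ∀ {A B : Set (Hyp S e)}, (∃ γ ∈ pieceGroup Λ C, γ • A = B) →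
      ∃ γ ∈ pieceGroup Λ C, γ • B = A := by
    rintro A B ⟨γ, hγ, rfl⟩
    exact ⟨γ⁻¹, inv_mem hγ, inv_smul_smul _ _⟩
  have hcross : ∀ g ∈ Λ, ∀ k ∈ Λ, ¬ ∃ γ ∈ pieceGroup Λ C,
      γ • g • hyperplane S e v₀ = k • hyperplane S e v₁ := by
    rintro g hg k hk ⟨γ, hγ, h⟩
    obtain ⟨x, hx⟩ := hne₀
    rw [← mul_smul] at h
    refine not_mem_of_disjoint hdisj (mul_mem hγ.1 hg) hk (Set.smul_mem_smul_set hx) ?_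
    rw [← h]
    exact Set.smul_mem_smul_set hx
  have hcross' : ∀ g ∈ Λ, ∀ k ∈ Λ, ¬ ∃ γ ∈ pieceGroup Λ C,
      γ • g • hyperplane S e v₁ = k • hyperplane S e v₀ :=
    fun g hg k hk h => hcross k hk g hg (hsymm h)
  have hv₀ : v₀ ∈ normals Λ v₀ v₁ := ⟨1, Λ.one_mem, by simp⟩
  have hv₁ : v₁ ∈ normals Λ v₀ v₁ := ⟨1, Λ.one_mem, by simp⟩
  have tr₀ : ∃ g ∈ Λ, hyperplane S e v₀ = g • hyperplane S e v₀ ∨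
      hyperplane S e v₀ = g • hyperplane S e v₁ := ⟨1, Λ.one_mem, by simp⟩
  have tr₁ : ∃ g ∈ Λ, hyperplane S e v₁ = g • hyperplane S e v₀ ∨
      hyperplane S e v₁ = g • hyperplane S e v₁ := ⟨1, Λ.one_mem, by simp⟩
  have c01 := hcross 1 Λ.one_mem 1 Λ.one_mem
  have c10 := hcross' 1 Λ.one_mem 1 Λ.one_mem
  simp only [one_smul] at c01 c10
  rcases exists_orbit_representatives hT hΛ hC hv₀ hne₀ hsub₀ with h₀ | ⟨k, hk, hks, hkn, h₀⟩ <;>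
  rcases exists_orbit_representatives hT hΛ hC hv₁ hne₁ hsub₁ with h₁ | ⟨l, hl, hls, hln, h₁⟩
  · refine ⟨0, by norm_num, ![hyperplane S e v₀, hyperplane S e v₁],
      isBoundarySystem_of_representatives hT hC rfl rfl ?_ ?_ ?_
        (fun g hg h => ⟨0, h₀ g hg h⟩) (fun g hg h => ⟨1, h₁ g hg h⟩)⟩
    · intro j
      fin_cases j
      exacts [tr₀, tr₁]
    · intro j
      fin_cases j
      exacts [hsub₀, hsub₁]
    · intro i j h
      fin_cases i <;> fin_cases j <;>
        first | rfl | exact absurd h c01 | exact absurd h c10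
  · have c0B := hcross 1 Λ.one_mem l hl
    have cB0 := hcross' l hl 1 Λ.one_mem
    simp only [one_smul] at c0B cB0
    refine ⟨1, by norm_num, ![hyperplane S e v₀, hyperplane S e v₁, l • hyperplane S e v₁],
      isBoundarySystem_of_representatives hT hC rfl rfl ?_ ?_ ?_
        (fun g hg h => ⟨0, h₀ g hg h⟩) (fun g hg h => (h₁ g hg h).elim (fun h => ⟨1, h⟩) fun h => ⟨2, h⟩)⟩
    · intro j
      fin_cases j
      exacts [tr₀, tr₁, ⟨l, hl, Or.inr rfl⟩]
    · intro j
      fin_cases j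
      exacts [hsub₀, hsub₁, hls]
    · intro i j h
      fin_cases i <;> fin_cases j <;>
        first | rfl | exact absurd h c01 | exact absurd h c10 | exact absurd h hln | exact absurd h (fun h => hln (hsymm h)) | exact absurd h c0B | exact absurd h cB0
  · have cA1 := hcross k hk 1 Λ.one_mem
    have c1A := hcross' 1 Λ.one_mem k hk
    simp only [one_smul] at cA1 c1A
    refine ⟨1, by norm_num, ![hyperplane S e v₀, hyperplane S e v₁, k • hyperplane S e v₀],
      isBoundarySystem_of_representatives hT hC rfl rfl ?_ ?_ ?_
        (fun g hg h => (h₀ g hg h).elim (fun h => ⟨0, h⟩) fun h => ⟨2, h⟩) (fun g hg h => ⟨1, h₁ g hg h⟩)⟩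
    · intro j
      fin_cases j
      exacts [tr₀, tr₁, ⟨k, hk, Or.inl rfl⟩]
    · intro j
      fin_cases j
      exacts [hsub₀, hsub₁, hks]
    · intro i j h
      fin_cases i <;> fin_cases j <;>
        first | rfl | exact absurd h c01 | exact absurd h c10 | exact absurd h hkn | exact absurd h (fun h => hkn (hsymm h)) | exact absurd h cA1 | exact absurd h c1A
  · have cA1 := hcross k hk 1 Λ.one_mem
    have c1A := hcross' 1 Λ.one_mem k hk
    have c0B := hcross 1 Λ.one_mem l hl
    have cB0 := hcross' l hl 1 Λ.one_mem
    simp only [one_smul] at cA1 c1A c0B cB0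
    refine ⟨2, by norm_num, ![hyperplane S e v₀, hyperplane S e v₁, k • hyperplane S e v₀, l • hyperplane S e v₁],
      isBoundarySystem_of_representatives hT hC rfl rfl ?_ ?_ ?_
        (fun g hg h => (h₀ g hg h).elim (fun h => ⟨0, h⟩) fun h => ⟨2, h⟩) (fun g hg h => (h₁ g hg h).elim (fun h => ⟨1, h⟩) fun h => ⟨3, h⟩)⟩
    · intro j
      fin_cases j
      exacts [tr₀, tr₁, ⟨k, hk, Or.inl rfl⟩, ⟨l, hl, Or.inr rfl⟩]
    · intro j
      fin_cases j
      exacts [hsub₀, hsub₁, hks, hls]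
    · intro i j h
      fin_cases i <;> fin_cases j <;>
        first | rfl | exact absurd h c01 | exact absurd h c10 | exact absurd h hkn | exact absurd h (fun h => hkn (hsymm h)) | exact absurd h cA1 | exact absurd h c1A | exact absurd h hln | exact absurd h (fun h => hln (hsymm h)) | exact absurd h c0B | exact absurd h cB0 | exact absurd h (hcross k hk l hl) | exact absurd h (hcross' l hl k hk)

end BoundarySystem

/-! ## Uniformizations of metric quotients -/

/-- `π : ℍⁿ → M` identifies `(M, D)` with `Γ\ℍⁿ`, where `Γ` acts freely and properly
discontinuously. -/
structure IsUniformization {M : Type*} (D : M → M → ℝ) (Γ : Subgroup ↥(PO S e))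
    (π : Hyp S e → M) : Prop where
  pd : ProperlyDiscontinuous Γ
  free : ActsFreely Γ
  surjective : Function.Surjective π
  smul : ∀ g ∈ Γ, ∀ x, π (g • x) = π x
  exists_smul_eq : ∀ x y, π x = π y → ∃ g ∈ Γ, g • x = y
  dist_le : ∀ x y, D (π x) (π y) ≤ hdist x y
  exists_of_dist_lt : ∀ x y c, D (π x) (π y) < c → ∃ g ∈ Γ, hdist x (g • y) < c
  eq_of_dist_eq_zero : ∀ a b, D a b = 0 → a = b
  dist_nonneg : ∀ a b, 0 ≤ D a b
  dist_triangle : ∀ a b c, D a c ≤ D a b + D b c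

/-- A map from `ℍⁿ` to `M` that preserves the distances of the points of `U`. -/
def PreservesDistOn {M : Type*} (D : M → M → ℝ) (f : Hyp S e → M) (U : Set (Hyp S e)) : Prop :=
  ∀ u ∈ U, ∀ v ∈ U, D (f u) (f v) = hdist u v

namespace IsUniformization

variable {M : Type*} {D : M → M → ℝ} {Γ : Subgroup ↥(PO S e)} {π : Hyp S e → M}
  (h : IsUniformization D Γ π)

include h

/-- Changing the covering map by an isometry conjugates the deck group; this is the normalisation
allowed for `Γ`. -/
theorem conj (g : ↥(PO S e)) :
    IsUniformization D (Γ.map (MulAut.conj g⁻¹).toMonoidHom) (fun x => π (g • x)) where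
  pd x R := by
    refine ((h.pd (g • x) R).image (MulAut.conj g⁻¹)).subset ?_
    rintro _ ⟨⟨k, hk, rfl⟩, hkR⟩
    refine ⟨k, ⟨hk, ?_⟩, rfl⟩
    simp only [MulEquiv.coe_toMonoidHom, MulAut.conj_apply, inv_inv, mul_smul] at hkR
    rwa [← hdist_smul g, smul_inv_smul] at hkR
  free := by
    rintro _ ⟨k, hk, rfl⟩ x hx
    simp only [MulEquiv.coe_toMonoidHom, MulAut.conj_apply, inv_inv, mul_smul] at hx ⊢
    rw [inv_smul_eq_iff] at hx
    rw [h.free k hk _ hx]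
    simp
  surjective a := by
    obtain ⟨x, rfl⟩ := h.surjective a
    exact ⟨g⁻¹ • x, by simp⟩
  smul := by
    rintro _ ⟨k, hk, rfl⟩ x
    simp [mul_smul, h.smul k hk]
  exists_smul_eq x y hxy := by
    obtain ⟨k, hk, hk'⟩ := h.exists_smul_eq _ _ hxy
    refine ⟨_, ⟨k, hk, rfl⟩, ?_⟩
    simp [mul_smul, hk']
  dist_le x y := (h.dist_le _ _).trans_eq (hdist_smul g x y)
  exists_of_dist_lt x y c hc := by
    obtain ⟨k, hk, hk'⟩ := h.exists_of_dist_lt _ _ _ hc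
    refine ⟨_, ⟨k, hk, rfl⟩, ?_⟩
    simp only [MulEquiv.coe_toMonoidHom, MulAut.conj_apply, inv_inv, mul_smul]
    rwa [← hdist_smul g, smul_inv_smul]
  eq_of_dist_eq_zero := h.eq_of_dist_eq_zero
  dist_nonneg := h.dist_nonneg
  dist_triangle := h.dist_triangle

theorem dist_eq (x₀ : Hyp S e) {r : ℝ} (hr : ∀ g ∈ Γ, g ≠ 1 → r ≤ hdist x₀ (g • x₀))
    {x y : Hyp S e} (hx : hdist x₀ x < r / 4) (hy : hdist x₀ y < r / 4) :
    D (π x) (π y) = hdist x y := by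
  refine le_antisymm (h.dist_le x y) ?_
  by_contra! hlt
  obtain ⟨g, hg, hlt⟩ := h.exists_of_dist_lt _ _ _ hlt
  rcases eq_or_ne g 1 with rfl | hg1
  · rw [one_smul] at hlt
    exact hlt.false
  · have h1 := hr g hg hg1
    have h2 := hdist_triangle x₀ x (g • x₀)
    have h3 := hdist_triangle x (g • y) (g • x₀)
    have h4 := hdist_triangle x x₀ y
    rw [hdist_smul, hdist_comm y] at h3
    rw [hdist_comm x x₀] at h4
    linarith

/-- A distance preserving germ lifts to an isometry. -/
theorem exists_germ {f : Hyp S e → M} {U : Set (Hyp S e)} {y : Hyp S e} (hU : U ∈ nhds y)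
    (hf : PreservesDistOn D f U) :
    ∃ g : ↥(PO S e), ∃ r > 0, ∀ u, hdist y u < r → π (g • u) = f u := by
  obtain ⟨x, hx⟩ := h.surjective (f y)
  obtain ⟨r, hr, hinj⟩ := exists_injectivity_radius h.pd h.free x
  obtain ⟨r', hr', hU'⟩ := exists_hball_subset hU
  -- The lift `u'` of `f u` is taken in the ball of radius `r/4` about `x`, where `π` preserves
  -- distances; so `u ↦ u'` preserves distances too. Outside the small ball the value is arbitrary.
  have hlift : ∀ u, ∃ u', hdist y u < min (r / 4) r' → hdist x u' < r / 4 ∧ π u' = f u := by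
    intro u
    by_cases hu : hdist y u < min (r / 4) r'
    · obtain ⟨w, hw⟩ := h.surjective (f u)
      have h1 : D (π x) (π w) < r / 4 := by
        rw [hx, hw, hf y (mem_of_mem_nhds hU) u (hU' u (hu.trans_le (min_le_right _ _)))]
        exact hu.trans_le (min_le_left _ _)
      obtain ⟨g, hg, hlt⟩ := h.exists_of_dist_lt _ _ _ h1
      exact ⟨g • w, fun _ => ⟨hlt, by rw [h.smul g hg, hw]⟩⟩
    · exact ⟨u, fun hu' => absurd hu' hu⟩
  choose ψ hψ using hlift
  have hρ : 0 < min (r / 4) r' := lt_min (by linarith) hr'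
  obtain ⟨g, hg⟩ := exists_PO_of_isometry (isOpen_hball y (min (r / 4) r'))
    ⟨y, show hdist y y < _ by simpa using hρ⟩ ψ fun u hu v hv => by
      rw [← h.dist_eq x hinj (hψ u hu).1 (hψ v hv).1, (hψ u hu).2, (hψ v hv).2]
      exact hf u (hU' u (lt_of_lt_of_le hu (min_le_right _ _))) v
        (hU' v (lt_of_lt_of_le hv (min_le_right _ _)))
  exact ⟨g, _, hρ, fun u hu => by rw [hg u hu, (hψ u hu).2]⟩

/-- Two lifts of one germ differ by an element of `Γ`. -/
theorem exists_mul_eq {g g' : ↥(PO S e)} {U : Set (Hyp S e)} (hU : IsOpen U) (hne : U.Nonempty)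
    (hgg : ∀ u ∈ U, π (g • u) = π (g' • u)) : ∃ γ ∈ Γ, g' = γ * g := by
  obtain ⟨u₀, hu₀⟩ := hne
  obtain ⟨γ, hγ, hγu⟩ := h.exists_smul_eq _ _ (hgg u₀ hu₀)
  -- Near `u₀` the points `γ • g • u` and `g' • u` lie in a ball on which `π` is injective and have
  -- the same image.
  obtain ⟨r, hr, hinj⟩ := exists_injectivity_radius h.pd h.free (g' • u₀)
  refine ⟨γ, hγ, eq_of_eqOn_isOpen (hU.inter (isOpen_hball u₀ (r / 4)))
    ⟨u₀, hu₀, show hdist u₀ u₀ < r / 4 by simpa using hr⟩ fun u hu => ?_⟩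
  have hu2 : hdist u₀ u < r / 4 := hu.2
  apply eq_of_hdist_eq_zero
  rw [← h.dist_eq (g' • u₀) hinj (by rwa [hdist_smul])
    (by rwa [← hγu, mul_smul, hdist_smul, hdist_smul]), mul_smul, h.smul γ hγ, ← hgg u hu.1]
  exact le_antisymm ((h.dist_le _ _).trans_eq (hdist_self _)) (h.dist_nonneg _ _)

theorem mem_of_forall_eq {g : ↥(PO S e)} {U : Set (Hyp S e)} (hU : IsOpen U) (hne : U.Nonempty)
    (hg : ∀ u ∈ U, π (g • u) = π u) : g ∈ Γ := by
  obtain ⟨γ, hγ, rfl⟩ := h.exists_mul_eq (g := 1) (g' := g) hU hne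
    fun u hu => by rw [one_smul, hg u hu]
  rwa [mul_one]

/-- A locally distance preserving map on a connected open subset of `ℍⁿ` lifts to an isometry. -/
theorem exists_lift {f : Hyp S e → M} {W : Set (Hyp S e)} (hW : IsPreconnected W)
    (hne : W.Nonempty) (hf : ∀ y ∈ W, ∃ U ∈ nhds y, PreservesDistOn D f U) :
    ∃ g : ↥(PO S e), ∀ y ∈ W, π (g • y) = f y := by
  obtain ⟨y₀, hy₀⟩ := hne
  obtain ⟨U₀, hU₀, hfU₀⟩ := hf y₀ hy₀
  obtain ⟨g, r₀, hr₀, hg⟩ := h.exists_germ hU₀ hfU₀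
  -- `E P` is the open set of points near which some `k` satisfying `P` lifts `f`. Lifts in the
  -- coset `Γ g` and lifts outside it give two open sets covering `W`, and an overlap would put a
  -- lift of the second kind into the coset.
  let E : (↥(PO S e) → Prop) → Set (Hyp S e) := fun P =>
    {y | ∃ k : ↥(PO S e), P k ∧ ∃ r > 0, ∀ u, hdist y u < r → π (k • u) = f u}
  have hE : ∀ P, IsOpen (E P) := by
    intro P
    rw [isOpen_iff_mem_nhds]
    rintro y ⟨k, hk, r, hr, hyr⟩
    refine Filter.mem_of_superset (hball_mem_nhds y (half_pos hr)) fun z hz =>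
      ⟨k, hk, r / 2, half_pos hr, fun u hu => hyr u ?_⟩
    have hz' : hdist y z < r / 2 := hz
    linarith [hdist_triangle y z u]
  have hcov : W ⊆ E (fun k => ∃ γ ∈ Γ, k = γ * g) ∪ E (fun k => ¬ ∃ γ ∈ Γ, k = γ * g) := by
    intro y hy
    obtain ⟨U, hU, hfU⟩ := hf y hy
    obtain ⟨k, r, hr, hk⟩ := h.exists_germ hU hfU
    by_cases hkg : ∃ γ ∈ Γ, k = γ * g
    · exact Or.inl ⟨k, hkg, r, hr, hk⟩
    · exact Or.inr ⟨k, hkg, r, hr, hk⟩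
  refine ⟨g, fun y hy => ?_⟩
  rcases hcov hy with ⟨k, ⟨γ, hγ, rfl⟩, r, hr, hk⟩ | hy'
  · have := hk y (by simpa using hr)
    rwa [mul_smul, h.smul γ hγ] at this
  · exfalso
    obtain ⟨z, -, ⟨k, ⟨γ, hγ, rfl⟩, r, hr, hk⟩, k', hk', r', hr', hkk'⟩ := hW _ _ (hE _) (hE _) hcov
      ⟨y₀, hy₀, g, ⟨1, Γ.one_mem, (one_mul g).symm⟩, r₀, hr₀, hg⟩ ⟨y, hy, hy'⟩
    obtain ⟨γ', hγ', rfl⟩ := h.exists_mul_eq (isOpen_hball z (min r r'))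
      ⟨z, show hdist z z < _ by simpa using ⟨hr, hr'⟩⟩
      (g := γ * g) (g' := k') fun u hu => by
        rw [hk u (lt_of_lt_of_le hu (min_le_left _ _)),
          hkk' u (lt_of_lt_of_le hu (min_le_right _ _))]
    exact hk' ⟨γ' * γ, Γ.mul_mem hγ' hγ, (mul_assoc _ _ _).symm⟩

end IsUniformization

/-! ## Doubles -/

section Double

variable {X : Type*} {B : Set X} {d : X → X → ℝ}

theorem double_mk_eq_iff {a b : X} {i j : Bool} :
    Quotient.mk (doubleSetoid B) (a, i) = Quotient.mk (doubleSetoid B) (b, j) ↔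
      a = b ∧ (i = j ∨ a ∈ B) :=
  Quotient.eq

/-- A boundary point belongs to both copies, so a pair with at least one boundary point may always
be represented within one copy. This removes the choice of representatives. -/
theorem doubleDist_mk (a b : X) (i j : Bool) :
    doubleDist B d (Quotient.mk _ (a, i)) (Quotient.mk _ (b, j)) =
      sInf {r | ((i = j ∨ a ∈ B ∨ b ∈ B) ∧ r = d a b) ∨ ∃ z ∈ B, r = d a z + d z b} := by
  unfold doubleDist
  congr 1
  ext r
  constructor
  · rintro ⟨a', b', i', j', ha, hb, h⟩
    obtain ⟨rfl, hi⟩ := double_mk_eq_iff.1 ha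
    obtain ⟨rfl, hj⟩ := double_mk_eq_iff.1 hb
    refine h.imp (fun h => ⟨?_, h.2⟩) id
    rcases hi with hi | hi
    · rcases hj with hj | hj
      · exact Or.inl (by rw [← hi, ← hj, h.1])
      · exact Or.inr (Or.inr hj)
    · exact Or.inr (Or.inl hi)
  · rintro (⟨h, rfl⟩ | h)
    · rcases h with rfl | h | h
      · exact ⟨a, b, i, i, rfl, rfl, Or.inl ⟨rfl, rfl⟩⟩
      · exact ⟨a, b, j, j, double_mk_eq_iff.2 ⟨rfl, Or.inr h⟩, rfl, Or.inl ⟨rfl, rfl⟩⟩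
      · exact ⟨a, b, i, i, rfl, double_mk_eq_iff.2 ⟨rfl, Or.inr h⟩, Or.inl ⟨rfl, rfl⟩⟩
    · exact ⟨a, b, i, j, rfl, rfl, Or.inr h⟩

theorem doubleDist_comm (hd : ∀ x y, d x y = d y x) (u v : Double B) :
    doubleDist B d u v = doubleDist B d v u := by
  obtain ⟨⟨a, i⟩, rfl⟩ := Quotient.exists_rep u
  obtain ⟨⟨b, j⟩, rfl⟩ := Quotient.exists_rep v
  rw [doubleDist_mk, doubleDist_mk]
  congr 1
  ext r
  refine or_congr (and_congr ?_ (by rw [hd])) ?_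
  · rw [eq_comm, or_comm (a := a ∈ B)]
  · refine exists_congr fun z => and_congr_right fun _ => ?_
    rw [hd a z, hd z b, add_comm]

/-- By the triangle inequality a detour through the boundary does not shorten the distance within
one copy. -/
theorem doubleDist_same (hd : ∀ x y, 0 ≤ d x y) (htri : ∀ x y z, d x z ≤ d x y + d y z)
    (a b : X) (i : Bool) :
    doubleDist B d (Quotient.mk _ (a, i)) (Quotient.mk _ (b, i)) = d a b := by
  rw [doubleDist_mk]
  refine le_antisymm (csInf_le ⟨0, ?_⟩ (Or.inl ⟨Or.inl rfl, rfl⟩))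
    (le_csInf ⟨_, Or.inl ⟨Or.inl rfl, rfl⟩⟩ ?_)
  · rintro _ (⟨-, rfl⟩ | ⟨z, -, rfl⟩)
    · exact hd _ _
    · exact add_nonneg (hd _ _) (hd _ _)
  · rintro _ (⟨-, rfl⟩ | ⟨z, -, rfl⟩)
    · exact le_rfl
    · exact htri _ _ _

/-- Exchange of the two copies. -/
def swapDouble (B : Set X) : Double B → Double B :=
  Quotient.map' (fun a => (a.1, !a.2)) (by
    rintro ⟨a, i⟩ ⟨b, j⟩ ⟨h, h'⟩
    exact ⟨h, h'.imp (fun h => congrArg Bool.not h) id⟩)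

theorem swapDouble_mk (a : X) (i : Bool) :
    swapDouble B (Quotient.mk _ (a, i)) = Quotient.mk _ (a, !i) := rfl

theorem swapDouble_swapDouble (u : Double B) : swapDouble B (swapDouble B u) = u := by
  obtain ⟨⟨a, i⟩, rfl⟩ := Quotient.exists_rep u
  rw [swapDouble_mk, swapDouble_mk, Bool.not_not]

theorem doubleDist_swap (u v : Double B) :
    doubleDist B d (swapDouble B u) (swapDouble B v) = doubleDist B d u v := by
  obtain ⟨⟨a, i⟩, rfl⟩ := Quotient.exists_rep u
  obtain ⟨⟨b, j⟩, rfl⟩ := Quotient.exists_rep v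
  rw [swapDouble_mk, swapDouble_mk, doubleDist_mk, doubleDist_mk, Bool.not_inj_iff]

end Double

theorem Uniformizes.isUniformization {Λ : Subgroup ↥(PO S e)} {C : Set (Hyp S e)}
    {Γ : Subgroup ↥(PO S e)}
    {F : Quotient (MulAction.orbitRel ↥Γ (Hyp S e)) ≃ DoubledManifold Λ C}
    (hF : Uniformizes Λ C Γ F) :
    IsUniformization (doubledManifoldDist Λ C) Γ (fun x => F (Quotient.mk _ x)) := by
  have := hF.discrete
  have hpd := properlyDiscontinuous_of_discrete Γ
  have hs := isGroupSetoid_orbitRel Γ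
  have hd : ∀ a b, doubledManifoldDist Λ C a b =
      IsGroupSetoid.qdist (fun x : Hyp S e => x) (MulAction.orbitRel ↥Γ (Hyp S e))
        (F.symm a) (F.symm b) := fun a b => by
    have := hF.isometric (F.symm a) (F.symm b)
    rwa [F.apply_symm_apply, F.apply_symm_apply] at this
  refine
    { pd := hpd
      free := hF.free
      surjective := F.surjective.comp Quotient.mk_surjective
      smul := fun g hg x => ?_
      exists_smul_eq := fun x y hxy => hs.mk_eq_iff.1 (F.injective hxy)
      dist_le := fun x y => ?_
      exists_of_dist_lt := fun x y c hc => ?_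
      eq_of_dist_eq_zero := fun a b hab => ?_
      dist_nonneg := fun a b => ?_
      dist_triangle := fun a b c => ?_ }
  · exact congrArg F (hs.mk_eq_iff.2 ⟨g⁻¹, Γ.inv_mem hg, inv_smul_smul _ _⟩)
  · rw [hF.isometric]
    exact quotDist_mk_le (fun _ _ => hdist_nonneg _ _) x y
  · rw [hF.isometric] at hc
    exact hs.exists_smul_of_lt hc
  · rw [hd] at hab
    exact F.symm.injective (hs.eq_of_qdist_eq_zero hpd hab)
  · rw [hd]
    exact quotDist_nonneg (fun _ _ => hdist_nonneg _ _) _ _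
  · rw [hd, hd, hd]
    exact hs.qdist_triangle _ _ _

/-! ## The double of the piece -/

/-- `C` is a domain on which the piece group acts freely and properly discontinuously. -/
structure IsPiece (Λ : Subgroup ↥(PO S e)) (C : Set (Hyp S e)) : Prop where
  isOpen : IsOpen C
  nonempty : C.Nonempty
  isPreconnected : IsPreconnected C
  pd : ProperlyDiscontinuous (pieceGroup Λ C)
  free : ActsFreely (pieceGroup Λ C)

variable {Λ : Subgroup ↥(PO S e)} {C : Set (Hyp S e)}

theorem smul_mem_frontier {g : ↥(PO S e)} (hg : g ∈ pieceGroup Λ C) {x : Hyp S e} :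
    g • x ∈ frontier C ↔ x ∈ frontier C := by
  have h : g • C = C := hg.2
  conv_lhs => rw [← h, smul_frontier, Set.smul_mem_smul_set_iff]

theorem mk_mem_pieceBoundary {x : ↥(closure C)} :
    (Quotient.mk _ x : Piece Λ C) ∈ pieceBoundary Λ C ↔ (x : Hyp S e) ∈ frontier C := by
  constructor
  · rintro ⟨y, hy, hyx⟩
    obtain ⟨g, hg, hgx⟩ := (isGroupSetoid_pieceSetoid Λ C).mk_eq_iff.1 hyx
    rw [← hgx]
    exact (smul_mem_frontier hg).2 hy
  · exact fun h => ⟨x, h, rfl⟩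

theorem pieceDist_nonneg (a b : Piece Λ C) : 0 ≤ pieceDist Λ C a b :=
  quotDist_nonneg (fun _ _ => hdist_nonneg _ _) a b

theorem pieceDist_triangle (a b c : Piece Λ C) :
    pieceDist Λ C a c ≤ pieceDist Λ C a b + pieceDist Λ C b c :=
  (isGroupSetoid_pieceSetoid Λ C).qdist_triangle a b c

theorem doubledManifoldDist_comm (a b : DoubledManifold Λ C) :
    doubledManifoldDist Λ C a b = doubledManifoldDist Λ C b a :=
  doubleDist_comm (quotDist_comm fun _ _ => hdist_comm _ _) a b

variable (Λ) in
/-- The projection of the closure of `C` to one of the two copies of the piece. -/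
def toCopy (i : Bool) (x : ↥(closure C)) : DoubledManifold Λ C :=
  Quotient.mk (doubleSetoid (pieceBoundary Λ C))
    (Quotient.mk (pieceSetoid (pieceGroup Λ C) C) x, i)

theorem dist_toCopy_same (i : Bool) (x y : ↥(closure C)) :
    doubledManifoldDist Λ C (toCopy Λ i x) (toCopy Λ i y) =
      pieceDist Λ C (Quotient.mk _ x) (Quotient.mk _ y) :=
  doubleDist_same pieceDist_nonneg pieceDist_triangle _ _ i

theorem swapDouble_toCopy (i : Bool) (x : ↥(closure C)) :
    swapDouble _ (toCopy Λ i x) = toCopy Λ (!i) x := rfl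

variable (Λ C) in
open Classical in
/-- The projection to the first copy, extended arbitrarily outside of the closure of `C`. -/
def firstCopyMap (a : DoubledManifold Λ C) (x : Hyp S e) : DoubledManifold Λ C :=
  if hx : x ∈ closure C then toCopy Λ false ⟨x, hx⟩ else a

theorem toCopy_smul {γ : ↥(PO S e)} (hγ : γ ∈ pieceGroup Λ C) (i : Bool) {x : Hyp S e}
    (hx : x ∈ closure C) :
    toCopy Λ i ⟨γ • x, smul_mem_closure hγ.2 hx⟩ = toCopy Λ i ⟨x, hx⟩ := by
  have : (Quotient.mk _ ⟨γ • x, smul_mem_closure hγ.2 hx⟩ : Piece Λ C) = Quotient.mk _ ⟨x, hx⟩ :=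
    (isGroupSetoid_pieceSetoid Λ C).mk_eq_iff.2 ⟨γ⁻¹, inv_mem hγ, inv_smul_smul γ x⟩
  unfold toCopy
  rw [this]

theorem toCopy_eq_iff {i j : Bool} {x y : ↥(closure C)} :
    toCopy Λ i x = toCopy Λ j y ↔ (∃ γ ∈ pieceGroup Λ C, γ • (x : Hyp S e) = y) ∧
      (i = j ∨ (x : Hyp S e) ∈ frontier C) := by
  unfold toCopy
  rw [double_mk_eq_iff, mk_mem_pieceBoundary, (isGroupSetoid_pieceSetoid Λ C).mk_eq_iff]

/-- The developing map of the double restricts to the projection onto the first copy. -/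
theorem IsUniformization.exists_normalization (hP : IsPiece Λ C) {Γ : Subgroup ↥(PO S e)}
    {π : Hyp S e → DoubledManifold Λ C} (h : IsUniformization (doubledManifoldDist Λ C) Γ π) :
    ∃ g : ↥(PO S e), ∀ x : ↥(closure C), π (g • (x : Hyp S e)) = toCopy Λ false x := by
  obtain ⟨c, hc⟩ := hP.nonempty
  let a : DoubledManifold Λ C := toCopy Λ false ⟨c, subset_closure hc⟩
  have hval : ∀ x : ↥(closure C), firstCopyMap Λ C a x = toCopy Λ false x := fun x => by
    simp only [firstCopyMap, x.2, dif_pos]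
  -- On small balls inside `C` the projection to the piece preserves distances, because the piece
  -- group has a positive injectivity radius.
  obtain ⟨g, hg⟩ := h.exists_lift (f := firstCopyMap Λ C a) hP.isPreconnected hP.nonempty (by
    intro y hy
    obtain ⟨r, hr, hinj⟩ := exists_injectivity_radius hP.pd hP.free y
    refine ⟨C ∩ {z | hdist y z < r / 4}, Filter.inter_mem (hP.isOpen.mem_nhds hy)
      (hball_mem_nhds y (by linarith)), fun u hu v hv => ?_⟩
    rw [hval ⟨u, subset_closure hu.1⟩, hval ⟨v, subset_closure hv.1⟩, dist_toCopy_same]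
    exact (isGroupSetoid_pieceSetoid Λ C).qdist_eq_hdist y hinj
      (x := ⟨u, subset_closure hu.1⟩) (y := ⟨v, subset_closure hv.1⟩) hu.2 hv.2)
  -- The identity passes from `C` to its closure: neither map increases distances.
  refine ⟨g, fun x => h.eq_of_dist_eq_zero _ _ (le_antisymm ?_ (h.dist_nonneg _ _))⟩
  refine le_of_forall_pos_lt_add fun ε hε => ?_
  obtain ⟨y, hy, hyC⟩ := mem_closure_iff_nhds.1 x.2 _ (hball_mem_nhds x.1 (half_pos hε))
  have hy' : hdist x.1 y < ε / 2 := hy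
  have h1 := h.dist_triangle (π (g • (x : Hyp S e))) (π (g • y)) (toCopy Λ false x)
  have h2 := h.dist_le (g • (x : Hyp S e)) (g • y)
  rw [hdist_smul] at h2
  have h3 : doubledManifoldDist Λ C (π (g • y)) (toCopy Λ false x) ≤ hdist y x.1 := by
    rw [hg y hyC, hval ⟨y, subset_closure hyC⟩, dist_toCopy_same]
    exact quotDist_mk_le (d := fun x y : ↥(closure C) => hdist (x : Hyp S e) (y : Hyp S e))
      (fun _ _ => hdist_nonneg _ _) ⟨y, subset_closure hyC⟩ x
  rw [hdist_comm] at h3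
  linarith

/-! ## Reflections and the group of the double -/

section Develop

variable {Λ : Subgroup ↥(PO S e)} {C : Set (Hyp S e)}

/-- Across a facet the double is locally the union of the piece and its mirror image. -/
theorem IsPiece.exists_dist_toCopy (hP : IsPiece Λ C) {v : Fin (n + 1) → ℝ} (hv : IsFacet C v)
    {p : Hyp S e} (hp : p ∈ hyperplane S e v) :
    ∃ r > 0, (∀ y, hdist p y < r → y ∈ closure C ∨ hypReflection e hv.pos • y ∈ closure C) ∧
      (∀ (i : Bool) (x y : ↥(closure C)), hdist p x < r → hdist p y < r →
        doubledManifoldDist Λ C (toCopy Λ i x) (toCopy Λ i y) = hdist (x : Hyp S e) y) ∧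
      ∀ x y : ↥(closure C), hdist p x < r → hdist p y < r →
        doubledManifoldDist Λ C (toCopy Λ false x) (toCopy Λ true y) =
          hdist (x : Hyp S e) (hypReflection e hv.pos • (y : Hyp S e)) := by
  have hs := isGroupSetoid_pieceSetoid Λ C
  set I := hypReflection e hv.pos with hI
  obtain ⟨r₁, hr₁, hinj⟩ := exists_injectivity_radius hP.pd hP.free p
  obtain ⟨r₀, hr₀, hball⟩ := hv.exists_ball p hp
  have hsame : ∀ (i : Bool) (x y : ↥(closure C)), hdist p x < r₁ / 4 → hdist p y < r₁ / 4 →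
        doubledManifoldDist Λ C (toCopy Λ i x) (toCopy Λ i y) = hdist (x : Hyp S e) y := by
    intro i x y hx hy
    rw [dist_toCopy_same]
    exact hs.qdist_eq_hdist p hinj hx hy
  -- Near `p` the frontier consists of the hyperplane alone: points on its positive side lie in the
  -- open set `C`.
  have hfront : ∀ z ∈ frontier C, hdist p z < r₀ → z ∈ hyperplane S e v := by
    intro z hz hlt
    by_contra hne
    have h1 := hv.nonneg_of_mem_closure (frontier_subset_closure hz)
    have h2 := hball z hlt (h1.lt_of_ne (Ne.symm hne))
    rw [hP.isOpen.frontier_eq] at hz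
    exact hz.2 h2
  -- Radius `r₁ / 4` rules out nontrivial elements of the piece group. Radius `r₀ / 3` makes a
  -- detour through a frontier point outside the `r₀`-ball longer than the path through `p`.
  refine ⟨min (r₁ / 4) (r₀ / 3), lt_min (by linarith) (by linarith), fun y hy => ?_,
    fun i x y hx hy => hsame i x y (hx.trans_le (min_le_left _ _)) (hy.trans_le (min_le_left _ _)),
    fun x y hx hy => ?_⟩
  · have hy' : hdist p y < r₀ := by linarith [hy.trans_le (min_le_right _ _)]
    rcases lt_trichotomy (bil S v y.1) 0 with h | h | h
    · right
      refine subset_closure (hball _ (by rwa [hdist_hypReflection_of_mem hv.pos hp]) ?_)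
      rw [bil_hypReflection_smul]; linarith
    · exact Or.inl (hv.mem_closure h)
    · exact Or.inl (subset_closure (hball y hy' h))
  · have hx1 := hx.trans_le (min_le_left _ _)
    have hx0 := hx.trans_le (min_le_right _ _)
    have hy1 := hy.trans_le (min_le_left _ _)
    have hy0 := hy.trans_le (min_le_right _ _)
    have hIy : hdist p (I • (y : Hyp S e)) = hdist p y := hdist_hypReflection_of_mem hv.pos hp _
    have hxIy : hdist (x : Hyp S e) (I • (y : Hyp S e)) ≤ hdist p x + hdist p y := by
      refine (hdist_triangle _ p _).trans_eq ?_
      rw [hdist_comm x.1 p, hIy]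
    have hmirror : ∀ z ∈ hyperplane S e v, hdist z (I • (y : Hyp S e)) = hdist z y := fun z hz =>
      hdist_hypReflection_of_mem hv.pos hz _
    have hpd : pieceDist Λ C (Quotient.mk _ x) (Quotient.mk _ y) = hdist (x : Hyp S e) y :=
      hs.qdist_eq_hdist p hinj hx1 hy1
    unfold doubledManifoldDist toCopy
    rw [doubleDist_mk]
    have hbdd : BddBelow {r | ((false = true ∨ Quotient.mk _ x ∈ pieceBoundary Λ C ∨
        Quotient.mk _ y ∈ pieceBoundary Λ C) ∧
        r = pieceDist Λ C (Quotient.mk _ x) (Quotient.mk _ y)) ∨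
        ∃ z ∈ pieceBoundary Λ C, r = pieceDist Λ C (Quotient.mk _ x) z +
          pieceDist Λ C z (Quotient.mk _ y)} := by
      refine ⟨0, ?_⟩
      rintro _ (⟨-, rfl⟩ | ⟨z, -, rfl⟩)
      · exact pieceDist_nonneg _ _
      · exact add_nonneg (pieceDist_nonneg _ _) (pieceDist_nonneg _ _)
    have hbd : ∀ z (hz : z ∈ hyperplane S e v),
        (Quotient.mk _ ⟨z, hv.mem_closure hz⟩ : Piece Λ C) ∈ pieceBoundary Λ C :=
      fun z hz => ⟨_, hv.subset_frontier hz, rfl⟩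
    refine le_antisymm ?_ (le_csInf ⟨_, Or.inr ⟨_, hbd p hp, rfl⟩⟩ ?_)
    -- The geodesic from `x` to the mirror image of `y` crosses the hyperplane at some `z`;
    -- reflecting its second half gives a path through the boundary of the same length.
    · obtain ⟨z, hz, hzd⟩ : ∃ z ∈ hyperplane S e v,
          hdist x.1 z + hdist z (I • (y : Hyp S e)) = hdist x.1 (I • (y : Hyp S e)) := by
        rcases (hv.nonneg_of_mem_closure y.2).eq_or_lt with h0 | h0
        · refine ⟨y, h0.symm, ?_⟩
          rw [hypReflection_smul_of_mem hv.pos h0.symm, hdist_self, add_zero]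
        · obtain ⟨z, hz, s, t, hs, ht, hzst⟩ := exists_between_mem_hyperplane (v := v) (x := x.1)
            (y := I • (y : Hyp S e)) (hv.nonneg_of_mem_closure x.2)
            (by rw [hI, bil_hypReflection_smul]; linarith)
          exact ⟨z, hz, hdist_add_of_between hs ht hzst⟩
      refine (csInf_le hbdd (Or.inr ⟨_, hbd z hz, rfl⟩)).trans ?_
      rw [← hzd, hmirror z hz]
      have hle := fun a b : ↥(closure C) => quotDist_mk_le (s := pieceSetoid (pieceGroup Λ C) C)
        (d := fun x y : ↥(closure C) => hdist (x : Hyp S e) (y : Hyp S e))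
        (fun _ _ => hdist_nonneg _ _) a b
      exact add_le_add (hle x ⟨z, hv.mem_closure hz⟩) (hle ⟨z, hv.mem_closure hz⟩ y)
    · rintro _ (⟨h0 | h0 | h0, rfl⟩ | ⟨z, hz, rfl⟩)
      · exact absurd h0 (by simp)
      · have hxH := hfront x (mk_mem_pieceBoundary.1 h0) (by linarith)
        rw [hpd, hmirror x hxH]
      · have hyH := hfront y (mk_mem_pieceBoundary.1 h0) (by linarith)
        rw [hpd, hI, hypReflection_smul_of_mem hv.pos hyH]
      · obtain ⟨z, rfl⟩ := Quotient.exists_rep z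
        rw [mk_mem_pieceBoundary] at hz
        refine le_of_forall_pos_lt_add fun ε hε => ?_
        obtain ⟨γ, hγ, h1⟩ := hs.exists_smul_of_lt (x := x) (y := z)
          (lt_add_of_pos_right _ (half_pos hε))
        obtain ⟨γ', hγ', h2⟩ := hs.exists_smul_of_lt (x := z) (y := y)
          (lt_add_of_pos_right _ (half_pos hε))
        change _ < pieceDist Λ C (Quotient.mk _ x) (Quotient.mk _ z) + ε / 2 at h1
        change _ < pieceDist Λ C (Quotient.mk _ z) (Quotient.mk _ y) + ε / 2 at h2
        rw [← hdist_smul γ] at h2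
        set w := γ • (z : Hyp S e) with hw
        have hwf : w ∈ frontier C := (smul_mem_frontier hγ).2 hz
        -- A competing path passes through `w` and ends at a translate of `y`. If the translate is
        -- trivial and `w` is near `p`, then `w` lies on the mirror and the second half can be
        -- reflected; in the other cases the path is too long by the choice of the radius.
        have key : hdist x.1 (I • (y : Hyp S e)) ≤
            hdist x.1 w + hdist w (γ • γ' • (y : Hyp S e)) := by
          rw [← mul_smul]
          rcases eq_or_ne (γ * γ') 1 with h1 | h1
          · rw [h1, one_smul]
            by_cases hwr : hdist p w < r₀
            · rw [← hmirror w (hfront w hwf hwr)]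
              exact hdist_triangle _ _ _
            · have h3 := hdist_triangle p x w
              have h4 := hdist_nonneg w y
              linarith
          · have h3 := hinj _ (mul_mem hγ hγ') h1
            have h4 := hdist_triangle p x ((γ * γ') • p)
            have h5 := hdist_triangle x.1 ((γ * γ') • y.1) ((γ * γ') • p)
            have h6 := hdist_triangle x.1 w ((γ * γ') • y.1)
            rw [hdist_smul, hdist_comm y.1 p] at h5
            linarith
        linarith

variable {Γ : Subgroup ↥(PO S e)} {π : Hyp S e → DoubledManifold Λ C}
  (h : IsUniformization (doubledManifoldDist Λ C) Γ π) (hP : IsPiece Λ C)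
  (hπ : ∀ x : ↥(closure C), π x = toCopy Λ false x)

include h hP hπ

/-- The reflection in a facet induces the exchange of the two copies of the piece. -/
theorem IsUniformization.hypReflection_smul {v : Fin (n + 1) → ℝ} (hv : IsFacet C v)
    (hne : (hyperplane S e v).Nonempty) (x : Hyp S e) :
    π (hypReflection e hv.pos • x) = swapDouble _ (π x) := by
  classical
  -- The exchange of the copies preserves the distance of the double, so its composite with `π`
  -- lifts to an isometry `s` of the whole space.
  obtain ⟨s, hs⟩ : ∃ s : ↥(PO S e), ∀ y ∈ (Set.univ : Set (Hyp S e)),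
      π (s • y) = swapDouble _ (π y) := by
    refine h.exists_lift isPreconnected_univ Set.univ_nonempty fun y _ => ?_
    obtain ⟨r, hr, hinj⟩ := exists_injectivity_radius h.pd h.free y
    refine ⟨_, hball_mem_nhds y (show 0 < r / 4 by linarith), fun u hu v hv => ?_⟩
    exact (doubleDist_swap _ _).trans (h.dist_eq y hinj hu hv)
  obtain ⟨p, hp⟩ := hne
  obtain ⟨r, hr, hcov, hsame, hopp⟩ := hP.exists_dist_toCopy hv hp
  set I := hypReflection e hv.pos with hI
  have hII : ∀ y : Hyp S e, I • I • y = y := hypReflection_smul_smul hv.pos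
  have hIp : ∀ y : Hyp S e, hdist p (I • y) = hdist p y := hdist_hypReflection_of_mem hv.pos hp
  -- The local model of the covering at `p`: the first copy on the side of `C` and the mirror image
  -- of the second copy on the other side. The value `π p` is never used near `p`.
  let f : Hyp S e → DoubledManifold Λ C := fun y =>
    if hy : y ∈ closure C then toCopy Λ false ⟨y, hy⟩ else
      if hy : I • y ∈ closure C then toCopy Λ true ⟨I • y, hy⟩ else π p
  have hf1 : ∀ y (hy : y ∈ closure C), f y = toCopy Λ false ⟨y, hy⟩ := fun y hy => by
    simp only [f, hy, dif_pos]
  have hf2 : ∀ y, hdist p y < r → y ∉ closure C →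
      ∃ hy : I • y ∈ closure C, f y = toCopy Λ true ⟨I • y, hy⟩ := fun y hyr hy => by
    have hy' := (hcov y hyr).resolve_left hy
    exact ⟨hy', by simp only [f, hy, hy', dif_pos, dif_neg, not_false_eq_true]⟩
  obtain ⟨g, r', hr', hg⟩ := h.exists_germ (f := f) (hball_mem_nhds p hr) (by
    intro u (hu : hdist p u < r) w (hw : hdist p w < r)
    by_cases huC : u ∈ closure C <;> by_cases hwC : w ∈ closure C
    · rw [hf1 u huC, hf1 w hwC]
      exact hsame false ⟨u, huC⟩ ⟨w, hwC⟩ hu hw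
    · obtain ⟨hw', hfw⟩ := hf2 w hw hwC
      rw [hf1 u huC, hfw, hopp ⟨u, huC⟩ ⟨_, hw'⟩ hu (by rwa [hIp])]
      simp only [hII]
    · obtain ⟨hu', hfu⟩ := hf2 u hu huC
      rw [hf1 w hwC, hfu, doubledManifoldDist_comm, hopp ⟨w, hwC⟩ ⟨_, hu'⟩ hw (by rwa [hIp]),
        hdist_comm]
      simp only [hII]
    · obtain ⟨hu', hfu⟩ := hf2 u hu huC
      obtain ⟨hw', hfw⟩ := hf2 w hw hwC
      rw [hfu, hfw, hsame true ⟨_, hu'⟩ ⟨_, hw'⟩ (by rwa [hIp]) (by rwa [hIp])]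
      simp only [hdist_smul])
  have hρ : 0 < min r r' := lt_min hr hr'
  have hρ1 : min r r' ≤ r := min_le_left _ _
  have hρ2 : min r r' ≤ r' := min_le_right _ _
  obtain ⟨q, hq, hqpos⟩ := exists_pos_of_mem_hyperplane hv.pos hp hρ
  obtain ⟨r₀, hr₀, hball⟩ := hv.exists_ball p hp
  have hopen : IsOpen {y : Hyp S e | hdist p y < min r r' ∧ 0 < bil S v y.1} :=
    (isOpen_hball p _).inter (isOpen_lt continuous_const (continuous_bil_val v))
  have hmemC : ∀ y, hdist p y < r → 0 < bil S v y.1 → y ∈ closure C := by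
    intro y hy hpos
    rcases hcov y hy with h1 | h1
    · exact h1
    · have := hv.nonneg_of_mem_closure h1
      rw [hI, bil_hypReflection_smul] at this
      linarith
  -- on the side of `C` the germ `g` is a lift of `π`
  obtain ⟨γ, hγ, rfl⟩ := h.exists_mul_eq (g := 1) (g' := g) hopen ⟨q, hq, hqpos⟩ (by
    rintro u ⟨hu, hupos⟩
    have huC := hmemC u (hu.trans_le hρ1) hupos
    rw [one_smul, hg u (hu.trans_le hρ2), hf1 u huC, hπ ⟨u, huC⟩])
  -- On the far side of the facet `π u` is the class of `I • u` in the second copy, which is the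
  -- exchange of `π (I • u)`. So `s * I` preserves `π` on an open set and is a deck transformation.
  have hsI : s * I ∈ Γ := by
    refine h.mem_of_forall_eq (U := {y : Hyp S e | hdist p y < min r r' ∧ bil S v y.1 < 0})
      ((isOpen_hball p _).inter (isOpen_lt (continuous_bil_val v) continuous_const))
      ⟨I • q, by rwa [hIp], by rw [hI, bil_hypReflection_smul]; linarith⟩ ?_
    rintro u ⟨hu, huneg⟩
    have huC : u ∉ closure C := fun h1 => by
      have := hv.nonneg_of_mem_closure h1
      linarith
    obtain ⟨hu', hfu⟩ := hf2 u (hu.trans_le hρ1) huC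
    have h1 := hg u (hu.trans_le hρ2)
    rw [mul_smul, h.smul γ hγ, one_smul, hfu] at h1
    rw [mul_smul, hs _ trivial, hπ ⟨_, hu'⟩, h1, swapDouble_toCopy, Bool.not_false]
  have h2 := h.smul _ hsI x
  rw [mul_smul, hs _ trivial] at h2
  rw [← h2, swapDouble_swapDouble]

end Develop

/-! ## Generators of the group of the double -/

section Generators

variable {Λ : Subgroup ↥(PO S e)} {C : Set (Hyp S e)}

/-- The group generated by the piece group, its conjugate by the reflection in the first of the
given facets, and the products of two of the reflections. -/
def doubleGroup (Λ : Subgroup ↥(PO S e)) (C : Set (Hyp S e)) {m : ℕ}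
    (I : Fin (m + 2) → ↥(PO S e)) : Subgroup ↥(PO S e) :=
  Subgroup.closure ((pieceGroup Λ C : Set ↥(PO S e)) ∪
    {x | ∃ γ ∈ pieceGroup Λ C, x = (I 0)⁻¹ * γ * I 0} ∪ {x | ∃ j, j ≠ 0 ∧ x = (I j)⁻¹ * I 0})

theorem pieceGroup_le_doubleGroup {m : ℕ} (I : Fin (m + 2) → ↥(PO S e)) :
    pieceGroup Λ C ≤ doubleGroup Λ C I := fun _ hγ =>
  Subgroup.subset_closure (Or.inl (Or.inl hγ))

theorem conj_mem_doubleGroup {m : ℕ} {I : Fin (m + 2) → ↥(PO S e)} (h0 : (I 0)⁻¹ = I 0)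
    {γ : ↥(PO S e)} (hγ : γ ∈ pieceGroup Λ C) : I 0 * γ * I 0 ∈ doubleGroup Λ C I :=
  Subgroup.subset_closure (Or.inl (Or.inr ⟨γ, hγ, by rw [h0]⟩))

theorem mul_mem_doubleGroup {m : ℕ} {I : Fin (m + 2) → ↥(PO S e)} (hI : ∀ j, (I j)⁻¹ = I j)
    (j : Fin (m + 2)) : I j * I 0 ∈ doubleGroup Λ C I := by
  rcases eq_or_ne j 0 with rfl | hj
  · have h1 := inv_mul_cancel (I 0)
    rw [hI] at h1
    rw [h1]
    exact one_mem _
  · exact Subgroup.subset_closure (Or.inr ⟨j, hj, by rw [hI]⟩)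

theorem mul_mem_doubleGroup' {m : ℕ} {I : Fin (m + 2) → ↥(PO S e)} (hI : ∀ j, (I j)⁻¹ = I j)
    (j : Fin (m + 2)) : I 0 * I j ∈ doubleGroup Λ C I := by
  have := inv_mem (mul_mem_doubleGroup (Λ := Λ) (C := C) hI j)
  rwa [mul_inv_rev, hI, hI] at this

variable {Γ : Subgroup ↥(PO S e)} {π : Hyp S e → DoubledManifold Λ C}
  (h : IsUniformization (doubledManifoldDist Λ C) Γ π) (hP : IsPiece Λ C)
  (hπ : ∀ x : ↥(closure C), π x = toCopy Λ false x)
  {m : ℕ} {v : Fin (m + 2) → Fin (n + 1) → ℝ} (hv : ∀ j, IsFacet C (v j))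
  (hne : ∀ j, (hyperplane S e (v j)).Nonempty)

include h hP hπ

/-- On `C` the covering is the projection to the piece, which `Γ₁` preserves; agreement on an open
set suffices for a deck transformation. -/
theorem IsUniformization.pieceGroup_le : pieceGroup Λ C ≤ Γ := by
  intro γ hγ
  refine h.mem_of_forall_eq hP.isOpen hP.nonempty fun u hu => ?_
  have hu' := subset_closure hu
  rw [hπ ⟨u, hu'⟩, ← toCopy_smul hγ false hu', ← hπ]

theorem IsUniformization.conj_mem {v : Fin (n + 1) → ℝ} (hv : IsFacet C v)
    (hne : (hyperplane S e v).Nonempty) {γ : ↥(PO S e)} (hγ : γ ∈ pieceGroup Λ C) :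
    hypReflection e hv.pos * γ * hypReflection e hv.pos ∈ Γ := by
  refine h.mem_of_forall_eq isOpen_univ Set.univ_nonempty fun u _ => ?_
  rw [mul_smul, mul_smul, h.hypReflection_smul hP hπ hv hne,
    h.smul _ (h.pieceGroup_le hP hπ hγ), h.hypReflection_smul hP hπ hv hne, swapDouble_swapDouble]

include hne in
theorem IsUniformization.doubleGroup_le :
    doubleGroup Λ C (fun j => hypReflection e (hv j).pos) ≤ Γ := by
  refine (Subgroup.closure_le _).2 ?_
  rintro _ ((hγ | ⟨γ, hγ, rfl⟩) | ⟨j, -, rfl⟩)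
  · exact h.pieceGroup_le hP hπ hγ
  · rw [hypReflection_inv]
    exact h.conj_mem hP hπ (hv 0) (hne 0) hγ
  · rw [hypReflection_inv]
    refine h.mem_of_forall_eq isOpen_univ Set.univ_nonempty fun u _ => ?_
    rw [mul_smul, h.hypReflection_smul hP hπ (hv j) (hne j),
      h.hypReflection_smul hP hπ (hv 0) (hne 0), swapDouble_swapDouble]

/-- The closure of `C` maps onto the first copy and, by the exchange property, its mirror image maps
onto the second. -/
theorem IsUniformization.exists_smul_mem {v : Fin (n + 1) → ℝ} (hv : IsFacet C v)
    (hne : (hyperplane S e v).Nonempty) (x : Hyp S e) :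
    ∃ k ∈ Γ, k • x ∈ closure C ∨ hypReflection e hv.pos • k • x ∈ closure C := by
  obtain ⟨⟨a, i⟩, ha⟩ := Quotient.exists_rep (π x)
  obtain ⟨c, rfl⟩ := Quotient.exists_rep a
  cases i
  · obtain ⟨k, hk, hkx⟩ := h.exists_smul_eq x c (by rw [hπ]; exact ha.symm)
    exact ⟨k, hk, Or.inl (hkx ▸ c.2)⟩
  · obtain ⟨k, hk, hkx⟩ := h.exists_smul_eq x (hypReflection e hv.pos • (c : Hyp S e)) (by
      rw [h.hypReflection_smul hP hπ hv hne, hπ]; exact ha.symm)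
    refine ⟨k, hk, Or.inr ?_⟩
    rw [hkx, hypReflection_smul_smul]
    exact c.2

include hne in
/-- Points of the two first copies with the same image are equivalent under the group generated by
the given elements. -/
theorem IsUniformization.exists_mem_doubleGroup
    (hcov : ∀ x ∈ frontier C, ∃ j, ∃ γ ∈ pieceGroup Λ C, γ • x ∈ hyperplane S e (v j))
    {x y : Hyp S e} (hxy : π x = π y)
    (hx : x ∈ closure C ∨ hypReflection e (hv 0).pos • x ∈ closure C)
    (hy : y ∈ closure C ∨ hypReflection e (hv 0).pos • y ∈ closure C) :
    ∃ w ∈ doubleGroup Λ C (fun j => hypReflection e (hv j).pos), w • x = y := by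
  set I : Fin (m + 2) → ↥(PO S e) := fun j => hypReflection e (hv j).pos with hI
  have hinv : ∀ j, (I j)⁻¹ = I j := fun j => hypReflection_inv (hv j).pos
  have hII : ∀ x : Hyp S e, I 0 • I 0 • x = x := hypReflection_smul_smul (hv 0).pos
  have hrefl : ∀ z : Hyp S e, ∀ hz : I 0 • z ∈ closure C, π z = toCopy Λ true ⟨I 0 • z, hz⟩ := by
    intro z hz
    have h1 := h.hypReflection_smul hP hπ (hv 0) (hne 0) (I 0 • z)
    change π (I 0 • I 0 • z) = _ at h1
    rw [hII, hπ ⟨I 0 • z, hz⟩] at h1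
    exact h1
  -- points of different copies with the same image lie in the boundary
  have mixed : ∀ x y : Hyp S e, π x = π y → x ∈ closure C → I 0 • y ∈ closure C →
      ∃ w ∈ doubleGroup Λ C I, w • x = y := by
    intro x y hxy hx hy
    rw [hπ ⟨x, hx⟩, hrefl y hy, toCopy_eq_iff] at hxy
    obtain ⟨⟨γ, hγ, hγx⟩, hf⟩ := hxy
    have hxf : x ∈ frontier C := hf.resolve_left (by simp)
    obtain ⟨j, γ₁, hγ₁, hj⟩ := hcov x hxf
    have hfix : I j • γ₁ • x = γ₁ • x := hypReflection_smul_of_mem (hv j).pos hj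
    -- First `γ₁` moves `x` into the `j`-th mirror, where `I j` acts trivially; then `I 0` crosses
    -- to the other copy, and the conjugated factor turns `I 0 • γ₁ • x` into `I 0 • γ • x = y`.
    refine ⟨(I 0 * (γ * γ₁⁻¹) * I 0) * (I 0 * I j) * γ₁,
      mul_mem (mul_mem (conj_mem_doubleGroup (hinv 0) (mul_mem hγ (inv_mem hγ₁)))
        (mul_mem_doubleGroup' hinv j)) (pieceGroup_le_doubleGroup I hγ₁), ?_⟩
    simp only [mul_smul, hII, hfix, inv_smul_smul]
    change I 0 • γ • x = y
    rw [show γ • x = I 0 • y from hγx, hII]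
  rcases hx with hx | hx <;> rcases hy with hy | hy
  · rw [hπ ⟨x, hx⟩, hπ ⟨y, hy⟩, toCopy_eq_iff] at hxy
    obtain ⟨⟨γ, hγ, hγx⟩, -⟩ := hxy
    exact ⟨γ, pieceGroup_le_doubleGroup I hγ, hγx⟩
  · exact mixed x y hxy hx hy
  · obtain ⟨w, hw, rfl⟩ := mixed y x hxy.symm hy hx
    exact ⟨w⁻¹, inv_mem hw, inv_smul_smul _ _⟩
  · rw [hrefl x hx, hrefl y hy, toCopy_eq_iff] at hxy
    obtain ⟨⟨γ, hγ, hγx⟩, -⟩ := hxy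
    refine ⟨_, conj_mem_doubleGroup (hinv 0) hγ, ?_⟩
    simp only [mul_smul]
    rw [show γ • I 0 • x = I 0 • y from hγx, hII]

omit h hπ in
/-- The translates of the two first copies cover a neighbourhood of them. -/
theorem IsPiece.exists_ball_doubleGroup
    (hcov : ∀ x ∈ frontier C, ∃ j, ∃ γ ∈ pieceGroup Λ C, γ • x ∈ hyperplane S e (v j))
    {x : Hyp S e} (hx : x ∈ closure C ∨ hypReflection e (hv 0).pos • x ∈ closure C) :
    ∃ r > 0, ∀ y, hdist x y < r →
      ∃ w ∈ doubleGroup Λ C (fun j => hypReflection e (hv j).pos),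
        w • y ∈ closure C ∨ hypReflection e (hv 0).pos • w • y ∈ closure C := by
  set I : Fin (m + 2) → ↥(PO S e) := fun j => hypReflection e (hv j).pos with hI
  have hinv : ∀ j, (I j)⁻¹ = I j := fun j => hypReflection_inv (hv j).pos
  have hII : ∀ x : Hyp S e, I 0 • I 0 • x = x := hypReflection_smul_smul (hv 0).pos
  -- Around an interior point there is a ball in `C`. A frontier point is moved by `γ` into one of
  -- the chosen facets, near which space is the union of the chamber and its mirror image.
  have main : ∀ x ∈ closure C, ∃ r > 0, ∃ γ ∈ pieceGroup Λ C, ∃ j, ∀ y, hdist x y < r →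
      γ • y ∈ closure C ∨ I j • γ • y ∈ closure C := by
    intro x hx
    by_cases hxC : x ∈ C
    · obtain ⟨r, hr, hb⟩ := exists_hball_subset (hP.isOpen.mem_nhds hxC)
      exact ⟨r, hr, 1, one_mem _, 0, fun y hy => Or.inl (by
        rw [one_smul]; exact subset_closure (hb y hy))⟩
    · have hxf : x ∈ frontier C := by rw [hP.isOpen.frontier_eq]; exact ⟨hx, hxC⟩
      obtain ⟨j, γ, hγ, hj⟩ := hcov x hxf
      obtain ⟨r, hr, hb, -⟩ := hP.exists_dist_toCopy (hv j) hj
      exact ⟨r, hr, γ, hγ, j, fun y hy => hb _ (by rwa [hdist_smul])⟩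
  rcases hx with hx | hx
  · obtain ⟨r, hr, γ, hγ, j, hb⟩ := main x hx
    refine ⟨r, hr, fun y hy => ?_⟩
    rcases hb y hy with hy | hy
    · exact ⟨γ, pieceGroup_le_doubleGroup I hγ, Or.inl hy⟩
    -- Beyond the `j`-th facet lies `I j • closure C`; the even word `I 0 * I j` carries it to `I 0
    -- • closure C`.
    · refine ⟨I 0 * I j * γ, mul_mem (mul_mem_doubleGroup' hinv j)
        (pieceGroup_le_doubleGroup I hγ), Or.inr ?_⟩
      change I 0 • (I 0 * I j * γ) • y ∈ closure C
      rwa [mul_smul, mul_smul, hII]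
  · obtain ⟨r, hr, γ, hγ, j, hb⟩ := main _ hx
    refine ⟨r, hr, fun y hy => ?_⟩
    rcases hb (I 0 • y) (by rwa [hdist_smul]) with hy | hy
    · refine ⟨_, conj_mem_doubleGroup (hinv 0) hγ, Or.inr ?_⟩
      change I 0 • (I 0 * γ * I 0) • y ∈ closure C
      rwa [mul_smul, mul_smul, hII]
    -- As an isometry this is `I j * γ * I 0`, written as a product of elements of the group.
    · refine ⟨(I j * I 0) * (I 0 * γ * I 0), mul_mem (mul_mem_doubleGroup hinv j)
        (conj_mem_doubleGroup (hinv 0) hγ), Or.inl ?_⟩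
      simp only [mul_smul, hII]
      exact hy

include hne in
/-- The group of the double is generated by the piece group, its mirror image, and the products of
two reflections. -/
theorem IsUniformization.eq_doubleGroup
    (hcov : ∀ x ∈ frontier C, ∃ j, ∃ γ ∈ pieceGroup Λ C, γ • x ∈ hyperplane S e (v j)) :
    Γ = doubleGroup Λ C (fun j => hypReflection e (hv j).pos) := by
  set Δ := doubleGroup Λ C (fun j => hypReflection e (hv j).pos) with hΔ
  have hle : Δ ≤ Γ := h.doubleGroup_le hP hπ hv hne
  refine le_antisymm (fun k hk => ?_) hle
  let P : Hyp S e → Prop := fun x => x ∈ closure C ∨ hypReflection e (hv 0).pos • x ∈ closure C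
  -- Points carried into the two basic copies by an element of `Γ` with property `A`. Membership in
  -- `Δ` and its negation are both stable under left multiplication by `Δ`, so both sets are open.
  let U : (↥(PO S e) → Prop) → Set (Hyp S e) := fun A => {x | ∃ k ∈ Γ, A k ∧ P (k • x)}
  have hU : ∀ A : ↥(PO S e) → Prop, (∀ w ∈ Δ, ∀ k, A k → A (w * k)) → IsOpen (U A) := by
    intro A hA
    rw [isOpen_iff_mem_nhds]
    rintro x ⟨k, hk, hkA, hkx⟩
    obtain ⟨r, hr, hb⟩ := hP.exists_ball_doubleGroup hv hcov hkx
    refine Filter.mem_of_superset (hball_mem_nhds x hr) fun y (hy : hdist x y < r) => ?_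
    obtain ⟨w, hw, hwy⟩ := hb (k • y) (by rwa [hdist_smul])
    exact ⟨w * k, mul_mem (hle hw) hk, hA w hw k hkA, by simp only [P, mul_smul]; exact hwy⟩
  by_contra hkΔ
  obtain ⟨c, hc⟩ := hP.nonempty
  obtain ⟨x, -, ⟨a, ha, haΔ, hax⟩, b, hb, hbΔ, hbx⟩ := isPreconnected_univ (α := Hyp S e)
    (U (· ∈ Δ)) (U (· ∉ Δ)) (hU _ fun w hw k hk => mul_mem hw hk)
    (hU _ fun w hw k hk hwk => hk ((Subgroup.mul_mem_cancel_left _ hw).1 hwk))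
    (fun x _ => by
      obtain ⟨k, hk, hkx⟩ := h.exists_smul_mem hP hπ (hv 0) (hne 0) x
      by_cases hkΔ : k ∈ Δ
      · exact Or.inl ⟨k, hk, hkΔ, hkx⟩
      · exact Or.inr ⟨k, hk, hkΔ, hkx⟩)
    ⟨c, trivial, 1, one_mem _, one_mem _, Or.inl (by rw [one_smul]; exact subset_closure hc)⟩
    ⟨k⁻¹ • c, trivial, k, hk, hkΔ, Or.inl (by rw [smul_inv_smul]; exact subset_closure hc)⟩
  -- At a point of the overlap `a • x` and `b • x` differ by some `w ∈ Δ`; freeness gives `b = w *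
  -- a`, which lies in `Δ`, a contradiction.
  obtain ⟨w, hw, hwx⟩ := h.exists_mem_doubleGroup hP hπ hv hne hcov
    (x := a • x) (y := b • x) (by rw [h.smul a ha, h.smul b hb]) hax hbx
  have h1 : b⁻¹ * (w * a) = 1 := h.free _ (mul_mem (inv_mem hb) (mul_mem (hle hw) ha)) x (by
    rw [mul_smul, mul_smul, hwx, inv_smul_smul])
  have h2 : w * a = b := by rwa [inv_mul_eq_one, eq_comm] at h1
  exact hbΔ (h2 ▸ mul_mem hw haΔ)

/-- The group of the double acts cocompactly. -/
theorem IsUniformization.exists_bound {v : Fin (n + 1) → ℝ} (hv : IsFacet C v)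
    (hne : (hyperplane S e v).Nonempty) (o : Hyp S e) {R : ℝ}
    (hR : ∀ x ∈ closure C, ∃ γ ∈ pieceGroup Λ C, hdist o (γ • x) ≤ R) :
    ∃ R' : ℝ, ∀ x, ∃ k ∈ Γ, hdist o (k • x) ≤ R' := by
  set I := hypReflection e hv.pos with hI
  refine ⟨hdist o (I • o) + R, fun x => ?_⟩
  have h0 := hdist_nonneg o (I • o)
  obtain ⟨k, hk, hkx | hkx⟩ := h.exists_smul_mem hP hπ hv hne x
  · obtain ⟨γ, hγ, hle⟩ := hR _ hkx
    refine ⟨γ * k, mul_mem (h.pieceGroup_le hP hπ hγ) hk, ?_⟩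
    rw [mul_smul]
    linarith
  · obtain ⟨γ, hγ, hle⟩ := hR _ hkx
    refine ⟨I * γ * I * k, mul_mem (h.conj_mem hP hπ hv hne hγ) hk, ?_⟩
    have h1 := hdist_triangle o (I • o) (I • γ • I • k • x)
    rw [hdist_smul I] at h1
    simp only [mul_smul]
    linarith

end Generators

/-! ## Finiteness of integral vectors and matrices -/

section Arithmetic

theorem exists_norm_sq_le_of_definite {M : Matrix (Fin (n + 1)) (Fin (n + 1)) ℝ}
    (hM : M.PosDef ∨ (-M).PosDef) : ∃ C : ℝ, 0 < C ∧ ∀ y, ‖y‖ ^ 2 ≤ C * |bil M y y| := by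
  refine exists_norm_sq_le ?_ ?_ ?_
  · exact (continuous_bil M continuous_id continuous_id).abs
  · intro r y
    rw [bil_smul_left, bil_smul_right, ← mul_assoc, abs_mul, ← pow_two, abs_of_nonneg (sq_nonneg r)]
  · intro y hy
    refine abs_pos.2 ?_
    rcases hM with hM | hM
    · have := hM.dotProduct_mulVec_pos hy
      rw [star_trivial] at this
      exact this.ne'
    · have := hM.dotProduct_mulVec_pos hy
      rw [star_trivial, Matrix.neg_mulVec, dotProduct_neg] at this
      exact (neg_pos.1 this).ne

variable {K : Type*} [Field K] [NumberField K] [NumberField.IsTotallyReal K]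

omit [NumberField.IsTotallyReal K] in
instance finite_realEmbeddings : Finite (K →+* ℝ) :=
  Finite.of_injective (fun τ : K →+* ℝ => Complex.ofRealHom.comp τ) fun _ _ h =>
    RingHom.ext fun x => Complex.ofReal_injective (RingHom.congr_fun h x)

theorem exists_realEmbedding (φ : K →+* ℂ) : ∃ τ : K →+* ℝ, Complex.ofRealHom.comp τ = φ := by
  have h := NumberField.IsTotallyReal.complexEmbedding_isReal φ
  exact ⟨h.embedding, RingHom.ext fun x => h.coe_embedding_apply x⟩

variable {σ : K →+* ℝ} {A : Matrix (Fin (n + 1)) (Fin (n + 1)) K}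

/-- At a place other than `σ` the form is definite, so its value `c` bounds the vector; at `σ` the
bound is assumed. As `K` is totally real, all conjugates of the integral coordinates are then
bounded. -/
theorem finite_integral_vectors
    (hdef : ∀ τ : K →+* ℝ, τ ≠ σ → (A.map τ).PosDef ∨ (-(A.map τ)).PosDef) (c : K) (B : ℝ) :
    {w : Fin (n + 1) → NumberField.RingOfIntegers K |
      bil A (fun i => (w i : K)) (fun i => (w i : K)) = c ∧ ∀ i, |σ (w i)| ≤ B}.Finite := by
  have hτ : ∀ τ : K →+* ℝ, ∃ B' : ℝ, ∀ w : Fin (n + 1) → K,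
      bil A w w = c → (∀ i, |σ (w i)| ≤ B) → ∀ i, |τ (w i)| ≤ B' := by
    intro τ
    by_cases h : τ = σ
    · exact ⟨B, fun w _ hB => by rwa [h]⟩
    · obtain ⟨C, hC, hb⟩ := exists_norm_sq_le_of_definite (hdef τ h)
      refine ⟨Real.sqrt (C * |τ c|), fun w hw _ i => ?_⟩
      have h1 := hb fun k => τ (w k)
      rw [← map_bil, hw] at h1
      exact (norm_le_pi_norm (fun k => τ (w k)) i).trans (Real.le_sqrt_of_sq_le h1)
  choose B' hB' using hτ
  have hfin := NumberField.Embeddings.finite_of_norm_le K ℂ (⨆ τ, B' τ)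
  have hpi := Set.Finite.pi fun _ : Fin (n + 1) => hfin
  refine (hpi.preimage (f := fun (w : Fin (n + 1) → NumberField.RingOfIntegers K) i => (w i : K))
    (Function.Injective.injOn fun w w' h => funext fun i =>
      NumberField.RingOfIntegers.coe_injective (congrFun h i))).subset ?_
  rintro w ⟨hw, hwB⟩ i -
  refine ⟨NumberField.RingOfIntegers.isIntegral_coe (w i), fun φ => ?_⟩
  obtain ⟨τ, rfl⟩ := exists_realEmbedding φ
  rw [RingHom.comp_apply, Complex.ofRealHom_eq_coe, Complex.norm_real]
  exact (hB' τ _ hw hwB i).trans (le_ciSup (Finite.bddAbove_range B') τ)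

variable [Lorentzian (A.map σ)] [Timelike (A.map σ) e] {Λ : Subgroup ↥(PO (A.map σ) e)}

omit [NumberField.IsTotallyReal K] [NumberField K] in
theorem exists_integral_matrix {R : Type*} [CommRing R] {i : R →+* ℝ} {g : ↥(PO (A.map σ) e)}
    (hg : g ∈ POover (A.map σ) e i) :
    ∃ M : Matrix (Fin (n + 1)) (Fin (n + 1)) R, M.map i = g.1.1 := by
  obtain ⟨q, hq⟩ := hg
  exact ⟨q.1, congrArg Units.val hq⟩

/-- The `j`-th column of `g` is an integral vector on which the form has the value `A j j`, and
bounded displacement bounds its entries at `σ`. -/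
theorem properlyDiscontinuous_of_integral
    (hdef : ∀ τ : K →+* ℝ, τ ≠ σ → (A.map τ).PosDef ∨ (-(A.map τ)).PosDef)
    (hΛ : Λ ≤ POover (A.map σ) e (σ.comp (algebraMap (NumberField.RingOfIntegers K) K))) :
    ProperlyDiscontinuous Λ := by
  intro x R
  obtain ⟨B, hB⟩ := abs_le_of_hdist_le x R
  have hpi := Set.Finite.pi fun j : Fin (n + 1) =>
    (finite_integral_vectors hdef (A j j) B).image fun w i => σ (w i : K)
  refine (hpi.preimage (f := fun (g : ↥(PO (A.map σ) e)) j i => g.1.1 i j)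
    (Function.Injective.injOn fun g g' h => Subtype.ext (Units.ext (Matrix.ext fun i j =>
      congrFun (congrFun h j) i)))).subset ?_
  rintro g ⟨hg, hgR⟩ j -
  obtain ⟨M, hM⟩ := exists_integral_matrix (hΛ hg)
  have hM' : ∀ i j, σ (M i j : K) = g.1.1 i j := fun i j => by rw [← hM]; rfl
  refine ⟨fun i => M i j, ⟨σ.injective ?_, fun i => ?_⟩, funext fun i => hM' i j⟩
  · have h1 := bil_PO g (Pi.single j 1) (Pi.single j 1)
    rw [map_bil]
    simp only [hM']
    rw [Matrix.mulVec_single_one] at h1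
    exact h1.trans (by simp [bil])
  · rw [hM']
    exact hB g hgR i j

/-- After multiplication by a common denominator the translates of `v` become integral vectors of a
fixed norm. A hyperplane near `x` has a normal whose pairing with `x` is bounded, so the definite
form at `x` bounds the normal. -/
theorem finite_translates_of_integral
    (hdef : ∀ τ : K →+* ℝ, τ ≠ σ → (A.map τ).PosDef ∨ (-(A.map τ)).PosDef)
    (hΛ : Λ ≤ POover (A.map σ) e (σ.comp (algebraMap (NumberField.RingOfIntegers K) K)))
    (v : Fin (n + 1) → K) (x : Hyp (A.map σ) e) (R : ℝ) :
    {w | (∃ g ∈ Λ, w = g.1.1.mulVec fun i => σ (v i)) ∧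
      ∃ y ∈ hyperplane (A.map σ) e w, hdist x y ≤ R}.Finite := by
  obtain ⟨C, hC, hb⟩ := exists_norm_sq_le_bil x
  obtain ⟨d, hd⟩ := IsLocalization.exist_integer_multiples_of_finite
    (nonZeroDivisors (NumberField.RingOfIntegers K)) v
  choose u hu using hd
  have hd0 : ((d : NumberField.RingOfIntegers K) : K) ≠ 0 := by
    simp
  have hu' : ∀ i, ((u i : NumberField.RingOfIntegers K) : K) = d.1 * v i := fun i =>
    (hu i).trans (Algebra.smul_def _ _)
  set s : ℝ := σ (d.1 : K) with hs
  have hs0 : s ≠ 0 := (map_ne_zero σ).2 hd0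
  set b : ℝ := bil (A.map σ) (fun i => σ (v i)) fun i => σ (v i) with hbdef
  have hfin := (finite_integral_vectors hdef (bil A (fun i => (u i : K)) fun i => (u i : K))
    (|s| * Real.sqrt (C * (b + 2 * ((Real.cosh R ^ 2 - 1) * b))))).image
      fun w i => s⁻¹ * σ (w i : K)
  refine hfin.subset ?_
  rintro w ⟨⟨g, hg, rfl⟩, y, hy, hxy⟩
  obtain ⟨M, hM⟩ := exists_integral_matrix (hΛ hg)
  have hM' : ∀ i j, σ (M i j : K) = g.1.1 i j := fun i j => by rw [← hM]; rfl
  have hval : ∀ i, σ ((M.mulVec u i : NumberField.RingOfIntegers K) : K) =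
      s * g.1.1.mulVec (fun i => σ (v i)) i := by
    intro i
    simp only [Matrix.mulVec, dotProduct, map_sum, map_mul, Finset.mul_sum]
    refine Finset.sum_congr rfl fun j _ => ?_
    have h1 := congrArg σ (hu' j)
    rw [map_mul] at h1
    rw [hM']
    exact (congrArg _ h1).trans (by ring)
  have hR : 0 ≤ R := (hdist_nonneg x y).trans hxy
  set w := g.1.1.mulVec fun i => σ (v i) with hw
  have hww : bil (A.map σ) w w = b := bil_PO g _ _
  have hyw : bil (A.map σ) y.1 w = 0 := by rw [bil_comm]; exact hy
  have hb0 : 0 ≤ b := by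
    rw [← hww]
    exact bil_self_nonneg_of_orth (hyp_neg y) hyw
  -- Since `w` is orthogonal to `y`, its pairing with `x` only sees the component of `x` orthogonal
  -- to `y`, of squared length `cosh² d(x, y) - 1`.
  have hle : bil (A.map σ) x.1 w ^ 2 ≤ (Real.cosh R ^ 2 - 1) * b := by
    have h1 := bil_proj_sq_le (hyp_neg y) x.1 w
    have h2 := (hdist_le_iff hR).1 hxy
    have h3 := one_le_neg_bil x y
    rw [hyw, hww, hyp_self, hyp_self, bil_comm y.1 x.1] at h1
    have h4 : bil (A.map σ) x.1 y.1 ^ 2 ≤ Real.cosh R ^ 2 := by nlinarith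
    nlinarith [mul_le_mul_of_nonneg_right h4 hb0]
  refine ⟨M.mulVec u, ⟨σ.injective ?_, fun i => ?_⟩, funext fun i => ?_⟩
  · rw [map_bil, map_bil]
    simp only [hval, hu', map_mul]
    change bil _ (s • w) (s • w) = bil _ (s • fun i => σ (v i)) (s • fun i => σ (v i))
    simp only [bil_smul_left, bil_smul_right, hww, hbdef]
  · rw [hval, abs_mul]
    refine mul_le_mul_of_nonneg_left ?_ (abs_nonneg s)
    refine (norm_le_pi_norm w i).trans (Real.le_sqrt_of_sq_le ((hb w).trans ?_))
    rw [hww]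
    gcongr
  · change s⁻¹ * σ _ = _
    rw [hval, inv_mul_cancel_left₀ hs0]

end Arithmetic

/-! ## Restriction of scalars of an orthogonal group -/

section Restriction

variable {K : Type*} [Field K] [NumberField K]

instance : Fintype (K →+* ℝ) := Fintype.ofFinite _

instance : DecidableEq (K →+* ℝ) := Classical.decEq _

variable (n K) in
/-- The dimension of `Kⁿ⁺¹` over `ℚ`. -/
abbrev ratDim : ℕ := Module.finrank ℚ (Fin (n + 1) → K)

variable (n K) in
/-- A basis of `Kⁿ⁺¹` over `ℚ`. -/
def ratBasis : Module.Basis (Fin (ratDim n K)) ℚ (Fin (n + 1) → K) := Module.finBasis ℚ _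

variable (n K) in
/-- The map `Kⁿ⁺¹ ⊗ ℝ → ∏ ℝⁿ⁺¹`, the product being over the real places. -/
def placeMatrix : Matrix (Fin (n + 1) × (K →+* ℝ)) (Fin (ratDim n K)) ℝ :=
  Matrix.of fun p m => p.2 (ratBasis n K m p.1)

/-- The matrix of a `ℚ`-linear endomorphism of `Kⁿ⁺¹`. -/
def ratMatrix (f : (Fin (n + 1) → K) →ₗ[ℚ] (Fin (n + 1) → K)) :
    Matrix (Fin (ratDim n K)) (Fin (ratDim n K)) ℚ :=
  LinearMap.toMatrix (ratBasis n K) (ratBasis n K) f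

theorem realEmbedding_sum_ratBasis (τ : K →+* ℝ) (v : Fin (n + 1) → K) (a : Fin (n + 1)) :
    ∑ l, τ (ratBasis n K l a) * ((ratBasis n K).repr v l : ℝ) = τ (v a) := by
  conv_rhs => rw [← (ratBasis n K).sum_repr v]
  simp only [Finset.sum_apply, Pi.smul_apply, map_sum, Rat.smul_def, map_mul, map_ratCast]
  exact Finset.sum_congr rfl fun l _ => mul_comm _ _

theorem placeMatrix_mul_ratMatrix (f : (Fin (n + 1) → K) →ₗ[ℚ] (Fin (n + 1) → K)) :
    placeMatrix n K * (ratMatrix f).map (algebraMap ℚ ℝ) =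
      Matrix.of fun p m => p.2 (f (ratBasis n K m) p.1) := by
  ext p m
  simp only [Matrix.mul_apply, placeMatrix, Matrix.of_apply, Matrix.map_apply, ratMatrix,
    LinearMap.toMatrix_apply, eq_ratCast]
  exact realEmbedding_sum_ratBasis _ _ _

/-- Dedekind's independence of characters, applied to the real embeddings. -/
theorem eq_zero_of_sum_realEmbedding {c : (K →+* ℝ) → ℝ} (h : ∀ x : K, ∑ τ, c τ * τ x = 0) :
    c = 0 := by
  have hli : LinearIndependent ℝ fun τ : K →+* ℝ => (τ : K → ℝ) :=
    (linearIndependent_monoidHom K ℝ).comp (fun τ : K →+* ℝ => (τ : K →* ℝ)) fun τ τ' h =>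
      RingHom.ext fun x => DFunLike.congr_fun h x
  refine funext fun τ => Fintype.linearIndependent_iff.1 hli c (funext fun x => ?_) τ
  simpa [Finset.sum_apply] using h x

theorem placeMatrix_vecMul_injective :
    Function.Injective (fun c => Matrix.vecMul c (placeMatrix n K)) := by
  refine (injective_iff_map_eq_zero (Matrix.vecMulLinear (placeMatrix n K))).2 fun c hc => ?_
  have h1 : ∀ v : Fin (n + 1) → K, ∑ p : Fin (n + 1) × (K →+* ℝ), c p * p.2 (v p.1) = 0 := by
    intro v
    simp only [← realEmbedding_sum_ratBasis _ v, Finset.mul_sum, ← mul_assoc]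
    rw [Finset.sum_comm]
    refine Finset.sum_eq_zero fun l _ => ?_
    rw [← Finset.sum_mul]
    have h2 : ∑ p : Fin (n + 1) × (K →+* ℝ), c p * p.2 (ratBasis n K l p.1) = 0 := congrFun hc l
    rw [h2, zero_mul]
  have h2 : ∀ a, (fun τ => c (a, τ)) = 0 := by
    refine fun a => eq_zero_of_sum_realEmbedding fun x => ?_
    have h3 := h1 (Pi.single a x)
    rw [Fintype.sum_prod_type, Finset.sum_eq_single a] at h3
    · simpa using h3
    · intro b _ hb
      simp [Pi.single_eq_of_ne hb]
    · simp
  exact funext fun p => congrFun (h2 p.1) p.2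

variable [NumberField.IsTotallyReal K]

theorem card_realEmbedding : Fintype.card (K →+* ℝ) = Module.finrank ℚ K := by
  rw [← NumberField.Embeddings.card K ℂ]
  refine Fintype.card_of_bijective (f := fun τ : K →+* ℝ => Complex.ofRealHom.comp τ)
    ⟨fun τ τ' h => RingHom.ext fun x => Complex.ofReal_injective (RingHom.congr_fun h x),
      exists_realEmbedding⟩

theorem card_place :
    Fintype.card (Fin (n + 1) × (K →+* ℝ)) = Fintype.card (Fin (ratDim n K)) := by
  rw [Fintype.card_prod, card_realEmbedding, Fintype.card_fin, Fintype.card_fin, ratDim,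
    Module.finrank_pi_fintype]
  simp

/-- For totally real `K` the number of real places is the degree, so the matrix is square and the
independence of the embeddings makes it invertible. -/
theorem exists_placeMatrix_inverse :
    ∃ E' : Matrix (Fin (ratDim n K)) (Fin (n + 1) × (K →+* ℝ)) ℝ,
      placeMatrix n K * E' = 1 ∧ E' * placeMatrix n K = 1 := by
  obtain ⟨ε⟩ := Fintype.card_eq.1 (card_place (n := n) (K := K))
  have h1 : IsUnit ((placeMatrix n K).submatrix ε.symm id) := by
    rw [← Matrix.vecMul_injective_iff_isUnit]
    intro c c' h
    have h2 : ∀ c, Matrix.vecMul c ((placeMatrix n K).submatrix ε.symm id) =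
        Matrix.vecMul (c ∘ ε) (placeMatrix n K) := fun c => by
      ext m
      simp only [Matrix.vecMul, dotProduct, Matrix.submatrix_apply, id]
      exact (Fintype.sum_equiv ε _ _ fun p => by simp).symm
    simp only [h2] at h
    exact ε.surjective.injective_comp_right (placeMatrix_vecMul_injective h)
  obtain ⟨u, hu⟩ := h1
  have h2 : placeMatrix n K * (u⁻¹.1).submatrix id ε = 1 := by
    have h3 : placeMatrix n K = u.1.submatrix ε id := by rw [hu]; ext; simp
    rw [h3, show (u⁻¹.1).submatrix id ε = (u⁻¹.1).submatrix (Equiv.refl _) ε from rfl,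
      show u.1.submatrix ε id = u.1.submatrix ε (Equiv.refl _) from rfl,
      Matrix.submatrix_mul_equiv, Units.mul_inv, Matrix.submatrix_one_equiv]
  exact ⟨_, h2, (Matrix.mul_eq_one_comm_of_card_eq _ _ _ card_place).1 h2⟩

variable (n K) in
/-- The inverse of `placeMatrix`. -/
def placeMatrixInv : Matrix (Fin (ratDim n K)) (Fin (n + 1) × (K →+* ℝ)) ℝ :=
  (exists_placeMatrix_inverse (n := n) (K := K)).choose

theorem placeMatrix_mul_inv : placeMatrix n K * placeMatrixInv n K = 1 :=
  exists_placeMatrix_inverse.choose_spec.1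

theorem inv_mul_placeMatrix : placeMatrixInv n K * placeMatrix n K = 1 :=
  exists_placeMatrix_inverse.choose_spec.2

theorem algebraMap_trace_eq_sum (x : K) :
    algebraMap ℚ ℝ (Algebra.trace ℚ K x) = ∑ τ : K →+* ℝ, τ x := by
  apply Complex.ofReal_injective
  have h1 := trace_eq_sum_embeddings (K := ℚ) (L := K) ℂ (x := x)
  rw [Complex.ofReal_sum]
  refine Eq.trans (by simp) (h1.trans (Fintype.sum_bijective
    (fun τ : K →+* ℝ => (Complex.ofRealHom.comp τ).toRatAlgHom) ⟨fun τ τ' h => ?_, fun φ => ?_⟩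
    (fun τ => ((τ x : ℝ) : ℂ)) _ fun τ => rfl).symm)
  · exact RingHom.ext fun y => Complex.ofReal_injective (DFunLike.congr_fun h y)
  · obtain ⟨τ, hτ⟩ := exists_realEmbedding (φ : K →+* ℂ)
    exact ⟨τ, AlgHom.ext fun y => RingHom.congr_fun hτ y⟩

/-- The matrix of the trace form of `A` over `ℚ`. -/
def traceMatrix (A : Matrix (Fin (n + 1)) (Fin (n + 1)) K) :
    Matrix (Fin (ratDim n K)) (Fin (ratDim n K)) ℚ :=
  Matrix.of fun l m => Algebra.trace ℚ K (bil A (ratBasis n K l) (ratBasis n K m))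

/-- The trace is the sum over the real places, so over `ℝ` the trace form is the orthogonal sum of
the conjugate forms. -/
theorem map_traceMatrix (A : Matrix (Fin (n + 1)) (Fin (n + 1)) K) :
    (traceMatrix A).map (algebraMap ℚ ℝ) = (placeMatrix n K).transpose *
      Matrix.blockDiagonal (fun τ : K →+* ℝ => A.map τ) * placeMatrix n K := by
  ext l m
  rw [Matrix.map_apply, traceMatrix, Matrix.of_apply, algebraMap_trace_eq_sum, Matrix.mul_assoc,
    Matrix.mul_apply, Fintype.sum_prod_type, Finset.sum_comm]
  refine Finset.sum_congr rfl fun τ _ => ?_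
  rw [map_bil, bil, dotProduct]
  refine Finset.sum_congr rfl fun a _ => ?_
  simp only [Matrix.transpose_apply, placeMatrix, Matrix.of_apply, Matrix.mulVec, dotProduct,
    Matrix.mul_apply, Fintype.sum_prod_type, Matrix.blockDiagonal_apply, Matrix.map_apply]
  simp

end Restriction

/-! ## Groups of matrices that preserve a form and commute with given matrices -/

section FormGroup

variable {N : ℕ}

/-- The group of the matrices that commute with the elements of `𝓛` and preserve the bilinear form
with matrix `T`. -/
def formGroup {F : Type*} [CommRing F] (𝓛 : Set (Matrix (Fin N) (Fin N) F))
    (T : Matrix (Fin N) (Fin N) F) : Subgroup (GL (Fin N) F) where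
  carrier := {x | (∀ L ∈ 𝓛, x.1 * L = L * x.1) ∧ x.1.transpose * T * x.1 = T}
  one_mem' := by simp
  mul_mem' := by
    rintro x y ⟨hx, hx'⟩ ⟨hy, hy'⟩
    refine ⟨fun L hL => ?_, ?_⟩
    · rw [Units.val_mul, mul_assoc, hy L hL, ← mul_assoc, hx L hL, mul_assoc]
    · rw [Units.val_mul, Matrix.transpose_mul]
      calc _ = y.1.transpose * (x.1.transpose * T * x.1) * y.1 := by simp only [mul_assoc]
        _ = T := by rw [hx', hy']
  inv_mem' := by
    rintro x ⟨hx, hx'⟩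
    have h1 : x.1 * (x⁻¹).1 = 1 := Units.mul_inv x
    have h2 : (x⁻¹).1 * x.1 = 1 := Units.inv_mul x
    have h3 : (x⁻¹).1.transpose * x.1.transpose = 1 := by
      rw [← Matrix.transpose_mul, h1, Matrix.transpose_one]
    refine ⟨fun L hL => ?_, ?_⟩
    · calc (x⁻¹).1 * L = (x⁻¹).1 * (L * x.1) * (x⁻¹).1 := by
            rw [mul_assoc, mul_assoc, h1, mul_one]
        _ = L * (x⁻¹).1 := by rw [← hx L hL, ← mul_assoc, h2, one_mul]
    · calc (x⁻¹).1.transpose * T * (x⁻¹).1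
          = (x⁻¹).1.transpose * (x.1.transpose * T * x.1) * (x⁻¹).1 := by rw [hx']
        _ = ((x⁻¹).1.transpose * x.1.transpose) * T * (x.1 * (x⁻¹).1) := by simp only [mul_assoc]
        _ = T := by rw [h3, h1, one_mul, mul_one]

theorem mem_formGroup_map {F F' : Type*} [Field F] [Field F'] (i : F →+* F')
    (𝓛 : Set (Matrix (Fin N) (Fin N) F)) (T : Matrix (Fin N) (Fin N) F) (x : GL (Fin N) F) :
    Matrix.GeneralLinearGroup.map i x ∈ formGroup ((fun L => L.map i) '' 𝓛) (T.map i) ↔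
      x ∈ formGroup 𝓛 T := by
  have hinj : Function.Injective fun M : Matrix (Fin N) (Fin N) F => M.map i :=
    Matrix.map_injective i.injective
  have hval : (Matrix.GeneralLinearGroup.map i x).1 = x.1.map i := rfl
  change (∀ L ∈ _, _) ∧ _ ↔ (∀ L ∈ _, _) ∧ _
  rw [hval, Set.forall_mem_image, ← Matrix.transpose_map]
  simp only [← Matrix.map_mul]
  exact and_congr (forall₂_congr fun L _ => hinj.eq_iff) hinj.eq_iff

/-- The algebraic group over `ℚ` given by `formGroup`. -/
def formAlgGroup (𝓛 : Set (Matrix (Fin N) (Fin N) ℚ)) (T : Matrix (Fin N) (Fin N) ℚ) :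
    RatAlgGroup where
  N := N
  equations := {p | ∃ L ∈ 𝓛, ∃ i j, p = (Matrix.mvPolynomialX (Fin N) (Fin N) ℚ *
      L.map (algebraMap ℚ (MvPolynomial (Fin N × Fin N) ℚ)) -
      L.map (algebraMap ℚ (MvPolynomial (Fin N × Fin N) ℚ)) *
        Matrix.mvPolynomialX (Fin N) (Fin N) ℚ) i j} ∪
    {p | ∃ i j, p = ((Matrix.mvPolynomialX (Fin N) (Fin N) ℚ).transpose *
      T.map (algebraMap ℚ (MvPolynomial (Fin N × Fin N) ℚ)) *
        Matrix.mvPolynomialX (Fin N) (Fin N) ℚ -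
      T.map (algebraMap ℚ (MvPolynomial (Fin N × Fin N) ℚ))) i j}
  points := formGroup ((fun L => L.map (algebraMap ℚ ℂ)) '' 𝓛) (T.map (algebraMap ℚ ℂ))
  mem_points := by
    intro g
    set f : MvPolynomial (Fin N × Fin N) ℚ →ₐ[ℚ] ℂ :=
      MvPolynomial.aeval fun k : Fin N × Fin N => g.1 k.1 k.2 with hf
    have hX : (Matrix.mvPolynomialX (Fin N) (Fin N) ℚ).map f = g.1 :=
      Matrix.mvPolynomialX_mapMatrix_aeval ℚ g.1
    have hC : ∀ M : Matrix (Fin N) (Fin N) ℚ,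
        (M.map (algebraMap ℚ (MvPolynomial (Fin N × Fin N) ℚ))).map f =
          M.map (algebraMap ℚ ℂ) := fun M => by
      ext i j
      simp [Matrix.map_apply]
    have h1 : ∀ P : Matrix (Fin N) (Fin N) (MvPolynomial (Fin N × Fin N) ℚ),
        (∀ i j, f (P i j) = 0) ↔ P.map f = 0 := fun P =>
      ⟨fun h => Matrix.ext h, fun h i j => congrFun (congrFun h i) j⟩
    change (∀ L ∈ _, _) ∧ _ ↔ _
    rw [Set.forall_mem_image]
    have h2 : ∀ L : Matrix (Fin N) (Fin N) ℚ,
        (∀ i j, f ((Matrix.mvPolynomialX (Fin N) (Fin N) ℚ *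
          L.map (algebraMap ℚ (MvPolynomial (Fin N × Fin N) ℚ)) -
          L.map (algebraMap ℚ (MvPolynomial (Fin N × Fin N) ℚ)) *
            Matrix.mvPolynomialX (Fin N) (Fin N) ℚ) i j) = 0) ↔
        g.1 * L.map (algebraMap ℚ ℂ) = L.map (algebraMap ℚ ℂ) * g.1 := fun L => by
      rw [h1, Matrix.map_sub f (map_sub f), Matrix.map_mul, Matrix.map_mul, hX, hC, sub_eq_zero]
    have h3 : (∀ i j, f (((Matrix.mvPolynomialX (Fin N) (Fin N) ℚ).transpose *
          T.map (algebraMap ℚ (MvPolynomial (Fin N × Fin N) ℚ)) *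
            Matrix.mvPolynomialX (Fin N) (Fin N) ℚ -
          T.map (algebraMap ℚ (MvPolynomial (Fin N × Fin N) ℚ))) i j) = 0) ↔
        g.1.transpose * T.map (algebraMap ℚ ℂ) * g.1 = T.map (algebraMap ℚ ℂ) := by
      rw [h1, Matrix.map_sub f (map_sub f), Matrix.map_mul, Matrix.map_mul, Matrix.transpose_map,
        hX, hC, sub_eq_zero]
    rw [← h3]
    simp only [← h2]
    constructor
    · rintro ⟨ha, hb⟩ p (⟨L, hL, i, j, rfl⟩ | ⟨i, j, rfl⟩)
      · exact ha hL i j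
      · exact hb i j
    · exact fun h => ⟨fun L hL i j => h _ (Or.inl ⟨L, hL, i, j, rfl⟩),
        fun i j => h _ (Or.inr ⟨i, j, rfl⟩)⟩

theorem map_mem_formGroup_iff (𝓛 : Set (Matrix (Fin N) (Fin N) ℚ))
    (T : Matrix (Fin N) (Fin N) ℚ) (x : GL (Fin N) ℝ) :
    Matrix.GeneralLinearGroup.map (algebraMap ℝ ℂ) x ∈
        formGroup ((fun L => L.map (algebraMap ℚ ℂ)) '' 𝓛) (T.map (algebraMap ℚ ℂ)) ↔
      x ∈ formGroup ((fun L => L.map (algebraMap ℚ ℝ)) '' 𝓛) (T.map (algebraMap ℚ ℝ)) := by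
  have h1 : ∀ L : Matrix (Fin N) (Fin N) ℚ,
      (L.map (algebraMap ℚ ℝ)).map (algebraMap ℝ ℂ) = L.map (algebraMap ℚ ℂ) := fun L => by
    ext i j
    simp
  rw [← mem_formGroup_map (algebraMap ℝ ℂ), Set.image_image]
  simp only [h1]

theorem realPoints_formAlgGroup (𝓛 : Set (Matrix (Fin N) (Fin N) ℚ))
    (T : Matrix (Fin N) (Fin N) ℚ) : (formAlgGroup 𝓛 T).realPoints =
      formGroup ((fun L => L.map (algebraMap ℚ ℝ)) '' 𝓛) (T.map (algebraMap ℚ ℝ)) :=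
  Subgroup.ext (map_mem_formGroup_iff 𝓛 T)

variable (𝓛 : Set (Matrix (Fin N) (Fin N) ℝ)) (T : Matrix (Fin N) (Fin N) ℝ)

theorem isClosed_formGroup : IsClosed (formGroup 𝓛 T : Set (GL (Fin N) ℝ)) := by
  have hv : Continuous fun x : GL (Fin N) ℝ => x.1 := Units.continuous_val
  have h1 : (formGroup 𝓛 T : Set (GL (Fin N) ℝ)) =
      (⋂ L ∈ 𝓛, {x | x.1 * L = L * x.1}) ∩ {x | x.1.transpose * T * x.1 = T} := by
    ext x
    simp [formGroup]
  rw [h1]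
  exact (isClosed_biInter fun L _ => isClosed_eq (hv.matrix_mul continuous_const)
    (continuous_const.matrix_mul hv)).inter
    (isClosed_eq ((hv.matrix_transpose.matrix_mul continuous_const).matrix_mul hv) continuous_const)

variable {𝓛 T}

/-- The Cayley transform moves `x` to `1` inside the group. -/
theorem mem_connectedComponent_formGroup {x : ↥(formGroup 𝓛 T)}
    (hx : ∀ s ∈ Set.Icc (0 : ℝ) 2, ((2 : Matrix (Fin N) (Fin N) ℝ) + s • (x.1.1 - 1)).det ≠ 0) :
    x ∈ connectedComponent (1 : ↥(formGroup 𝓛 T)) := by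
  set u := x.1.1 - 1 with hu
  have hux : x.1.1 = 1 + u := by rw [hu]; abel
  -- The path is `t ↦ q (1 + t) * (q (1 - t))⁻¹`, which runs from `1` to `x`. With the Cayley
  -- transform `c = u (2 + u)⁻¹` it is `(1 + t c) (1 - t c)⁻¹`; this form only needs `q` to be
  -- invertible on `[0, 2]`.
  set q : ℝ → Matrix (Fin N) (Fin N) ℝ := fun s => 2 + s • u with hq
  have hqc : Continuous q := by fun_prop
  have hL : ∀ s, ∀ L ∈ 𝓛, q s * L = L * q s := fun s L hL => by
    have := x.2.1 L hL
    simp only [hq, hu, add_mul, mul_add, smul_mul_assoc, mul_smul_comm, sub_mul, mul_sub, this,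
      two_mul, mul_two, one_mul, mul_one]
  have hT : ∀ t, (q (1 + t)).transpose * T * q (1 + t) = (q (1 - t)).transpose * T * q (1 - t) := by
    intro t
    have h1 := x.2.2
    rw [hux, Matrix.transpose_add, Matrix.transpose_one, add_mul, add_mul, mul_add, mul_add,
      one_mul, mul_one, mul_one] at h1
    have h2 : T * u + u.transpose * T + u.transpose * T * u = 0 := by
      have h3 := sub_eq_zero.2 h1
      rw [← h3]
      abel
    -- The transformed form depends on `s` only through `2 s - s ^ 2`, which is symmetric about `s =
    -- 1`; hence the quotient of `q (1 + t)` by `q (1 - t)` preserves `T`.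
    have h4 : ∀ s, (q s).transpose * T * q s = 
        (4 : ℝ) • T + (2 * s - s ^ 2) • (T * u + u.transpose * T) := by
      intro s
      have h5 : u.transpose * T * u = -(T * u + u.transpose * T) := by
        rw [eq_neg_iff_add_eq_zero, ← h2]; abel
      have h6 : (2 : Matrix (Fin N) (Fin N) ℝ) = (2 : ℝ) • 1 := by
        ext i j
        simp [Matrix.ofNat_apply, Matrix.one_apply]
      simp only [hq, h6, Matrix.transpose_add, Matrix.transpose_smul, Matrix.transpose_one, add_mul,
        mul_add, smul_mul_assoc, mul_smul_comm, one_mul, mul_one, h5]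
      module
    rw [h4, h4]
    congr 2
    ring
  have hdet : ∀ t : Set.Icc (0 : ℝ) 1, IsUnit (q (1 + t)).det ∧ IsUnit (q (1 - t)).det := fun t =>
    ⟨(hx _ ⟨by linarith [t.2.1], by linarith [t.2.2]⟩).isUnit,
      (hx _ ⟨by linarith [t.2.2], by linarith [t.2.1]⟩).isUnit⟩
  have hval : ∀ t : Set.Icc (0 : ℝ) 1,
      (q (1 + t) * (q (1 - t))⁻¹) * (q (1 - t) * (q (1 + t))⁻¹) = 1 := fun t => by
    rw [mul_assoc, ← mul_assoc _ (q (1 - t)), Matrix.nonsing_inv_mul _ (hdet t).2, one_mul,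
      Matrix.mul_nonsing_inv _ (hdet t).1]
  let path : Set.Icc (0 : ℝ) 1 → GL (Fin N) ℝ := fun t =>
    ⟨q (1 + t) * (q (1 - t))⁻¹, q (1 - t) * (q (1 + t))⁻¹, hval t, mul_eq_one_comm.1 (hval t)⟩
  have hpath : ∀ t, path t ∈ formGroup 𝓛 T := by
    intro t
    have h1 : (path t).1 * q (1 - t) = q (1 + t) := by
      change q (1 + t) * (q (1 - t))⁻¹ * q (1 - t) = _
      rw [mul_assoc, Matrix.nonsing_inv_mul _ (hdet t).2, mul_one]
    obtain ⟨m, hm⟩ := (Matrix.isUnit_iff_isUnit_det _).2 (hdet t).2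
    have h2 : (path t).1 = q (1 + t) * m⁻¹.1 := by
      rw [← h1, ← hm, mul_assoc, Units.mul_inv, mul_one]
    refine ⟨fun L hL' => ?_, ?_⟩
    · have h3 : m⁻¹.1 * L = L * m⁻¹.1 := by
        rw [Units.inv_mul_eq_iff_eq_mul, ← mul_assoc, hm, hL _ L hL', mul_assoc, ← hm,
          Units.mul_inv, mul_one]
      rw [h2, mul_assoc, h3, ← mul_assoc, hL _ L hL', mul_assoc]
    · have h3 := hT t
      rw [← h1, Matrix.transpose_mul, ← hm] at h3
      have h4 : m⁻¹.1.transpose * m.1.transpose = 1 := by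
        rw [← Matrix.transpose_mul, Units.mul_inv, Matrix.transpose_one]
      calc (path t).1.transpose * T * (path t).1
          = (m⁻¹.1.transpose * m.1.transpose) * ((path t).1.transpose * T * (path t).1) *
            (m.1 * m⁻¹.1) := by rw [h4, Units.mul_inv, one_mul, mul_one]
        _ = m⁻¹.1.transpose * (m.1.transpose * (path t).1.transpose * T * ((path t).1 * m.1)) *
            m⁻¹.1 := by simp only [mul_assoc]
        _ = (m⁻¹.1.transpose * m.1.transpose) * T * (m.1 * m⁻¹.1) := by
            rw [h3]; simp only [mul_assoc]
        _ = T := by rw [h4, Units.mul_inv, one_mul, mul_one]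
  have hinv : ∀ f : Set.Icc (0 : ℝ) 1 → Matrix (Fin N) (Fin N) ℝ, Continuous f →
      (∀ t, IsUnit (f t).det) → Continuous fun t => (f t)⁻¹ := by
    intro f hf hf'
    simp only [Matrix.inv_def, Ring.inverse_eq_inv']
    exact (hf.matrix_det.inv₀ fun t => (hf' t).ne_zero).smul hf.matrix_adjugate
  have hc1 : Continuous fun t : Set.Icc (0 : ℝ) 1 => q (1 + t) :=
    hqc.comp (continuous_const.add continuous_subtype_val)
  have hc2 : Continuous fun t : Set.Icc (0 : ℝ) 1 => q (1 - t) :=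
    hqc.comp (continuous_const.sub continuous_subtype_val)
  have hcont : Continuous path := Units.continuous_iff.2
    ⟨hc1.matrix_mul (hinv _ hc2 fun t => (hdet t).2), hc2.matrix_mul (hinv _ hc1 fun t => (hdet t).1)⟩
  have hsub := (isPreconnected_range (hcont.subtype_mk hpath)).subset_connectedComponent
    (x := 1) ⟨⟨0, by simp⟩, ?_⟩
  · refine hsub ⟨⟨1, by simp⟩, Subtype.ext (Units.ext ?_)⟩
    have h6 : q 0 = 2 := by simp [hq]
    have h7 : q 2 = x.1.1 * 2 := by
      rw [hux]
      simp only [hq, mul_two, two_smul]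
      rw [← one_add_one_eq_two (R := Matrix (Fin N) (Fin N) ℝ)]
      abel
    have h8 := (hdet ⟨1, by simp⟩).2
    change q (1 + 1) * (q (1 - 1))⁻¹ = x.1.1
    simp only [sub_self] at h8 ⊢
    rw [one_add_one_eq_two, h7, ← h6, mul_assoc, Matrix.mul_nonsing_inv _ h8, mul_one]
  · refine Subtype.ext (Units.ext ?_)
    have h8 := (hdet ⟨0, by simp⟩).2
    change q (1 + 0) * (q (1 - 0))⁻¹ = 1
    simp only [sub_zero, add_zero] at h8 ⊢
    exact Matrix.mul_nonsing_inv _ h8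

-- Near `1` the matrices `q s` of the Cayley path are invertible for all `s` in the compact interval
-- `[0, 2]`, so the component contains a neighbourhood of `1`.
variable (𝓛 T) in
theorem isOpen_connectedComponent_formGroup :
    IsOpen (Subgroup.connectedComponentOfOne ↥(formGroup 𝓛 T) : Set ↥(formGroup 𝓛 T)) := by
  refine Subgroup.isOpen_of_mem_nhds _ (g := 1) ?_
  have hc : Continuous fun z : ↥(formGroup 𝓛 T) × ℝ =>
      ((2 : Matrix (Fin N) (Fin N) ℝ) + z.2 • (z.1.1.1 - 1)).det := by
    have h1 : Continuous fun z : ↥(formGroup 𝓛 T) × ℝ => z.1.1.1 :=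
      Units.continuous_val.comp (continuous_subtype_val.comp continuous_fst)
    exact (continuous_const.add (continuous_snd.smul (h1.sub continuous_const))).matrix_det
  have h2 := (isCompact_Icc (a := (0 : ℝ)) (b := 2)).eventually_forall_of_forall_eventually
    (x₀ := (1 : ↥(formGroup 𝓛 T)))
    (P := fun x s => ((2 : Matrix (Fin N) (Fin N) ℝ) + s • (x.1.1 - 1)).det ≠ 0) fun s _ => by
      refine hc.continuousAt.eventually_ne ?_
      have h6 : (2 : Matrix (Fin N) (Fin N) ℝ) = (2 : ℝ) • 1 := by
        ext i j
        simp [Matrix.ofNat_apply, Matrix.one_apply]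
      simp [h6]
  exact h2.mono fun x hx => mem_connectedComponent_formGroup hx

end FormGroup

/-! ## The real points of the restriction of scalars -/

section Places

variable {K : Type*} [Field K] [NumberField K]

variable (n K) in
/-- The matrices over `ℚ` of the multiplications by elements of `K`. -/
def scalarMatrices : Set (Matrix (Fin (ratDim n K)) (Fin (ratDim n K)) ℚ) :=
  Set.range fun k : K => ratMatrix (Algebra.lsmul ℚ ℚ (Fin (n + 1) → K) k)

variable [NumberField.IsTotallyReal K]

/-- The matrix that acts on the factors of `∏ ℝⁿ⁺¹` by the given matrices. -/
def realize (Y : (K →+* ℝ) → Matrix (Fin (n + 1)) (Fin (n + 1)) ℝ) :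
    Matrix (Fin (ratDim n K)) (Fin (ratDim n K)) ℝ :=
  placeMatrixInv n K * Matrix.blockDiagonal Y * placeMatrix n K

/-- The block of a matrix at a real place. -/
def place (x : Matrix (Fin (ratDim n K)) (Fin (ratDim n K)) ℝ) (τ : K →+* ℝ) :
    Matrix (Fin (n + 1)) (Fin (n + 1)) ℝ :=
  Matrix.blockDiag (placeMatrix n K * x * placeMatrixInv n K) τ

theorem placeMatrix_mul_mul_inv (x : Matrix (Fin (ratDim n K)) (Fin (ratDim n K)) ℝ) :
    placeMatrixInv n K * (placeMatrix n K * x * placeMatrixInv n K) * placeMatrix n K = x := by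
  calc _ = (placeMatrixInv n K * placeMatrix n K) * x * (placeMatrixInv n K * placeMatrix n K) := by
        simp only [Matrix.mul_assoc]
    _ = x := by rw [inv_mul_placeMatrix, Matrix.one_mul, Matrix.mul_one]

theorem placeMatrix_mul_mul (x y : Matrix (Fin (ratDim n K)) (Fin (ratDim n K)) ℝ) :
    placeMatrix n K * (x * y) * placeMatrixInv n K =
      (placeMatrix n K * x * placeMatrixInv n K) * (placeMatrix n K * y * placeMatrixInv n K) := by
  calc _ = placeMatrix n K * x * (1 : Matrix (Fin (ratDim n K)) (Fin (ratDim n K)) ℝ) * y *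
        placeMatrixInv n K := by rw [Matrix.mul_one]; simp only [Matrix.mul_assoc]
    _ = _ := by rw [← inv_mul_placeMatrix]; simp only [Matrix.mul_assoc]

theorem placeMatrix_mul_realize_mul (Y : (K →+* ℝ) → Matrix (Fin (n + 1)) (Fin (n + 1)) ℝ) :
    placeMatrix n K * realize Y * placeMatrixInv n K = Matrix.blockDiagonal Y := by
  calc _ = (placeMatrix n K * placeMatrixInv n K) * Matrix.blockDiagonal Y *
        (placeMatrix n K * placeMatrixInv n K) := by
        simp only [realize, Matrix.mul_assoc]
    _ = _ := by rw [placeMatrix_mul_inv, Matrix.one_mul, Matrix.mul_one]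

theorem place_realize (Y : (K →+* ℝ) → Matrix (Fin (n + 1)) (Fin (n + 1)) ℝ) (τ : K →+* ℝ) :
    place (realize Y) τ = Y τ := by
  rw [place, placeMatrix_mul_realize_mul, Matrix.blockDiag_blockDiagonal]

theorem realize_mul (Y Y' : (K →+* ℝ) → Matrix (Fin (n + 1)) (Fin (n + 1)) ℝ) :
    realize Y * realize Y' = realize fun τ => Y τ * Y' τ := by
  calc _ = placeMatrixInv n K * Matrix.blockDiagonal Y * (placeMatrix n K * placeMatrixInv n K) *
        Matrix.blockDiagonal Y' * placeMatrix n K := by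
        simp only [realize, Matrix.mul_assoc]
    _ = _ := by
      rw [placeMatrix_mul_inv, Matrix.mul_one, realize, Matrix.blockDiagonal_mul]
      simp only [Matrix.mul_assoc]

theorem realize_one :
    realize (fun _ => 1 : (K →+* ℝ) → Matrix (Fin (n + 1)) (Fin (n + 1)) ℝ) = 1 := by
  rw [realize, show (fun _ => 1 : (K →+* ℝ) → Matrix (Fin (n + 1)) (Fin (n + 1)) ℝ) = 1 from rfl,
    Matrix.blockDiagonal_one, Matrix.mul_one, inv_mul_placeMatrix]

theorem realize_map (M : Matrix (Fin (n + 1)) (Fin (n + 1)) K) :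
    realize (fun τ : K →+* ℝ => M.map τ) =
      (ratMatrix ((Matrix.toLin' M).restrictScalars ℚ)).map (algebraMap ℚ ℝ) := by
  have h1 : Matrix.blockDiagonal (fun τ : K →+* ℝ => M.map τ) * placeMatrix n K =
      placeMatrix n K * (ratMatrix ((Matrix.toLin' M).restrictScalars ℚ)).map (algebraMap ℚ ℝ) := by
    rw [placeMatrix_mul_ratMatrix]
    ext ⟨a, τ⟩ m
    rw [Matrix.mul_apply, Fintype.sum_prod_type]
    simp [Matrix.blockDiagonal_apply, placeMatrix, Matrix.mulVec, dotProduct, map_sum]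
  rw [realize, Matrix.mul_assoc, h1, ← Matrix.mul_assoc, inv_mul_placeMatrix, Matrix.one_mul]

theorem map_scalar (k : K) :
    (ratMatrix (Algebra.lsmul ℚ ℚ (Fin (n + 1) → K) k)).map (algebraMap ℚ ℝ) =
      realize fun τ : K →+* ℝ => Matrix.scalar (Fin (n + 1)) (τ k) := by
  have h1 : (Algebra.lsmul ℚ ℚ (Fin (n + 1) → K) k : (Fin (n + 1) → K) →ₗ[ℚ] (Fin (n + 1) → K)) =
      (Matrix.toLin' (Matrix.scalar (Fin (n + 1)) k)).restrictScalars ℚ := by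
    refine LinearMap.ext fun v => funext fun i => ?_
    simp
  rw [h1, ← realize_map]
  congr 1
  ext τ i j
  by_cases h : i = j <;> simp [h]

/-- In the coordinates of the real places an element `k` acts on the block of `τ` by the scalar `τ
k`. Two places are separated by some `k`, so a matrix commuting with all scalars has no off-diagonal
blocks. -/
theorem commute_scalars_iff (x : Matrix (Fin (ratDim n K)) (Fin (ratDim n K)) ℝ) :
    (∀ L ∈ (fun L => L.map (algebraMap ℚ ℝ)) '' scalarMatrices n K, x * L = L * x) ↔
      realize (place x) = x := by
  rw [Set.forall_mem_image, scalarMatrices, Set.forall_mem_range]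
  simp only [map_scalar]
  constructor
  · intro h
    suffices h1 : Matrix.blockDiagonal (place x) = placeMatrix n K * x * placeMatrixInv n K by
      rw [realize, h1, placeMatrix_mul_mul_inv]
    ext ⟨a, τ⟩ ⟨b, τ'⟩
    rw [Matrix.blockDiagonal_apply]
    split_ifs with hτ
    · simp only at hτ
      subst hτ
      rfl
    · obtain ⟨k, hk⟩ : ∃ k, τ k ≠ τ' k := by
        by_contra! h2
        exact hτ (RingHom.ext h2)
      have h2 := congrArg (fun z => placeMatrix n K * z * placeMatrixInv n K) (h k)
      simp only [placeMatrix_mul_mul, placeMatrix_mul_realize_mul] at h2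
      have h5 : (Matrix.blockDiagonal fun τ : K →+* ℝ => Matrix.scalar (Fin (n + 1)) (τ k)) =
          Matrix.diagonal fun p : Fin (n + 1) × (K →+* ℝ) => p.2 k := by
        simp only [Matrix.scalar_apply]
        exact Matrix.blockDiagonal_diagonal _
      have h6 := congrFun (congrFun h2 (a, τ)) (b, τ')
      rw [h5, Matrix.mul_diagonal, Matrix.diagonal_mul] at h6
      have h7 : (τ' k - τ k) * (placeMatrix n K * x * placeMatrixInv n K) (a, τ) (b, τ') = 0 := by
        linear_combination h6
      exact ((mul_eq_zero.1 h7).resolve_left (sub_ne_zero.2 hk.symm)).symm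
  · intro h k
    rw [← h, realize_mul, realize_mul]
    congr 1
    ext τ : 1
    exact ((Matrix.scalar_commute (τ k) (fun r => mul_comm _ _) (place x τ)).eq).symm

theorem preserves_trace_iff (A : Matrix (Fin (n + 1)) (Fin (n + 1)) K)
    (Y : (K →+* ℝ) → Matrix (Fin (n + 1)) (Fin (n + 1)) ℝ) :
    (realize Y).transpose * (traceMatrix A).map (algebraMap ℚ ℝ) * realize Y =
        (traceMatrix A).map (algebraMap ℚ ℝ) ↔
      ∀ τ, (Y τ).transpose * A.map τ * Y τ = A.map τ := by
  have h0 : placeMatrix n K * realize Y = Matrix.blockDiagonal Y * placeMatrix n K := by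
    rw [← placeMatrix_mul_realize_mul, Matrix.mul_assoc _ (placeMatrixInv n K), inv_mul_placeMatrix,
      Matrix.mul_one]
  have h1 : (realize Y).transpose * (traceMatrix A).map (algebraMap ℚ ℝ) * realize Y =
      (placeMatrix n K).transpose *
        Matrix.blockDiagonal (fun τ => (Y τ).transpose * A.map τ * Y τ) * placeMatrix n K := by
    rw [map_traceMatrix, Matrix.blockDiagonal_mul, Matrix.blockDiagonal_mul,
      ← Matrix.blockDiagonal_transpose]
    calc _ = (placeMatrix n K * realize Y).transpose *
          Matrix.blockDiagonal (fun τ : K →+* ℝ => A.map τ) * (placeMatrix n K * realize Y) := by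
          rw [Matrix.transpose_mul]; simp only [Matrix.mul_assoc]
      _ = _ := by rw [h0, Matrix.transpose_mul]; simp only [Matrix.mul_assoc]
  have h2 : ∀ B B' : (K →+* ℝ) → Matrix (Fin (n + 1)) (Fin (n + 1)) ℝ,
      (placeMatrix n K).transpose * Matrix.blockDiagonal B * placeMatrix n K =
        (placeMatrix n K).transpose * Matrix.blockDiagonal B' * placeMatrix n K → B = B' := by
    intro B B' h
    have h3 := congrArg (fun z => (placeMatrixInv n K).transpose * z * placeMatrixInv n K) h
    have h4 : ∀ B : (K →+* ℝ) → Matrix (Fin (n + 1)) (Fin (n + 1)) ℝ,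
        (placeMatrixInv n K).transpose * ((placeMatrix n K).transpose * Matrix.blockDiagonal B *
          placeMatrix n K) * placeMatrixInv n K = Matrix.blockDiagonal B := fun B => by
      calc _ = (placeMatrix n K * placeMatrixInv n K).transpose * Matrix.blockDiagonal B *
            (placeMatrix n K * placeMatrixInv n K) := by
            rw [Matrix.transpose_mul]; simp only [Matrix.mul_assoc]
        _ = _ := by rw [placeMatrix_mul_inv, Matrix.transpose_one, Matrix.one_mul, Matrix.mul_one]
    simp only [h4] at h3
    exact Matrix.blockDiagonal_injective h3
  rw [h1, map_traceMatrix]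
  exact ⟨fun h τ => congrFun (h2 _ _ h) τ, fun h => by simp only [h]⟩

/-- The real points of the restriction of scalars of the orthogonal group of `A`. -/
def resGroup (A : Matrix (Fin (n + 1)) (Fin (n + 1)) K) : Subgroup (GL (Fin (ratDim n K)) ℝ) :=
  formGroup ((fun L => L.map (algebraMap ℚ ℝ)) '' scalarMatrices n K)
    ((traceMatrix A).map (algebraMap ℚ ℝ))

variable {A : Matrix (Fin (n + 1)) (Fin (n + 1)) K}

theorem realize_place {x : GL (Fin (ratDim n K)) ℝ} (hx : x ∈ resGroup A) :
    realize (place x.1) = x.1 :=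
  (commute_scalars_iff x.1).1 hx.1

theorem place_preserves {x : GL (Fin (ratDim n K)) ℝ} (hx : x ∈ resGroup A) (τ : K →+* ℝ) :
    (place x.1 τ).transpose * A.map τ * place x.1 τ = A.map τ := by
  refine (preserves_trace_iff A (place x.1)).1 ?_ τ
  rw [realize_place hx]
  exact hx.2

theorem place_mul {x y : GL (Fin (ratDim n K)) ℝ} (hx : x ∈ resGroup A) (hy : y ∈ resGroup A)
    (τ : K →+* ℝ) : place (x * y).1 τ = place x.1 τ * place y.1 τ := by
  rw [Units.val_mul, ← realize_place hx, ← realize_place hy, realize_mul, place_realize,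
    place_realize, place_realize]

/-- The invertible matrix that acts on the factors by the given matrices. -/
def realizeGL (Y : (K →+* ℝ) → GL (Fin (n + 1)) ℝ) : GL (Fin (ratDim n K)) ℝ where
  val := realize fun τ => (Y τ).1
  inv := realize fun τ => ((Y τ)⁻¹).1
  val_inv := by simp only [realize_mul, Units.mul_inv, realize_one]
  inv_val := by simp only [realize_mul, Units.inv_mul, realize_one]

theorem realizeGL_mem {Y : (K →+* ℝ) → GL (Fin (n + 1)) ℝ}
    (hY : ∀ τ, (Y τ).1.transpose * A.map τ * (Y τ).1 = A.map τ) : realizeGL Y ∈ resGroup A := by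
  refine ⟨(commute_scalars_iff _).2 ?_, (preserves_trace_iff A _).2 hY⟩
  change realize (place (realize _)) = realize _
  simp only [funext (place_realize _)]

theorem continuous_realize : Continuous fun Y : (K →+* ℝ) →
    Matrix (Fin (n + 1)) (Fin (n + 1)) ℝ => realize Y :=
  (continuous_const.matrix_mul continuous_id.matrix_blockDiagonal).matrix_mul continuous_const

theorem continuous_place (τ : K →+* ℝ) :
    Continuous fun x : Matrix (Fin (ratDim n K)) (Fin (ratDim n K)) ℝ => place x τ :=
  (continuous_apply τ).comp
    (((continuous_const.matrix_mul continuous_id).matrix_mul continuous_const).matrix_blockDiag)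

/-- Multiplication by `M` is a `ℚ`-linear map of `Kⁿ⁺¹`; its rational matrix becomes the family of
all conjugates of `M` over the reals. -/
theorem realizeGL_isRational (M : GL (Fin (n + 1)) K) :
    ∃ q : GL (Fin (ratDim n K)) ℚ, Matrix.GeneralLinearGroup.map (algebraMap ℚ ℝ) q =
      realizeGL fun τ : K →+* ℝ => Matrix.GeneralLinearGroup.map τ M := by
  have h1 : ∀ M M' : Matrix (Fin (n + 1)) (Fin (n + 1)) K, M * M' = 1 →
      ratMatrix ((Matrix.toLin' M).restrictScalars ℚ) *
        ratMatrix ((Matrix.toLin' M').restrictScalars ℚ) = 1 := by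
    intro M M' h
    rw [ratMatrix, ratMatrix, ← LinearMap.toMatrix_mul,
      ← LinearMap.toMatrix_one (ratBasis n K)]
    congr 1
    refine LinearMap.ext fun v => ?_
    simp [h]
  exact ⟨⟨_, _, h1 _ _ M.mul_inv, h1 _ _ M.inv_mul⟩, Units.ext (realize_map M.1).symm⟩

variable (A) in
/-- The projection to the orthogonal group at a real place. -/
def placeHom (τ : K →+* ℝ) : ↥(resGroup A) →* GL (Fin (n + 1)) ℝ :=
  MonoidHom.toHomUnits
    { toFun := fun x => place x.1.1 τ
      map_one' := by
        change place 1 τ = 1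
        rw [← realize_one, place_realize]
      map_mul' := fun x y => place_mul x.2 y.2 τ }

theorem continuous_placeHom (τ : K →+* ℝ) : Continuous (placeHom A τ) := by
  have h1 : Continuous fun x : ↥(resGroup A) => place x.1.1 τ :=
    (continuous_place τ).comp (Units.continuous_val.comp continuous_subtype_val)
  exact Units.continuous_iff.2 ⟨h1, h1.comp continuous_inv⟩

theorem placeHom_realizeGL {Y : (K →+* ℝ) → GL (Fin (n + 1)) ℝ} (hY : realizeGL Y ∈ resGroup A)
    (τ : K →+* ℝ) : placeHom A τ ⟨realizeGL Y, hY⟩ = Y τ :=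
  Units.ext (place_realize _ τ)

end Places

/-! ## The projection to the isometry group of hyperbolic space -/

section Transvections

theorem bil_reflMatrix {v : Fin (n + 1) → ℝ} (hv : bil S v v ≠ 0) (y z : Fin (n + 1) → ℝ) :
    bil S ((reflMatrix S v).mulVec y) ((reflMatrix S v).mulVec z) = bil S y z := by
  simp only [reflMatrix_mulVec, bil_sub_left, bil_sub_right, bil_smul_left, bil_smul_right,
    bil_comm y v]
  field_simp
  ring

theorem bil_add_hyp (o p : Hyp S e) : bil S (o.1 + p.1) (o.1 + p.1) = 2 * (bil S o.1 p.1 - 1) := by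
  simp only [bil_add_left, bil_add_right, hyp_self, bil_comm p.1 o.1]
  ring

theorem bil_add_hyp_ne_zero (o p : Hyp S e) : bil S (o.1 + p.1) (o.1 + p.1) ≠ 0 := by
  rw [bil_add_hyp]
  have := bil_hyp_neg o p
  linarith

theorem reflMatrix_add_mulVec (o p : Hyp S e) :
    (reflMatrix S (o.1 + p.1)).mulVec o.1 = -p.1 := by
  have h1 := bil_hyp_neg o p
  have h2 : 2 / bil S (o.1 + p.1) (o.1 + p.1) * bil S (o.1 + p.1) o.1 = 1 := by
    have h3 : bil S (o.1 + p.1) o.1 = bil S o.1 p.1 - 1 := by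
      rw [bil_add_left, hyp_self, bil_comm p.1 o.1]
      ring
    rw [bil_add_hyp, h3]
    have : bil S o.1 p.1 - 1 ≠ 0 := by linarith
    field_simp
  rw [reflMatrix_mulVec, h2, one_smul]
  abel

/-- A continuous family of isometries that move `o` to any given point. -/
theorem exists_transvections (o : Hyp S e) :
    ∃ T : Hyp S e → ↥(PO S e), Continuous T ∧ T o = 1 ∧ ∀ p, T p • o = p := by
  -- The second reflection sends `o` to `-o` and the first sends `-o` to `p`. Sums of two points of
  -- the sheet are never isotropic, which gives continuity.
  let t : Hyp S e → GL (Fin (n + 1)) ℝ := fun p =>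
    reflGL S (o.1 + p.1) (bil_add_hyp_ne_zero o p) * reflGL S (o.1 + o.1) (bil_add_hyp_ne_zero o o)
  have ho : ∀ p, (t p).1.mulVec o.1 = p.1 := by
    intro p
    change (reflMatrix S (o.1 + p.1) * reflMatrix S (o.1 + o.1)).mulVec o.1 = p.1
    rw [← Matrix.mulVec_mulVec, reflMatrix_add_mulVec, Matrix.mulVec_neg, reflMatrix_add_mulVec,
      neg_neg]
  have ht : ∀ p, t p ∈ PO S e := by
    refine fun p => (mem_PO_iff o _).2 ⟨eq_of_forall_bil_eq fun y z => ?_, ?_⟩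
    · rw [← bil_mulVec_mulVec]
      change bil S ((reflMatrix S (o.1 + p.1) * reflMatrix S (o.1 + o.1)).mulVec y)
        ((reflMatrix S (o.1 + p.1) * reflMatrix S (o.1 + o.1)).mulVec z) = _
      rw [← Matrix.mulVec_mulVec, ← Matrix.mulVec_mulVec, bil_reflMatrix (bil_add_hyp_ne_zero o p),
        bil_reflMatrix (bil_add_hyp_ne_zero o o)]
    · rw [ho]
      exact bil_hyp_neg o p
  have hc : Continuous fun p : Hyp S e => reflMatrix S (o.1 + p.1) := by
    have h1 : Continuous fun p : Hyp S e => o.1 + p.1 := by fun_prop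
    exact continuous_const.sub ((continuous_const.div (continuous_bil S h1 h1)
      (bil_add_hyp_ne_zero o)).smul (h1.matrix_vecMulVec (h1.matrix_vecMul continuous_const)))
  refine ⟨fun p => ⟨t p, ht p⟩, Continuous.subtype_mk (Units.continuous_iff.2
    ⟨hc.matrix_mul continuous_const, ?_⟩) _, Subtype.ext (Units.ext ?_), fun p =>
      Subtype.ext (ho p)⟩
  · have h2 : ∀ p, (t p)⁻¹.1 = reflMatrix S (o.1 + o.1) * reflMatrix S (o.1 + p.1) := fun p => by
      simp only [t, mul_inv_rev, Units.val_mul]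
      rfl
    simp only [h2]
    exact continuous_const.matrix_mul hc
  · exact reflMatrix_mul_self (bil_add_hyp_ne_zero o o)

end Transvections

section Projection

theorem exists_bound_of_definite {M : Matrix (Fin (n + 1)) (Fin (n + 1)) ℝ}
    (hM : M.PosDef ∨ (-M).PosDef) : ∃ B : ℝ, ∀ h : Matrix (Fin (n + 1)) (Fin (n + 1)) ℝ,
      h.transpose * M * h = M → ∀ i j, |h i j| ≤ B := by
  obtain ⟨C, hC, hb⟩ := exists_norm_sq_le_of_definite hM
  refine ⟨⨆ j, Real.sqrt (C * |M j j|), fun h hh i j => ?_⟩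
  have h1 : bil M (h.mulVec (Pi.single j 1)) (h.mulVec (Pi.single j 1)) = M j j := by
    rw [bil_mulVec_mulVec, hh]
    simp [bil]
  have h2 := hb (h.mulVec (Pi.single j 1))
  rw [h1] at h2
  refine le_trans ?_ (le_ciSup (Finite.bddAbove_range fun j => Real.sqrt (C * |M j j|)) j)
  refine le_trans ?_ (Real.le_sqrt_of_sq_le h2)
  have h3 := norm_le_pi_norm (h.mulVec (Pi.single j 1)) i
  rw [Matrix.mulVec_single_one] at h3 ⊢
  exact h3

variable {K : Type*} [Field K] [NumberField K] [NumberField.IsTotallyReal K]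
  {σ : K →+* ℝ} {A : Matrix (Fin (n + 1)) (Fin (n + 1)) K}

/-- The matrices whose blocks are bounded by `B` have bounded entries. -/
theorem exists_bound_realize (B : (K →+* ℝ) → ℝ) :
    ∃ D : ℝ, ∀ Y : (K →+* ℝ) → Matrix (Fin (n + 1)) (Fin (n + 1)) ℝ,
      (∀ τ i j, |Y τ i j| ≤ B τ) → ∀ l m, |realize Y l m| ≤ D := by
  have hK : IsCompact (Set.pi Set.univ fun τ : K →+* ℝ =>
      {Y : Matrix (Fin (n + 1)) (Fin (n + 1)) ℝ | ∀ i j, |Y i j| ≤ B τ}) := by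
    refine isCompact_univ_pi fun τ => ?_
    have : {a : Matrix (Fin (n + 1)) (Fin (n + 1)) ℝ | ∀ i j, |a i j| ≤ B τ} =
        Set.pi Set.univ fun _ => Set.pi Set.univ fun _ => Set.Icc (-B τ) (B τ) := by
      ext a
      exact ⟨fun h i _ j _ => abs_le.1 (h i j), fun h i j => abs_le.2 (h i trivial j trivial)⟩
    rw [this]
    exact isCompact_univ_pi fun _ => isCompact_univ_pi fun _ => isCompact_Icc
  have h1 : ∀ p : Fin (ratDim n K) × Fin (ratDim n K), ∃ D : ℝ,
      ∀ Y : (K →+* ℝ) → Matrix (Fin (n + 1)) (Fin (n + 1)) ℝ,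
        (∀ τ i j, |Y τ i j| ≤ B τ) → |realize Y p.1 p.2| ≤ D := by
    intro p
    have hc : Continuous fun Y : (K →+* ℝ) → Matrix (Fin (n + 1)) (Fin (n + 1)) ℝ =>
        |realize Y p.1 p.2| := (continuous_realize.matrix_elem p.1 p.2).abs
    obtain ⟨D, hD⟩ := (hK.image hc).bddAbove
    exact ⟨D, fun Y hY => hD ⟨Y, fun τ _ => hY τ, rfl⟩⟩
  choose D hD using h1
  exact ⟨⨆ p, D p, fun Y hY l m => (hD (l, m) Y hY).trans
    (le_ciSup (Finite.bddAbove_range D) (l, m))⟩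

/-- The orthogonal groups at the places other than `σ` preserve definite forms and are bounded, so
bounds at `σ` suffice. -/
theorem isCompact_resGroup_of_bounded
    (hdef : ∀ τ : K →+* ℝ, τ ≠ σ → (A.map τ).PosDef ∨ (-(A.map τ)).PosDef) (B : ℝ) :
    IsCompact {x : ↥(resGroup A) | (∀ i j, |(placeHom A σ x).1 i j| ≤ B) ∧
      ∀ i j, |(placeHom A σ x)⁻¹.1 i j| ≤ B} := by
  have h1 : ∀ τ : K →+* ℝ, ∃ B' : ℝ, ∀ x : ↥(resGroup A),
      (∀ i j, |(placeHom A σ x).1 i j| ≤ B) → ∀ i j, |place x.1.1 τ i j| ≤ B' := by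
    intro τ
    by_cases h : τ = σ
    · subst h
      exact ⟨B, fun x hx => hx⟩
    · obtain ⟨B', hB'⟩ := exists_bound_of_definite (hdef τ h)
      exact ⟨B', fun x _ => hB' _ (place_preserves x.2 τ)⟩
  choose B' hB' using h1
  obtain ⟨D, hD⟩ := exists_bound_realize B'
  have hbd : ∀ x : ↥(resGroup A), (∀ i j, |(placeHom A σ x).1 i j| ≤ B) →
      ∀ l m, |x.1.1 l m| ≤ D := by
    intro x hx l m
    rw [← realize_place x.2]
    exact hD _ (fun τ => hB' τ x hx) l m
  have hemb : Topology.IsClosedEmbedding (Subtype.val : ↥(resGroup A) → GL _ ℝ) :=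
    (isClosed_formGroup _ _).isClosedEmbedding_subtypeVal
  refine (hemb.isCompact_preimage (isCompact_GL_of_bounded D)).of_isClosed_subset ?_ ?_
  · have h2 : Continuous fun x => (placeHom A σ x).1 :=
      Units.continuous_val.comp (continuous_placeHom σ)
    have h3 : Continuous fun x => (placeHom A σ x)⁻¹.1 :=
      Units.continuous_val.comp (continuous_placeHom σ).inv
    simp only [Set.ofPred_and, Set.ofPred_forall]
    exact (isClosed_iInter fun i => isClosed_iInter fun j =>
      isClosed_le (h2.matrix_elem i j).abs continuous_const).inter
      (isClosed_iInter fun i => isClosed_iInter fun j =>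
        isClosed_le (h3.matrix_elem i j).abs continuous_const)
  · rintro x ⟨hx, hx'⟩
    refine ⟨hbd x hx, hbd x⁻¹ ?_⟩
    rwa [map_inv]

variable [Lorentzian (A.map σ)] [Timelike (A.map σ) e]

/-- The pairing of `o` with its image never vanishes on the group and is `-1` at the identity, hence
stays negative on the identity component. -/
theorem placeHom_mem_PO {x : ↥(resGroup A)}
    (hx : x ∈ Subgroup.connectedComponentOfOne ↥(resGroup A)) :
    placeHom A σ x ∈ PO (A.map σ) e := by
  obtain ⟨o⟩ : Nonempty (Hyp (A.map σ) e) := inferInstance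
  set f : ↥(resGroup A) → ℝ := fun x => bil (A.map σ) o.1 ((place x.1.1 σ).mulVec o.1) with hf
  have hfc : Continuous f := by
    have h1 : Continuous fun x : ↥(resGroup A) => place x.1.1 σ :=
      (continuous_place σ).comp (Units.continuous_val.comp continuous_subtype_val)
    exact continuous_bil _ continuous_const (h1.matrix_mulVec continuous_const)
  have hf0 : ∀ x, f x ≠ 0 := by
    intro x h0
    have h1 := bil_mul_bil_le_sq (hyp_neg o) ((place x.1.1 σ).mulVec o.1)
    rw [bil_mulVec_mulVec, place_preserves x.2 σ, hyp_self] at h1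
    simp only [hf] at h0
    rw [h0] at h1
    norm_num at h1
  refine (mem_PO_iff o _).2 ⟨place_preserves x.2 σ, ?_⟩
  by_contra hcon
  have hf1 : f 1 = -1 := by
    have : place (1 : ↥(resGroup A)).1.1 σ = 1 := congrArg Units.val (map_one (placeHom A σ))
    simp only [hf]
    rw [this, Matrix.one_mulVec, hyp_self]
  obtain ⟨y, -, hy⟩ := isPreconnected_connectedComponent.intermediate_value
    (mem_connectedComponent (x := (1 : ↥(resGroup A)))) hx hfc.continuousOn
    ⟨by rw [hf1]; norm_num, not_lt.1 hcon⟩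
  exact hf0 y hy

/-- The isometry as an element of the factor at `σ`. -/
def embedPO (g : ↥(PO (A.map σ) e)) : ↥(resGroup A) :=
  ⟨realizeGL fun τ => if τ = σ then g.1 else 1, realizeGL_mem fun τ => by
    split_ifs with h
    · rw [h]
      exact g.2.1
    · simp⟩

theorem placeHom_embedPO (g : ↥(PO (A.map σ) e)) : placeHom A σ (embedPO g) = g.1 := by
  rw [embedPO, placeHom_realizeGL, if_pos rfl]

theorem embedPO_one : embedPO (1 : ↥(PO (A.map σ) e)) = 1 := by
  refine Subtype.ext (Units.ext ?_)
  change realize _ = 1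
  rw [← realize_one]
  congr 1
  ext τ : 1
  beta_reduce
  split_ifs <;> rfl

theorem continuous_embedPO : Continuous fun g : ↥(PO (A.map σ) e) => embedPO g := by
  refine Continuous.subtype_mk (Units.continuous_iff.2 ⟨?_, ?_⟩) _
  · refine continuous_realize.comp (continuous_pi fun τ => ?_)
    beta_reduce
    split_ifs
    · exact Units.continuous_val.comp continuous_subtype_val
    · exact continuous_const
  · refine continuous_realize.comp (continuous_pi fun τ => ?_)
    beta_reduce
    split_ifs
    · exact Units.continuous_val.comp (continuous_subtype_val.inv)
    · exact continuous_const

theorem embedPO_mem_connectedComponent {g : ↥(PO (A.map σ) e)}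
    (hg : g ∈ connectedComponent (1 : ↥(PO (A.map σ) e))) :
    embedPO g ∈ connectedComponent (1 : ↥(resGroup A)) := by
  have h1 := continuous_embedPO (A := A) (σ := σ) (e := e) |>.image_connectedComponent_subset 1
  have h2 := h1 ⟨g, hg, rfl⟩
  rwa [embedPO_one] at h2

variable (e σ A) in
/-- The projection of the identity component to the isometry group of hyperbolic space. -/
def projPO : ↥(Subgroup.connectedComponentOfOne ↥(resGroup A)) →* ↥(PO (A.map σ) e) :=
  ((placeHom A σ).comp (Subgroup.subtype _)).codRestrict _ fun x => placeHom_mem_PO x.2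

theorem continuous_projPO : Continuous (projPO e σ A) :=
  Continuous.subtype_mk ((continuous_placeHom σ).comp continuous_subtype_val) _

theorem projPO_mem (x : ↥(Subgroup.connectedComponentOfOne ↥(resGroup A))) :
    projPO e σ A x ∈ Subgroup.connectedComponentOfOne ↥(PO (A.map σ) e) := by
  have : PreconnectedSpace ↥(Subgroup.connectedComponentOfOne ↥(resGroup A)) :=
    Subtype.preconnectedSpace isPreconnected_connectedComponent
  exact (isPreconnected_range continuous_projPO).subset_connectedComponent
    ⟨1, map_one (projPO e σ A)⟩ ⟨x, rfl⟩

/-- An orthogonal matrix at `σ` that preserves the sheet lies in finitely many classes modulo the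
identity component. -/
theorem finite_classes
    (hdef : ∀ τ : K →+* ℝ, τ ≠ σ → (A.map τ).PosDef ∨ (-(A.map τ)).PosDef) :
    ((fun x : ↥(resGroup A) => (x : ↥(resGroup A) ⧸
      Subgroup.connectedComponentOfOne ↥(resGroup A))) ''
        {x | placeHom A σ x ∈ PO (A.map σ) e}).Finite := by
  obtain ⟨o⟩ : Nonempty (Hyp (A.map σ) e) := inferInstance
  obtain ⟨T, hTc, hT1, hTo⟩ := exists_transvections o
  -- Radius `0` singles out the stabiliser of `o`. Every class will be represented over it, and the
  -- image of a compact set in the discrete group of components is finite.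
  obtain ⟨B, hB⟩ := abs_le_of_hdist_le o 0
  have hcpt := isCompact_resGroup_of_bounded (A := A) hdef B
  have hdisc : DiscreteTopology (↥(resGroup A) ⧸ Subgroup.connectedComponentOfOne ↥(resGroup A)) :=
    QuotientGroup.discreteTopology (isOpen_connectedComponent_formGroup _ _)
  have hfin := (hcpt.image (f := fun x : ↥(resGroup A) => (x : ↥(resGroup A) ⧸
      Subgroup.connectedComponentOfOne ↥(resGroup A))) continuous_quotient_mk').finite_of_discrete
  refine hfin.subset ?_
  rintro _ ⟨x, hx, rfl⟩
  set g : ↥(PO (A.map σ) e) := ⟨placeHom A σ x, hx⟩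
  -- Transvections are joined to the identity through the connected hyperbolic space, so dividing by
  -- one does not change the component.
  have hTmem : embedPO (T (g • o)) ∈ connectedComponent (1 : ↥(resGroup A)) := by
    have h1 := (isPreconnected_range (continuous_embedPO.comp hTc)).subset_connectedComponent
      (x := (1 : ↥(resGroup A))) ⟨o, by simp only [Function.comp, hT1, embedPO_one]⟩
    exact h1 ⟨_, rfl⟩
  set s : ↥(resGroup A) := (embedPO (T (g • o)))⁻¹ * x with hs
  have hsg : placeHom A σ s = ((T (g • o))⁻¹ * g).1 := by
    rw [hs, map_mul, map_inv, placeHom_embedPO]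
    rfl
  have hfix : ((T (g • o))⁻¹ * g) • o = o := by
    rw [mul_smul, inv_smul_eq_iff, hTo]
  refine ⟨s, ⟨?_, ?_⟩, ?_⟩
  · rw [hsg]
    exact hB _ (by rw [hfix, hdist_self])
  · rw [hsg]
    refine hB ((T (g • o))⁻¹ * g)⁻¹ ?_
    rw [inv_smul_eq_iff.2 hfix.symm, hdist_self]
  · refine QuotientGroup.eq.2 ?_
    have h1 : s⁻¹ * x = x⁻¹ * embedPO (T (g • o)) * x := by rw [hs]; group
    rw [h1]
    have h2 := (show Continuous fun z : ↥(resGroup A) => x⁻¹ * z * x by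
      fun_prop).image_connectedComponent_subset 1 ⟨_, hTmem, rfl⟩
    simp only [mul_one, inv_mul_cancel] at h2
    exact h2

/-- Projection to the factor at `σ` is split by `embedPO`, hence surjective on identity components,
and its kernel is controlled by the definite places. The elements of `Γ` with a rational lift in the
identity component have finite index. -/
theorem exists_admissible_projection
    (hdef : ∀ τ : K →+* ℝ, τ ≠ σ → (A.map τ).PosDef ∨ (-(A.map τ)).PosDef)
    {Γ : Subgroup ↥(PO (A.map σ) e)} (hΓ : Γ ≤ POover (A.map σ) e σ) :
    ∃ φ : ↥(Subgroup.connectedComponentOfOne ↥(resGroup A)) →*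
        ↥(Subgroup.connectedComponentOfOne ↥(PO (A.map σ) e)),
      Continuous φ ∧ Function.Surjective φ ∧ 
        IsCompact (φ.ker : Set ↥(Subgroup.connectedComponentOfOne ↥(resGroup A))) ∧
      ∃ Γ' : Subgroup ↥(PO (A.map σ) e), Γ' ≤ Γ ∧ Γ'.relIndex Γ ≠ 0 ∧
        ∀ γ ∈ Γ', ∃ x, (∃ q : GL (Fin (ratDim n K)) ℚ,
          Matrix.GeneralLinearGroup.map (algebraMap ℚ ℝ) q = x.1.1) ∧ (φ x).1 = γ := by
  have hclosed : IsClosed (Subgroup.connectedComponentOfOne ↥(resGroup A) : Set ↥(resGroup A)) :=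
    isClosed_connectedComponent
  have hφc : Continuous ((projPO e σ A).codRestrict _ projPO_mem) :=
    Continuous.subtype_mk continuous_projPO _
  refine ⟨(projPO e σ A).codRestrict _ projPO_mem, hφc, ?_, ?_, ?_⟩
  · intro g
    exact ⟨⟨embedPO g.1, embedPO_mem_connectedComponent g.2⟩,
      Subtype.ext (Subtype.ext (placeHom_embedPO g.1))⟩
  · refine ((hclosed.isClosedEmbedding_subtypeVal).isCompact_preimage
      (isCompact_resGroup_of_bounded (A := A) hdef 1)).of_isClosed_subset ?_ ?_
    · exact isClosed_singleton.preimage hφc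
    · intro x hx
      have h1 : placeHom A σ x.1 = 1 := congrArg (fun z => z.1.1) (MonoidHom.mem_ker.1 hx)
      have h2 : ∀ i j, |(1 : Matrix (Fin (n + 1)) (Fin (n + 1)) ℝ) i j| ≤ 1 := fun i j => by
        rw [Matrix.one_apply]
        split_ifs <;> simp
      refine ⟨?_, ?_⟩
      · rw [h1]; exact h2
      · rw [h1, inv_one]; exact h2
  · let Q : Subgroup ↥(Subgroup.connectedComponentOfOne ↥(resGroup A)) :=
      ((Matrix.GeneralLinearGroup.map (n := Fin (ratDim n K)) (algebraMap ℚ ℝ)).range.comap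
        (Subgroup.subtype _)).comap (Subgroup.subtype _)
    refine ⟨Γ ⊓ Q.map (projPO e σ A), inf_le_left, ?_, ?_⟩
    -- A matrix over `K` that preserves the form at `σ` preserves it over `K`, hence at every place.
    -- Its conjugates form a rational point above `γ`, possibly outside the identity component.
    · have h1 : ∀ γ : ↥Γ, ∃ x : ↥(resGroup A), placeHom A σ x = γ.1.1 ∧
          x.1 ∈ (Matrix.GeneralLinearGroup.map (n := Fin (ratDim n K)) (algebraMap ℚ ℝ)).range := by
        intro γ
        obtain ⟨M, hM⟩ := hΓ γ.2
        have hM' : M.1.transpose * A * M.1 = A := by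
          refine Matrix.map_injective σ.injective ?_
          have h2 : M.1.map σ = γ.1.1.1 := congrArg Units.val hM
          simp only [Matrix.map_mul]
          rw [Matrix.transpose_map, h2]
          exact γ.1.2.1
        have hmem : realizeGL (fun τ : K →+* ℝ => Matrix.GeneralLinearGroup.map τ M) ∈
            resGroup A := by
          refine realizeGL_mem fun τ => ?_
          have h3 := congrArg (fun z => z.map τ) hM'
          simp only [Matrix.map_mul] at h3
          rwa [Matrix.transpose_map] at h3
        exact ⟨⟨_, hmem⟩, (placeHom_realizeGL hmem σ).trans hM, realizeGL_isRational M⟩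
      choose x hx hxQ using h1
      have hfin := (finite_classes (A := A) (e := e) hdef).to_subtype
      let f : ↥Γ ⧸ (Γ ⊓ Q.map (projPO e σ A)).subgroupOf Γ →
          ↥((fun x : ↥(resGroup A) => (x : ↥(resGroup A) ⧸
            Subgroup.connectedComponentOfOne ↥(resGroup A))) ''
              {x | placeHom A σ x ∈ PO (A.map σ) e}) := fun q =>
        ⟨_, x q.out, by
          rw [Set.mem_ofPred_eq, hx]
          exact q.out.1.2, rfl⟩
      -- If two rational lifts lie in one class, their quotient is rational, lies in the identity
      -- component and projects to the quotient of the two elements.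
      have hf : Function.Injective f := by
        intro q q' h
        have h2 := QuotientGroup.eq.1 (congrArg Subtype.val h)
        rw [← q.out_eq', ← q'.out_eq']
        refine QuotientGroup.eq.2 (Subgroup.mem_subgroupOf.2
          ⟨(q.out⁻¹ * q'.out).2, ⟨_, h2⟩, ?_, ?_⟩)
        · exact Subgroup.mul_mem _ (Subgroup.inv_mem _ (hxQ _)) (hxQ _)
        · refine Subtype.ext ?_
          change placeHom A σ ((x q.out)⁻¹ * x q'.out) = _
          rw [map_mul, map_inv, hx, hx]
          rfl
      have := Finite.of_injective f hf
      exact Subgroup.index_ne_zero_of_finite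
    · rintro γ ⟨-, y, hy, rfl⟩
      exact ⟨y, hy, rfl⟩

end Projection

/-! ## Lattices -/

section Lattice

/-- A cocompact action gives a compact set of isometries meeting every coset of `Γ`; compact sets
have finite Haar measure. -/
theorem isLattice_of_bound {Γ : Subgroup ↥(PO S e)} (hΓ : DiscreteTopology ↥Γ) (o : Hyp S e) {R : ℝ}
    (hR : ∀ x : Hyp S e, ∃ k ∈ Γ, hdist o (k • x) ≤ R) : IsLattice Γ := by
  refine ⟨hΓ, ?_⟩
  let : MeasurableSpace ↥(PO S e) := borel _
  have : BorelSpace ↥(PO S e) := ⟨rfl⟩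
  have hnhds : {g : ↥(PO S e) | hdist o (g • o) ≤ 1} ∈ nhds (1 : ↥(PO S e)) := by
    have h1 : Continuous fun g : ↥(PO S e) => hdist o (g • o) :=
      continuous_hdist continuous_const (by fun_prop)
    have h2 : (1 : ↥(PO S e)) ∈ {g : ↥(PO S e) | hdist o (g • o) < 1} := by
      rw [Set.mem_ofPred_eq, one_smul, hdist_self]
      exact one_pos
    exact Filter.mem_of_superset ((isOpen_lt h1 continuous_const).mem_nhds h2)
      fun g (hg : hdist o (g • o) < 1) => le_of_lt hg
  have : LocallyCompactSpace ↥(PO S e) :=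
    (isCompact_PO_of_bounded o 1).locallyCompactSpace_of_mem_nhds_of_group hnhds
  have hD := isCompact_PO_of_bounded o R
  refine ⟨MeasureTheory.Measure.haar, inferInstance, _, hD.isClosed.measurableSet,
    hD.measure_lt_top, fun g => ?_⟩
  obtain ⟨k, hk, h⟩ := hR (g • o)
  exact ⟨k, hk, by rwa [← mul_smul] at h⟩

/-- The images of the balls of integral radius form an increasing open cover of the compact
quotient. -/
theorem exists_bound_of_compactSpace {Λ : Subgroup ↥(PO S e)}
    [CompactSpace (Quotient (MulAction.orbitRel ↥Λ (Hyp S e)))] (o : Hyp S e) :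
    ∃ R : ℝ, ∀ x : Hyp S e, ∃ g ∈ Λ, hdist o (g • x) ≤ R := by
  obtain ⟨k, hk⟩ := isCompact_univ.elim_directed_cover
    (fun k : ℕ => (Quotient.mk (MulAction.orbitRel ↥Λ (Hyp S e))) '' {x | hdist o x < k})
    (fun k => isOpenMap_quotient_mk'_mul _ (isOpen_hball o k))
    (fun a _ => by
      obtain ⟨x, rfl⟩ := Quotient.exists_rep a
      obtain ⟨k, hk⟩ := exists_nat_gt (hdist o x)
      exact Set.mem_iUnion.2 ⟨k, x, hk, rfl⟩)
    (directed_of_isDirected_le fun i j hij => Set.image_mono fun x (hx : hdist o x < i) =>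
      hx.trans_le (Nat.cast_le.2 hij))
  refine ⟨k, fun x => ?_⟩
  obtain ⟨y, hy, h⟩ := hk (Set.mem_univ (Quotient.mk _ x))
  obtain ⟨g, hg⟩ := MulAction.orbitRel_apply.1 (Quotient.exact h)
  exact ⟨g.1, g.2, by rw [show g.1 • x = y from hg]; exact le_of_lt hy⟩

end Lattice

/-! ## Quasi-arithmeticity -/

section QuasiArithmetic

theorem conj_mem_connectedComponentOfOne {G : Type*} [Group G] [TopologicalSpace G]
    [IsTopologicalGroup G] (g : G) {x : G} (hx : x ∈ Subgroup.connectedComponentOfOne G) :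
    g * x * g⁻¹ ∈ Subgroup.connectedComponentOfOne G := by
  have h1 := (show Continuous fun z : G => g * z * g⁻¹ by
    fun_prop).image_connectedComponent_subset 1 ⟨x, hx, rfl⟩
  simp only [mul_one, mul_inv_cancel] at h1
  exact h1

variable {K : Type*} [Field K] [NumberField K] [NumberField.IsTotallyReal K]
  {σ : K →+* ℝ} {A : Matrix (Fin (n + 1)) (Fin (n + 1)) K}
  [Lorentzian (A.map σ)] [Timelike (A.map σ) e]

/-- Composing the projection with conjugation by `g` transports the rational structure from the
conjugate of `Γ` back to `Γ`. -/
theorem isQuasiArithmetic_of_conj_le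
    (hdef : ∀ τ : K →+* ℝ, τ ≠ σ → (A.map τ).PosDef ∨ (-(A.map τ)).PosDef)
    {Γ : Subgroup ↥(PO (A.map σ) e)} (hΓ : IsLattice Γ) (g : ↥(PO (A.map σ) e))
    (hg : Γ.map (MulAut.conj g⁻¹).toMonoidHom ≤ POover (A.map σ) e σ) : IsQuasiArithmetic Γ := by
  -- A variable group is used so that the equality of the real points with `resGroup A` can be
  -- substituted in the types depending on it.
  have key : ∀ 𝓖 : Subgroup (GL (Fin (ratDim n K)) ℝ), 𝓖 = resGroup A →
      ∃ φ : ↥(Subgroup.connectedComponentOfOne ↥𝓖) →*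
        ↥(Subgroup.connectedComponentOfOne ↥(PO (A.map σ) e)),
      Continuous φ ∧ Function.Surjective φ ∧
      IsCompact (φ.ker : Set ↥(Subgroup.connectedComponentOfOne ↥𝓖)) ∧
      ∃ Γ' : Subgroup ↥(PO (A.map σ) e), Γ' ≤ Γ ∧ Γ'.relIndex Γ ≠ 0 ∧
        ∀ γ ∈ Γ', ∃ x, (∃ q : GL (Fin (ratDim n K)) ℚ,
          Matrix.GeneralLinearGroup.map (algebraMap ℚ ℝ) q = x.1.1) ∧ (φ x).1 = γ := by
    rintro _ rfl
    obtain ⟨φ, hc, hs, hk, Γ', hle, hidx, hΓ'⟩ := exists_admissible_projection hdef hg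
    let ψ : ↥(Subgroup.connectedComponentOfOne ↥(resGroup A)) →*
        ↥(Subgroup.connectedComponentOfOne ↥(PO (A.map σ) e)) :=
      ((MulAut.conj g).toMonoidHom.comp ((Subgroup.subtype _).comp φ)).codRestrict _
        fun x => conj_mem_connectedComponentOfOne g (φ x).2
    have hψ : ∀ x, (ψ x).1 = g * (φ x).1 * g⁻¹ := fun x => rfl
    have hconj : ∀ Δ : Subgroup ↥(PO (A.map σ) e),
        (Δ.map (MulAut.conj g⁻¹).toMonoidHom).map (MulAut.conj g).toMonoidHom = Δ := by
      intro Δ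
      have h1 : (MulAut.conj g).toMonoidHom.comp (MulAut.conj g⁻¹).toMonoidHom =
          MonoidHom.id _ := MonoidHom.ext fun x => by simp; group
      rw [Subgroup.map_map, h1, Subgroup.map_id]
    have hψker : ψ.ker = φ.ker := by
      ext x
      rw [MonoidHom.mem_ker, MonoidHom.mem_ker, Subtype.ext_iff, Subtype.ext_iff, hψ]
      simp
    refine ⟨ψ, ?_, ?_, ?_, Γ'.map (MulAut.conj g).toMonoidHom, ?_, ?_, ?_⟩
    · exact ((continuous_const.mul (continuous_subtype_val.comp hc)).mul
        continuous_const).subtype_mk _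
    · intro y
      obtain ⟨x, hx⟩ := hs ⟨g⁻¹ * y.1 * g, by
        simpa using conj_mem_connectedComponentOfOne g⁻¹ y.2⟩
      refine ⟨x, Subtype.ext ?_⟩
      rw [hψ, hx]
      group
    · rwa [hψker]
    · rw [← hconj Γ]
      exact Subgroup.map_mono hle
    · rw [← hconj Γ, Subgroup.relIndex_map_map_of_injective _ _ (MulAut.conj g).injective]
      exact hidx
    · rintro _ ⟨γ, hγ, rfl⟩
      obtain ⟨x, hx, rfl⟩ := hΓ' γ hγ
      exact ⟨x, hx, rfl⟩
  obtain ⟨φ, hc, hs, hk, Γ', hle, hidx, hΓ'⟩ := key _ (realPoints_formAlgGroup _ _)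
  exact ⟨hΓ, formAlgGroup (scalarMatrices n K) (traceMatrix A), φ, ⟨hc, hs, hk⟩, Γ', hle, hidx, hΓ'⟩

end QuasiArithmetic

/-! ## The chamber of a segment and its rational facets -/

section Main

theorem openGeodesic_nonempty (p q : Hyp S e) : (openGeodesic p q).Nonempty :=
  closure_nonempty_iff.1 ⟨p, (subset_closure_openGeodesic p q).1⟩

theorem isChamber_componentOf {T : Set (Hyp S e)} {p q : Hyp S e} (h : openGeodesic p q ⊆ Tᶜ) :
    IsChamber T (componentOf T (openGeodesic p q)) := by
  obtain ⟨x, hx⟩ := openGeodesic_nonempty p q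
  refine ⟨x, h hx, Set.Subset.antisymm ?_ fun y hy => ⟨x, hx, hy⟩⟩
  rintro y ⟨x', hx', hy⟩
  rwa [connectedComponentIn_eq
    ((isPreconnected_openGeodesic p q).subset_connectedComponentIn hx h hx')]

theorem openGeodesic_subset_componentOf {T : Set (Hyp S e)} {p q : Hyp S e}
    (h : openGeodesic p q ⊆ Tᶜ) : openGeodesic p q ⊆ componentOf T (openGeodesic p q) :=
  fun x hx => ⟨x, hx, mem_connectedComponentIn (h hx)⟩

theorem IsArrangement.isPiece {Λ : Subgroup ↥(PO S e)} {𝓥 : Set (Fin (n + 1) → ℝ)}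
    {T C : Set (Hyp S e)} (hT : IsArrangement e 𝓥 T) (hC : IsChamber T C)
    (hpd : ProperlyDiscontinuous Λ) (hfree : ActsFreely Λ) : IsPiece Λ C where
  isOpen := hT.isOpen_chamber hC
  nonempty := hC.nonempty
  isPreconnected := hC.isPreconnected
  pd := hpd.mono inf_le_left
  free := hfree.mono inf_le_left

theorem POover_comp_le {R R' : Type*} [CommRing R] [CommRing R'] (i : R' →+* ℝ) (j : R →+* R') :
    POover S e (i.comp j) ≤ POover S e i := by
  rintro g ⟨M, hM⟩
  exact ⟨Matrix.GeneralLinearGroup.map j M, hM⟩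

variable {K : Type*} [Field K] {σ : K →+* ℝ} {A : Matrix (Fin (n + 1)) (Fin (n + 1)) K}
  [Lorentzian (A.map σ)] [Timelike (A.map σ) e]

theorem hypReflection_mem_POover {v : Fin (n + 1) → K}
    (hv : 0 < bil (A.map σ) (fun i => σ (v i)) fun i => σ (v i)) :
    hypReflection e hv ∈ POover (A.map σ) e σ := by
  have h1 : bil A v v ≠ 0 := by
    rw [← map_bil] at hv
    exact fun h => hv.ne' (by rw [h, map_zero])
  exact ⟨reflGL A v h1, Units.ext (map_reflMatrix σ A v)⟩

variable {Λ : Subgroup ↥(PO (A.map σ) e)} {v₀ v₁ : Fin (n + 1) → K} {C : Set (Hyp (A.map σ) e)}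

/-- A `K`-rational isometry sends a vector over `K` to a vector over `K`, and so does the change of
sign that puts `C` on the positive side. -/
theorem IsBoundarySystem.exists_facets
    (hT : IsArrangement e (normals Λ (fun i => σ (v₀ i)) fun i => σ (v₁ i))
      (arrangement Λ (hyperplane (A.map σ) e fun i => σ (v₀ i))
        (hyperplane (A.map σ) e fun i => σ (v₁ i))))
    (hC : IsChamber (arrangement Λ (hyperplane (A.map σ) e fun i => σ (v₀ i))
        (hyperplane (A.map σ) e fun i => σ (v₁ i))) C)
    (hΛ : Λ ≤ POover (A.map σ) e σ)
    (hne₀ : (hyperplane (A.map σ) e fun i => σ (v₀ i)).Nonempty)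
    (hne₁ : (hyperplane (A.map σ) e fun i => σ (v₁ i)).Nonempty)
    {m : ℕ} {H : Fin (m + 2) → Set (Hyp (A.map σ) e)}
    (hH : IsBoundarySystem Λ (hyperplane (A.map σ) e fun i => σ (v₀ i))
      (hyperplane (A.map σ) e fun i => σ (v₁ i)) C H) (j : Fin (m + 2)) :
    ∃ v : Fin (n + 1) → K, IsFacet C (fun i => σ (v i)) ∧
      (hyperplane (A.map σ) e fun i => σ (v i)).Nonempty ∧
      H j = hyperplane (A.map σ) e fun i => σ (v i) := by
  have key : ∀ v : Fin (n + 1) → K, (v = v₀ ∨ v = v₁) →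
      (hyperplane (A.map σ) e fun i => σ (v i)).Nonempty → ∀ g ∈ Λ,
      H j = g • hyperplane (A.map σ) e (fun i => σ (v i)) →
      ∃ v : Fin (n + 1) → K, IsFacet C (fun i => σ (v i)) ∧
        (hyperplane (A.map σ) e fun i => σ (v i)).Nonempty ∧
        H j = hyperplane (A.map σ) e fun i => σ (v i) := by
    intro v hv hne g hg hj
    obtain ⟨M, hM⟩ := exists_integral_matrix (hΛ hg)
    have hval : (fun i => σ (M.mulVec v i)) = g.1.1.mulVec fun i => σ (v i) := by
      rw [← hM]
      funext i
      simp [Matrix.mulVec, dotProduct, map_sum]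
    rw [smul_hyperplane, ← hval] at hj
    have hne' : (H j).Nonempty := by
      rw [hj, hval, ← smul_hyperplane]
      exact hne.smul_set
    obtain ⟨p, hp⟩ := hne'
    have hmem : (fun i => σ (M.mulVec v i)) ∈ normals Λ (fun i => σ (v₀ i)) fun i => σ (v₁ i) := by
      refine ⟨g, hg, ?_⟩
      rw [hval]
      rcases hv with rfl | rfl
      exacts [Or.inl rfl, Or.inr rfl]
    obtain ⟨w, hw, hwv, hwf⟩ := hT.exists_isFacet hC hmem (hj ▸ hp) (hH.subset_frontier j hp)
    obtain ⟨u, rfl⟩ : ∃ u : Fin (n + 1) → K, (fun i => σ (u i)) = w := by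
      rcases hw with rfl | rfl
      · exact ⟨_, rfl⟩
      · exact ⟨-M.mulVec v, funext fun i => by simp⟩
    rw [← hwv] at hj
    exact ⟨u, hwf, ⟨p, hj ▸ hp⟩, hj⟩
  obtain ⟨g, hg, h | h⟩ := hH.translate j
  · exact key v₀ (Or.inl rfl) hne₀ g hg h
  · exact key v₁ (Or.inr rfl) hne₁ g hg h

theorem doubleGroup_le_POover (hΛ : Λ ≤ POover (A.map σ) e σ) {m : ℕ}
    {I : Fin (m + 2) → ↥(PO (A.map σ) e)} (hI : ∀ j, I j ∈ POover (A.map σ) e σ) :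
    doubleGroup Λ C I ≤ POover (A.map σ) e σ := by
  have h1 : pieceGroup Λ C ≤ POover (A.map σ) e σ := inf_le_left.trans hΛ
  refine (Subgroup.closure_le _).2 ?_
  rintro _ ((hγ | ⟨γ, hγ, rfl⟩) | ⟨j, -, rfl⟩)
  · exact h1 hγ
  · exact mul_mem (mul_mem (inv_mem (hI 0)) (h1 hγ)) (hI 0)
  · exact mul_mem (inv_mem (hI j)) (hI 0)

theorem exists_bound_of_conj {Γ : Subgroup ↥(PO S e)} (g : ↥(PO S e)) (o : Hyp S e) {R : ℝ}
    (hR : ∀ x, ∃ k ∈ Γ.map (MulAut.conj g⁻¹).toMonoidHom, hdist o (k • x) ≤ R) (x : Hyp S e) :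
    ∃ k ∈ Γ, hdist (g • o) (k • x) ≤ R := by
  obtain ⟨_, ⟨k, hk, rfl⟩, h⟩ := hR (g⁻¹ • x)
  refine ⟨k, hk, ?_⟩
  rw [hdist_smul_left]
  simpa [mul_smul] using h

end Main

end Doubling

end

/-! ### The main theorem -/

open Doubling in
theorem mainTheorem4
    (n : ℕ) (hn : 2 ≤ n)
    -- an admissible pair over a totally real field, and a choice of sheet of the hyperboloid
    (K : Type*) [Field K] [NumberField K] [NumberField.IsTotallyReal K]
    (hK : Module.finrank ℚ K ≠ 1) (σ : K →+* ℝ)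
    (A : Matrix (Fin (n + 1)) (Fin (n + 1)) K) (hA : IsAdmissiblePair σ A)
    (e : Fin (n + 1) → ℝ) (he : bil (A.map σ) e e < 0)
    -- a torsion-free group of integral isometries with compact quotient
    (Λ : Subgroup ↥(PO (A.map σ) e))
    (hΛ : Λ ≤ POover (A.map σ) e (σ.comp (algebraMap (NumberField.RingOfIntegers K) K)))
    (hΛtf : ∀ g ∈ Λ, IsOfFinOrder g → g = 1)
    (hΛcpt : CompactSpace (Quotient (MulAction.orbitRel ↥Λ (Hyp (A.map σ) e))))
    -- two rational hyperplanes with disjoint embedded images in the quotient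
    (v₀ v₁ : Fin (n + 1) → K) (hv₀ : 0 < σ (bil A v₀ v₀)) (hv₁ : 0 < σ (bil A v₁ v₁))
    (H₀ H₁ : Set (Hyp (A.map σ) e))
    (hH₀ : H₀ = hyperplane (A.map σ) e (fun i => σ (v₀ i)))
    (hH₁ : H₁ = hyperplane (A.map σ) e (fun i => σ (v₁ i)))
    (hemb₀ : EmbeddedIn Λ H₀) (hemb₁ : EmbeddedIn Λ H₁)
    (hdisj : ∀ g ∈ Λ, Disjoint (g • H₀) H₁)
    -- their common perpendicular segment, whose interior lies in the complement of the translates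
    (p₀ p₁ : Hyp (A.map σ) e) (hp₀ : p₀ ∈ H₀) (hp₁ : p₁ ∈ H₁)
    (hperp₀ : (fun i => σ (v₀ i)) ∈ Submodule.span ℝ {p₀.1, p₁.1})
    (hperp₁ : (fun i => σ (v₁ i)) ∈ Submodule.span ℝ {p₀.1, p₁.1})
    (hseg : openGeodesic p₀ p₁ ⊆ (arrangement Λ H₀ H₁)ᶜ)
    -- the component of the complement containing that segment, and the double `M = Γ\ℍⁿ`
    (C : Set (Hyp (A.map σ) e))
    (hC : C = componentOf (arrangement Λ H₀ H₁) (openGeodesic p₀ p₁))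
    (Γ : Subgroup ↥(PO (A.map σ) e))
    (F : Quotient (MulAction.orbitRel ↥Γ (Hyp (A.map σ) e)) ≃ DoubledManifold Λ C)
    (hF : Uniformizes Λ C Γ F) :
    -- the boundary of the piece has between two and four components
    (∃ m : ℕ, m ≤ 2 ∧ ∃ H : Fin (m + 2) → Set (Hyp (A.map σ) e),
      IsBoundarySystem Λ H₀ H₁ C H) ∧
    -- the piece group consists of `K`-rational isometries
    pieceGroup Λ C ≤ POover (A.map σ) e σ ∧
    -- after a conjugation that makes `ℍⁿ → M` restrict on `closure C` to the projection onto the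
    -- first copy of the piece, `Γ` is `K`-rational and has the asserted generators
    (∃ g : ↥(PO (A.map σ) e),
      (∀ x : ↥(closure C),
        F (Quotient.mk _ (g • (x : Hyp (A.map σ) e))) = toFirstCopy Λ C x) ∧
      Γ.map (MulAut.conj g⁻¹).toMonoidHom ≤ POover (A.map σ) e σ ∧
      ∀ (m : ℕ) (H : Fin (m + 2) → Set (Hyp (A.map σ) e)), IsBoundarySystem Λ H₀ H₁ C H →
        (∀ j, ∃ v : Fin (n + 1) → K, 0 < σ (bil A v v) ∧
          H j = hyperplane (A.map σ) e (fun i => σ (v i))) ∧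
        ∃ I : Fin (m + 2) → ↥(PO (A.map σ) e),
          (∀ j, IsReflectionIn (I j) (H j)) ∧
          (∀ j, I j ∈ POover (A.map σ) e σ) ∧
          Γ.map (MulAut.conj g⁻¹).toMonoidHom =
            Subgroup.closure
              ((pieceGroup Λ C : Set ↥(PO (A.map σ) e)) ∪
                {x | ∃ γ ∈ pieceGroup Λ C, x = (I 0)⁻¹ * γ * I 0} ∪
                {x | ∃ j, j ≠ 0 ∧ x = (I j)⁻¹ * I 0})) ∧
    IsQuasiArithmetic Γ := by
  obtain ⟨hsymm, hsig, hdef⟩ := hA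
  have : Timelike (A.map σ) e := ⟨he⟩
  have : Lorentzian (A.map σ) := ⟨hsymm.map σ, ⟨e, he⟩, hsig.pos_of_orth⟩
  subst hH₀ hH₁
  have hv₀' : 0 < bil (A.map σ) (fun i => σ (v₀ i)) fun i => σ (v₀ i) := by rwa [← map_bil]
  have hv₁' : 0 < bil (A.map σ) (fun i => σ (v₁ i)) fun i => σ (v₁ i) := by rwa [← map_bil]
  have hpd := properlyDiscontinuous_of_integral hdef hΛ
  have hΛ' : Λ ≤ POover (A.map σ) e σ := hΛ.trans (POover_comp_le _ _)
  have hT := isArrangement_normals hv₀' hv₁' hemb₀ hemb₁ hdisj fun x R =>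
    ((finite_translates_of_integral hdef hΛ v₀ x R).union
      (finite_translates_of_integral hdef hΛ v₁ x R)).subset (by
        rintro w ⟨⟨g, hg, rfl | rfl⟩, hy⟩
        exacts [Or.inl ⟨⟨g, hg, rfl⟩, hy⟩, Or.inr ⟨⟨g, hg, rfl⟩, hy⟩])
  have hCh : IsChamber _ C := hC ▸ isChamber_componentOf hseg
  have hcl : closure (openGeodesic p₀ p₁) ⊆ closure C :=
    closure_mono (hC ▸ openGeodesic_subset_componentOf hseg)
  have hn₀ : (fun i => σ (v₀ i)) ∈ normals Λ (fun i => σ (v₀ i)) fun i => σ (v₁ i) :=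
    ⟨1, one_mem _, Or.inl (by simp)⟩
  have hn₁ : (fun i => σ (v₁ i)) ∈ normals Λ (fun i => σ (v₀ i)) fun i => σ (v₁ i) :=
    ⟨1, one_mem _, Or.inr (by simp)⟩
  -- The end point of the segment is in the closure of `C` and on the arrangement, hence in the
  -- frontier, and with it the whole hyperplane through it.
  have hsub₀ := hT.hyperplane_subset_frontier hCh hn₀ hp₀ ((hT.mem_frontier_iff hCh).2
    ⟨hcl (subset_closure_openGeodesic p₀ p₁).1, (hT.mem_iff _).2 ⟨_, hn₀, hp₀⟩⟩)
  have hsub₁ := hT.hyperplane_subset_frontier hCh hn₁ hp₁ ((hT.mem_frontier_iff hCh).2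
    ⟨hcl (subset_closure_openGeodesic p₀ p₁).2, (hT.mem_iff _).2 ⟨_, hn₁, hp₁⟩⟩)
  have hP : IsPiece Λ C := hT.isPiece hCh hpd (hpd.actsFreely hΛtf)
  have hU := hF.isUniformization
  obtain ⟨g, hg⟩ := hU.exists_normalization hP
  have hsys := exists_isBoundarySystem hT hCh hdisj ⟨p₀, hp₀⟩ ⟨p₁, hp₁⟩ hsub₀ hsub₁
  have key : ∀ (m : ℕ) (H : Fin (m + 2) → Set (Hyp (A.map σ) e)),
      IsBoundarySystem Λ (hyperplane (A.map σ) e fun i => σ (v₀ i))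
        (hyperplane (A.map σ) e fun i => σ (v₁ i)) C H →
      (∀ j, ∃ v : Fin (n + 1) → K, 0 < σ (bil A v v) ∧
        H j = hyperplane (A.map σ) e (fun i => σ (v i))) ∧
      ∃ I : Fin (m + 2) → ↥(PO (A.map σ) e), (∀ j, IsReflectionIn (I j) (H j)) ∧
        (∀ j, I j ∈ POover (A.map σ) e σ) ∧
        Γ.map (MulAut.conj g⁻¹).toMonoidHom = doubleGroup Λ C I := by
    intro m H hH
    choose v hv hne hHv using hH.exists_facets hT hCh hΛ' ⟨p₀, hp₀⟩ ⟨p₁, hp₁⟩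
    refine ⟨fun j => ⟨v j, ?_, hHv j⟩, fun j => hypReflection e (hv j).pos, fun j => ?_,
      fun j => hypReflection_mem_POover (hv j).pos,
      (hU.conj g).eq_doubleGroup hP hg hv hne fun x hx => ?_⟩
    · rw [map_bil]
      exact (hv j).pos
    · rw [hHv j]
      exact isReflectionIn_hypReflection _
    · obtain ⟨j, ⟨γ, hγ, h⟩, -⟩ := hH.existsUnique x hx
      exact ⟨j, γ, hγ, hHv j ▸ h⟩
  obtain ⟨m, -, H, hH⟩ := hsys
  obtain ⟨-, I, -, hI, hΓI⟩ := key m H hH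
  have hΓK : Γ.map (MulAut.conj g⁻¹).toMonoidHom ≤ POover (A.map σ) e σ :=
    hΓI ▸ doubleGroup_le_POover hΛ' hI
  obtain ⟨v, hv, hne, -⟩ := hH.exists_facets hT hCh hΛ' ⟨p₀, hp₀⟩ ⟨p₁, hp₁⟩ 0
  obtain ⟨R, hR⟩ := exists_bound_of_compactSpace (Λ := Λ) p₀
  -- Cocompactness passes from `Λ` to the piece group acting on `closure C`, then to the conjugate
  -- of `Γ` through the two copies, and finally back to `Γ`.
  obtain ⟨R', hR'⟩ := exists_bound_pieceGroup hT (fun k hk => arrangement_eq_of_mem Λ _ _ hk) hCh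
    p₀ hR
  obtain ⟨R'', hR''⟩ := (hU.conj g).exists_bound hP hg hv hne p₀ hR'
  exact ⟨exists_isBoundarySystem hT hCh hdisj ⟨p₀, hp₀⟩ ⟨p₁, hp₁⟩ hsub₀ hsub₁,
    inf_le_left.trans hΛ', ⟨g, hg, hΓK, key⟩, isQuasiArithmetic_of_conj_le hdef
      (isLattice_of_bound hF.discrete (g • p₀) (exists_bound_of_conj g p₀ hR'')) g hΓK⟩
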